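/- Let $k\ge 1$ be an integer and $k'=\lfloor (k-1)/2\rfloor$. Let $\mathrm{Kl}_2$ be the free $\mathbb C[z,z^{-1}]$-module with basis $v_0,v_1$ and connection $z\nabla_{\partial_z}v_0=v_1$, $z\nabla_{\partial_z}v_1=z\,v_0$ on $\mathbb G_m$, and let $\mathrm{Sym}^k\mathrm{Kl}_2$ be its $k$-th symmetric power, with basis $u_a=v_0^{k-a}v_1^a$ $(0\le a\le k)$. Endow it with the flat pairing $\langle\ ,\ \rangle_{\rm top}=(2\pi i)^k\langle\ ,\ \rangle_{\rm alg}$, where $\langle u_a,u_b\rangle_{\rm alg}=(-1)^a\frac{a!\,b!}{k!}$ if $a+b=k$ and $0$ otherwise. On $\mathbb C\setminus\mathbb R_{\le 0}$, with $t=2\sqrt z$, $\mathrm{Re}\,t>0$, consider the flat sections of $\mathrm{Kl}_2$ $$e_0=\tfrac t2 I_0'(t)\,v_0-I_0(t)\,v_1,\qquad e_1=\tfrac1{\pi i}\bigl(-\tfrac t2K_0'(t)\,v_0+K_0(t)\,v_1\bigr),$$ where $I_0,K_0$ are the modified Bessel functions of order $0$, and continue them analytically to multivalued flat sections on $\mathbb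 C^\times$. Let $\widetilde{\mathbb P}^1\cong[0,\infty]\times S^1$ be the real oriented blow-up of $\mathbb P^1$ at $0$ and $\infty$. The rapid decay (resp. moderate growth) homology $H_1^{\rm rd}(\mathbb G_m,\mathrm{Sym}^k\mathrm{Kl}_2)$ (resp. $H_1^{\rm mod}$) is the first homology, relative to $\partial\widetilde{\mathbb P}^1$, of the complex of twisted smooth singular chains $\sum\sigma\otimes e$ on $\widetilde{\mathbb P}^1$, where $e$ is a flat section of $\mathrm{Sym}^k\mathrm{Kl}_2$ along $\sigma$ that has rapid decay (resp. moderate growth) near each point of $\partial\widetilde{\mathbb P}^1$ met by $\sigma$. The Betti intersection pairing $\mathsf B: H_1^{\rm rd}\otimes H_1^{\rm mod}\to\mathbb C$ sends the classes of $a=\sum\sigma\otimes e$ and $b=\sum\tau\otimes f$ in general position (the simplices $\sigma$ and $\tau$ meet only over $\mathbb C^\times$, at interior points of both, and transversally) to the sum, over all intersection points of the $\sigma$ with the $\tau$, of the local intersection index $\pm1$ times $\langle e,f\rangle_{\rm top}$. Let $c_0^a$ be the unit circle starting at $1$ and run through $a$ times counterclockwise ($c_0=c_0^1$), $c_+=[1,\infty]$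 and $\mathbb R_+=[0,\infty]$, both oriented towards $+\infty$, the sections $e_0^je_1^{k-j}$ being the above determination at the starting point $1$ of $c_0^a$ and along $c_+$ and $\mathbb R_+$. Put $C_n(a)=\frac{(-1)^{a-1}}{na}\binom na$ and $$\alpha_0=c_0\otimes e_0^k,\qquad \alpha_i=-\frac{(-1)^{k-i}(k-i)!}{k-i+2}\,\alpha_0+c_+\otimes e_0^ie_1^{k-i}+\sum_{a=1}^{k-i+1}C_{k-i+1}(a)\,c_0^a\otimes e_0^{i-1}e_1^{k-i+1}\quad(1\le i\le k'),$$ $$\beta_j=\mathbb R_+\otimes e_0^je_1^{k-j}\quad(0\le j\le\lfloor k/2\rfloor).$$ Then $\alpha_0,\dots,\alpha_{k'}$ are rapid decay cycles, $\beta_0,\dots,\beta_{\lfloor k/2\rfloor}$ are moderate growth cycles and, for their homology classes and all $0\le j\le\lfloor k/2\rfloor$: the pairs $(\alpha_i,\beta_j)$ have representatives in general position, the intersection number does not depend on the choice of such representatives, $$\mathsf B(\alpha_0,\beta_j)=-\delta_{0,j},$$ and, for $1\le i\le k'$, $$\mathsf B(\alpha_i,\beta_j)=(-1)^{k-i}\,\frac{(k-i)!\,(k-j)!}{k!}\,\frac{B_{k-i-j+1}}{(k-i-j+1)!},$$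 where the Bernoulli numbers $B_n$ are defined by $\frac{x}{e^x-1}=\sum_{n\ge0}B_n\frac{x^n}{n!}$. -/

import Mathlib

open scoped Topology ContDiff Nat

namespace KloostermanBetti

noncomputable section

/-! ### The Kloosterman connection, its symmetric powers, and their flat sections

`Kl₂` is the free `ℂ[z, z⁻¹]`-module on `v₀, v₁` with `z∇v₀ = v₁`, `z∇v₁ = z v₀`, and `Sym^k Kl₂`
has the basis `u_a = v₀^(k-a) v₁^a`, `0 ≤ a ≤ k`.  A vector of a fibre is its family of
coefficients on `(u_a)`.  Multivalued sections on `ℂˣ` are functions of `ζ = log z ∈ ℂ`. -/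

/-- A multivalued section of `Sym^k Kl₂` on `ℂˣ`: its coefficients on `(u_a)`, as functions of
`ζ = log z` on the universal cover. -/
abbrev MultiSection (k : ℕ) : Type := ℂ → Fin (k + 1) → ℂ

/-- The matrix of `z∇` in the basis `(u_a)`: `z∇ u_b = (k - b) u_{b+1} + b z u_{b-1}`. -/
def connectionMatrix (k : ℕ) (z : ℂ) : Matrix (Fin (k + 1)) (Fin (k + 1)) ℂ :=
  Matrix.of fun a b =>
    if (a : ℕ) = b + 1 then (k : ℂ) - (b : ℕ)
    else if (a : ℕ) + 1 = b then ((b : ℕ) : ℂ) * z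
    else 0

/-- Flatness `∇ e = 0` of a multivalued section (recall `z ∂_z = ∂_ζ`). -/
def IsFlat (k : ℕ) (e : MultiSection k) : Prop :=
  ∀ ζ : ℂ, HasDerivAt e (-((connectionMatrix k (Complex.exp ζ)).mulVec (e ζ))) ζ

/-- The flat duality pairing `⟨ , ⟩_top = (2πi)^k ⟨ , ⟩_alg` on a fibre of `Sym^k Kl₂`, where
`⟨u_a, u_b⟩_alg = (-1)^a a! b! / k!` if `a + b = k` and `0` otherwise (the pairing induced by the
skew-symmetric pairing on `Kl₂` with `⟨v₀, v₁⟩_alg = 1`). -/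
def topPairing (k : ℕ) (m m' : Fin (k + 1) → ℂ) : ℂ :=
  (2 * Real.pi * Complex.I) ^ k *
    ∑ a : Fin (k + 1), ∑ b : Fin (k + 1),
      if (a : ℕ) + b = k then (-1) ^ (a : ℕ) * ((a : ℕ)! * (b : ℕ)! / k ! : ℂ) * m a * m' b else 0

/-- The modified Bessel function `I₀`. -/
def besselI0 (t : ℂ) : ℂ :=
  (2 * Real.pi * Complex.I)⁻¹ *
    ∮ y in C(0, 1), Complex.exp (-(t / 2) * (y + 1 / y)) / y

/-- The modified Bessel function `K₀`, for `Re t > 0`. -/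
def besselK0 (t : ℂ) : ℂ :=
  1 / 2 * ∫ y in Set.Ioi (0 : ℝ), Complex.exp (-(t / 2) * ((y : ℂ) + 1 / (y : ℂ))) / (y : ℂ)

/-- `t = 2 √z`, with `Re t > 0` when `|arg z| < π`. -/
def tCoord (ζ : ℂ) : ℂ := 2 * Complex.exp (ζ / 2)

/-- `e₀ = (t/2) I₀'(t) v₀ - I₀(t) v₁` on `ℂ ∖ ℝ_{≤ 0}`. -/
def e0Principal : MultiSection 1 := fun ζ =>
  ![tCoord ζ / 2 * deriv besselI0 (tCoord ζ), -besselI0 (tCoord ζ)]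

/-- `e₁ = (1/πi) (-(t/2) K₀'(t) v₀ + K₀(t) v₁)` on `ℂ ∖ ℝ_{≤ 0}`. -/
def e1Principal : MultiSection 1 := fun ζ =>
  ![-(tCoord ζ / 2 * deriv besselK0 (tCoord ζ)) / (Real.pi * Complex.I),
    besselK0 (tCoord ζ) / (Real.pi * Complex.I)]

/-- The analytic continuation to the universal cover of `ℂˣ` of a flat section `s` of `Kl₂` on
`ℂ ∖ ℝ_{≤ 0}`, that is, on the strip `|Im ζ| < π`. -/
def flatContinuation (s : MultiSection 1) : MultiSection 1 :=
  Classical.epsilon fun e => IsFlat 1 e ∧ ∀ ζ : ℂ, |ζ.im| < Real.pi → e ζ = s ζ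

/-- The multivalued flat section `e₀` of `Kl₂`. -/
def e0 : MultiSection 1 := flatContinuation e0Principal

/-- The multivalued flat section `e₁` of `Kl₂`. -/
def e1 : MultiSection 1 := flatContinuation e1Principal

/-- The section `e₀^j e₁^(k-j)` of `Sym^k Kl₂`, for `j ≤ k`.  The product is computed by
identifying `v₀^(k-a) v₁^a` with `X^a`. -/
def eMonomial (k j : ℕ) : MultiSection k := fun ζ a =>
  ((Polynomial.C (e0 ζ 0) + Polynomial.C (e0 ζ 1) * Polynomial.X) ^ j *
    (Polynomial.C (e1 ζ 0) + Polynomial.C (e1 ζ 1) * Polynomial.X) ^ (k - j)).coeff a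

/-! ### The real oriented blow-up of `ℙ¹` along `{0, ∞}`

It is the closed annulus `[0, ∞] × S¹` of pairs `(|z|, arg z)`.  With the coordinate
`ρ = |z| / (1 + |z|) ∈ [0, 1]`, which is a smooth boundary coordinate at both ends, its universal
cover is the strip `[0, 1] × ℝ` of pairs `q = (ρ, θ)`, and deck transformations are translations of
`θ` by multiples of `2π`.  The boundary circle over `0` is `ρ = 0`, the one over `∞` is `ρ = 1`. -/

/-- Points of the strip that lie over `ℂˣ`. -/
def openStrip : Set (ℝ × ℝ) := {q | 0 < q.1 ∧ q.1 < 1}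

/-- Points of the strip that lie over the boundary. -/
def boundaryStrip : Set (ℝ × ℝ) := {q | q.1 = 0 ∨ q.1 = 1}

/-- `ζ = log |z| + i θ` for `q = (ρ, θ)`, where `|z| = ρ / (1 - ρ)`. -/
def logCoord (q : ℝ × ℝ) : ℂ := (Real.log (q.1 / (1 - q.1)) : ℂ) + (q.2 : ℂ) * Complex.I

/-- The section `e` has rapid decay near the boundary point `p`.  Note that `ρ (1 - ρ)` is
comparable with `|z|` near `0` and with `1 / |z|` near `∞`. -/
def RapidDecayAt (k : ℕ) (e : MultiSection k) (p : ℝ × ℝ) : Prop :=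
  ∀ N : ℕ, (fun q => e (logCoord q)) =O[𝓝[openStrip] p] fun q => (q.1 * (1 - q.1)) ^ N

/-- The section `e` has moderate growth near the boundary point `p`. -/
def ModerateGrowthAt (k : ℕ) (e : MultiSection k) (p : ℝ × ℝ) : Prop :=
  ∃ N : ℕ, (fun q => e (logCoord q)) =O[𝓝[openStrip] p] fun q => ((q.1 * (1 - q.1)) ^ N)⁻¹

/-- A `C^∞` singular `n`-simplex of the blow-up, given by a lift to the strip. -/
@[ext] structure SmoothSimplex (n : ℕ) where
  toFun : stdSimplex ℝ (Fin (n + 1)) → ℝ × ℝ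
  smooth' : ∃ F : (Fin (n + 1) → ℝ) → ℝ × ℝ, ContDiff ℝ ∞ F ∧
    ∀ x : stdSimplex ℝ (Fin (n + 1)), toFun x = F (x : Fin (n + 1) → ℝ)
  mem_strip' : ∀ x, (toFun x).1 ∈ Set.Icc (0 : ℝ) 1

namespace SmoothSimplex

/-- The `i`-th face. -/
def face {n : ℕ} (σ : SmoothSimplex (n + 1)) (i : Fin (n + 2)) : SmoothSimplex n where
  toFun x := σ.toFun (stdSimplex.map i.succAbove x)
  smooth' := by
    obtain ⟨F, hF, h⟩ := σ.smooth'
    refine ⟨fun x => F (FunOnFinite.linearMap ℝ ℝ i.succAbove x), ?_, fun x => ?_⟩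
    · exact hF.comp
        (LinearMap.toContinuousLinearMap (FunOnFinite.linearMap ℝ ℝ i.succAbove)).contDiff
    · rw [h, stdSimplex.map_coe]
  mem_strip' x := σ.mem_strip' _

/-- The other lift of the same simplex, obtained by adding `2π` to the angle. -/
def deck {n : ℕ} (σ : SmoothSimplex n) : SmoothSimplex n where
  toFun x := σ.toFun x + (0, 2 * Real.pi)
  smooth' := by
    obtain ⟨F, hF, h⟩ := σ.smooth'
    exact ⟨fun x => F x + (0, 2 * Real.pi), hF.add contDiff_const, fun x => by rw [h]⟩
  mem_strip' x := by simpa using σ.mem_strip' x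

/-- The segment from `p` to `q` in the strip. -/
def segment (p q : ℝ × ℝ) (hp : p.1 ∈ Set.Icc (0 : ℝ) 1) (hq : q.1 ∈ Set.Icc (0 : ℝ) 1) :
    SmoothSimplex 1 where
  toFun x := x.1 0 • p + x.1 1 • q
  smooth' := by
    refine ⟨fun x => x 0 • p + x 1 • q, ?_, fun x => rfl⟩
    fun_prop
  mem_strip' x := by
    have h0 := x.2.1 0
    have h1 := x.2.1 1
    have hs : x.1 0 + x.1 1 = 1 := by simpa [Fin.sum_univ_two] using x.2.2
    exact (convex_Icc (0 : ℝ) 1) hp hq h0 h1 hs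

/-- A `1`-simplex as a path `[0, 1] → [0, 1] × ℝ`, extended by constants. -/
def path (σ : SmoothSimplex 1) (s : ℝ) : ℝ × ℝ :=
  σ.toFun (stdSimplexHomeomorphUnitInterval.symm (Set.projIcc 0 1 zero_le_one s))

end SmoothSimplex

/-! ### Twisted chains and homology

`G` is a growth condition at boundary points, `RapidDecayAt k` or `ModerateGrowthAt k`. -/

/-- Finite sums `∑ σ ⊗ e` of (lifted) simplices with multivalued sections. -/
abbrev Chain (k n : ℕ) : Type := SmoothSimplex n →₀ MultiSection k

/-- The boundary `σ ⊗ e ↦ ∑ (-1)^i σ_i ⊗ e`. -/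
def boundary (k n : ℕ) : Chain k (n + 1) →ₗ[ℂ] Chain k n :=
  Finsupp.lsum ℂ fun σ => ∑ i : Fin (n + 2), (-1 : ℂ) ^ (i : ℕ) • Finsupp.lsingle (σ.face i)

/-- `σ ⊗ e` is a twisted simplex: `e` is flat and satisfies the growth condition near every
boundary point of the blow-up which is met by `σ`. -/
def Admissible {k n : ℕ} (G : MultiSection k → ℝ × ℝ → Prop) (σ : SmoothSimplex n)
    (e : MultiSection k) : Prop :=
  IsFlat k e ∧ ∀ x, σ.toFun x ∈ boundaryStrip → G e (σ.toFun x)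

/-- The space of twisted chains with growth condition `G`. -/
def twistedChains {k : ℕ} (G : MultiSection k → ℝ × ℝ → Prop) (n : ℕ) : Submodule ℂ (Chain k n) :=
  Submodule.span ℂ {c | ∃ σ e, Admissible G σ e ∧ c = Finsupp.single σ e}

/-- The twisted chains that are considered as zero: those supported in the boundary of the blow-up,
and the differences of the two descriptions of a twisted simplex by means of two lifts, the one
having `2π` added to the angle. -/
def nullChains {k : ℕ} (G : MultiSection k → ℝ × ℝ → Prop) (n : ℕ) : Submodule ℂ (Chain k n) :=
  Submodule.span ℂ
    ({c | ∃ σ e, Admissible G σ e ∧ (∀ x, σ.toFun x ∈ boundaryStrip) ∧ c = Finsupp.single σ e} ∪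
      {c | ∃ (σ : SmoothSimplex n) (e : MultiSection k), Admissible G σ.deck e ∧
        c = Finsupp.single σ.deck e -
          Finsupp.single σ (fun ζ => e (ζ + 2 * Real.pi * Complex.I))})

/-- Twisted `1`-cycles, relative to the boundary of the blow-up. -/
def twistedCycles {k : ℕ} (G : MultiSection k → ℝ × ℝ → Prop) : Submodule ℂ (Chain k 1) :=
  twistedChains G 1 ⊓ (nullChains G 0).comap (boundary k 0)

/-- Twisted `1`-chains that are homologous to zero. -/
def twistedBoundaries {k : ℕ} (G : MultiSection k → ℝ × ℝ → Prop) : Submodule ℂ (Chain k 1) :=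
  (twistedChains G 2).map (boundary k 1) ⊔ nullChains G 1

/-- The first twisted homology with growth condition `G`: cycles modulo boundaries, realized as the
image of the cycles in the quotient of all chains by the boundaries. -/
abbrev TwistedHomology {k : ℕ} (G : MultiSection k → ℝ × ℝ → Prop) : Type :=
  (twistedCycles G).map (twistedBoundaries G).mkQ

/-- The cycles that compute rapid decay homology. -/
abbrev rdCycles (k : ℕ) : Submodule ℂ (Chain k 1) := twistedCycles (RapidDecayAt k)

/-- The cycles that compute moderate growth homology. -/
abbrev modCycles (k : ℕ) : Submodule ℂ (Chain k 1) := twistedCycles (ModerateGrowthAt k)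

/-- Rapid decay homology `H₁^rd(𝔾_m, Sym^k Kl₂)`. -/
abbrev RdHomology (k : ℕ) : Type := TwistedHomology (RapidDecayAt k)

/-- Moderate growth homology `H₁^mod(𝔾_m, Sym^k Kl₂)`. -/
abbrev ModHomology (k : ℕ) : Type := TwistedHomology (ModerateGrowthAt k)

/-- The homology class of a cycle. -/
def homologyClass {k : ℕ} {G : MultiSection k → ℝ × ℝ → Prop} (c : Chain k 1)
    (hc : c ∈ twistedCycles G) : TwistedHomology G :=
  ⟨(twistedBoundaries G).mkQ c, Submodule.mem_map_of_mem hc⟩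

/-! ### The Betti intersection pairing -/

/-- The pairs of parameters at which two paths pass through the same point of the blow-up. -/
def crossings (σ τ : SmoothSimplex 1) : Set (ℝ × ℝ) :=
  {p | p.1 ∈ Set.Icc (0 : ℝ) 1 ∧ p.2 ∈ Set.Icc (0 : ℝ) 1 ∧
    ∃ m : ℤ, σ.path p.1 = τ.path p.2 + (0, 2 * Real.pi * m)}

/-- The determinant of the tangent vectors of two paths, in the coordinates `(ρ, θ)`, which are
positively oriented. -/
def crossingDet (σ τ : SmoothSimplex 1) (p : ℝ × ℝ) : ℝ :=
  (deriv σ.path p.1).1 * (deriv τ.path p.2).2 - (deriv σ.path p.1).2 * (deriv τ.path p.2).1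

/-- Two chains are in general position if their simplices only meet over `ℂˣ`, at interior points
of both simplices, and transversally. -/
def InGeneralPosition {k : ℕ} (a b : Chain k 1) : Prop :=
  ∀ σ ∈ a.support, ∀ τ ∈ b.support, ∀ p ∈ crossings σ τ,
    p.1 ∈ Set.Ioo (0 : ℝ) 1 ∧ p.2 ∈ Set.Ioo (0 : ℝ) 1 ∧ σ.path p.1 ∈ openStrip ∧
      crossingDet σ τ p ≠ 0

/-- The intersection number of two chains in general position: the sum over all crossings of the
local intersection index `±1` times the pairing `⟨e, f⟩_top` of the coefficients at that point. -/
def intersectionNumber {k : ℕ} (a b : Chain k 1) : ℂ :=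
  a.sum fun σ e => b.sum fun τ f => ∑ᶠ p ∈ crossings σ τ,
    ((SignType.sign (crossingDet σ τ p) : ℤ) : ℂ) *
      topPairing k (e (logCoord (σ.path p.1))) (f (logCoord (τ.path p.2)))

/-- The Betti intersection pairing `H₁^rd ⊗ H₁^mod → ℂ`: `HasBettiPairing α β v` says that
`B(α, β) = v`, that is, the classes `α` and `β` have representatives in general position, and all
such representatives have intersection number `v`. -/
def HasBettiPairing {k : ℕ} (α : RdHomology k) (β : ModHomology k) (v : ℂ) : Prop :=
  (∃ (a : Chain k 1) (ha : a ∈ rdCycles k) (b : Chain k 1) (hb : b ∈ modCycles k),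
    homologyClass a ha = α ∧ homologyClass b hb = β ∧ InGeneralPosition a b) ∧
  ∀ (a : Chain k 1) (ha : a ∈ rdCycles k) (b : Chain k 1) (hb : b ∈ modCycles k),
    homologyClass a ha = α → homologyClass b hb = β → InGeneralPosition a b →
      intersectionNumber a b = v

theorem HasBettiPairing.unique {k : ℕ} {α : RdHomology k} {β : ModHomology k} {v w : ℂ}
    (hv : HasBettiPairing α β v) (hw : HasBettiPairing α β w) : v = w := by
  obtain ⟨⟨a, ha, b, hb, h1, h2, h3⟩, h⟩ := hv
  rw [← h a ha b hb h1 h2 h3, hw.2 a ha b hb h1 h2 h3]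

/-! ### The cycles `α_i` and `β_j` -/

/-- `c₀^n`: the unit circle, starting at `1` and run through `n` times counterclockwise. -/
def circle (n : ℕ) : SmoothSimplex 1 :=
  SmoothSimplex.segment (1 / 2, 0) (1 / 2, 2 * Real.pi * n) (by norm_num) (by norm_num)

/-- `c_+ = [1, ∞]`, oriented from `1` to `+∞`. -/
def cPlus : SmoothSimplex 1 :=
  SmoothSimplex.segment (1 / 2, 0) (1, 0) (by norm_num) (by norm_num)

/-- `ℝ_+ = [0, ∞]`, oriented from `0` to `+∞`. -/
def ray : SmoothSimplex 1 :=
  SmoothSimplex.segment (0, 0) (1, 0) (by norm_num) (by norm_num)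

/-- `C_n(a) = (-1)^(a-1) / (n a) * binom(n, a)`, for `1 ≤ a ≤ n`. -/
def coeffC (n a : ℕ) : ℂ := (-1) ^ (a - 1) / ((n : ℂ) * (a : ℂ)) * (n.choose a : ℂ)

/-- `α_0 = c₀ ⊗ e₀^k`. -/
def alphaZero (k : ℕ) : Chain k 1 := Finsupp.single (circle 1) (eMonomial k k)

/-- The twisted chain `α_i`, for `i = 0` and for `1 ≤ i ≤ k`. -/
def alphaChain (k i : ℕ) : Chain k 1 :=
  if i = 0 then alphaZero k
  else
    -(((-1 : ℂ) ^ (k - i) * ((k - i)! : ℂ)) / ((k - i + 2 : ℕ) : ℂ)) • alphaZero k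
      + Finsupp.single cPlus (eMonomial k i)
      + ∑ a ∈ Finset.Icc 1 (k - i + 1),
          coeffC (k - i + 1) a • Finsupp.single (circle a) (eMonomial k (i - 1))

/-- The twisted chain `β_j = ℝ_+ ⊗ e₀^j e₁^(k-j)`, for `0 ≤ j ≤ k`. -/
def betaChain (k j : ℕ) : Chain k 1 := Finsupp.single ray (eMonomial k j)

end

end KloostermanBetti

/-! The theorem has two halves: the intersection number depends only on homology classes, and it can
be computed on convenient representatives.

Invariance is proved by smearing. For a narrow bump `η` of integral one, `∫∫ η(γ s - δ t) cross(γ'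
s, δ' t)` equals the signed number of crossings of two transversal curves
(`meets_finite_and_eventually`), but it makes sense for all smooth curves and obeys Stokes' theorem
exactly (`stokes_square`). On the strip all translates by full turns are summed, each weighted by
the pairing of the branches of `e` and `f` that meet there. That weight is constant because the
pairing is flat (`topPairing_const`), so the boundary operators are adjoint for the smeared pairing
(`chainPairing_boundary`). Pieces lying on the boundary circles do not contribute: if they miss the
other simplex, a narrow bump does not see them, and if they meet it, a rapidly decaying and a
moderately growing flat section are orthogonal, their constant pairing having limit zero
(`isDual_rapidDecay_moderateGrowth`). This gives `intersectionNumber_eq_of_homologous`.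

For the computation, the equation `f'' = e^ζ f` has an entire solution in `e^ζ` and a logarithmic
one. Their behaviour at `-∞`, transported by constant Wronskians, identifies `I₀(2√z)` and `K₀(2√z)`
in this basis. Hence one turn around `0` sends `e₁` to `e₁ + e₀` and fixes `e₀`, and `2πi det(e₀,
e₁) = 1`. The integral representations bound `e₀` by `e^{Re t}` and `e₁` by `e^{-Re t}` near
infinity, up to powers of `|z|`, which gives the growth conditions on the monomials.

The ray carrying `β_j` overlaps `c_+`, so its end at infinity is rotated to angle `π/2`
(`homologyClass_diagonal`). The new path misses `c_+` and crosses `c₀^a` exactly `a` times, with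
index `-1`. After `m` turns the pairing of the monomials is a constant times a power of `m`
(`topPairing_eMonomial_turns`), so `c₀^a` contributes a power sum. The weights `C_n(a)` extract from
Faulhaber's formula the Bernoulli number, which is its linear coefficient in `a`, up to a top degree
term that occurs only for `j = 0` and is cancelled by the multiple of `α₀`
(`sum_coeffC_mul_sum_pow`). The same identity for `C_n(a)` makes `α_i` close up at `z = 1`
(`sum_coeffC_smul_eMonomial`). -/

namespace KloostermanBetti

noncomputable section

open MeasureTheory Filter Set

/-! ### Smeared intersection numbers in the plane and Stokes' theorem -/

/-- The determinant of two plane vectors. -/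
def cross (u v : ℝ × ℝ) : ℝ := u.1 * v.2 - u.2 * v.1

/-- The smeared intersection number of two plane curves. -/
def curveKernel (η : ℝ × ℝ → ℝ) (γ δ : ℝ → ℝ × ℝ) : ℝ :=
  ∫ t in (0 : ℝ)..1, ∫ s in (0 : ℝ)..1, η (γ s - δ t) * cross (deriv γ s) (deriv δ t)

/-- The smeared degree of a map from the unit square to the plane over a point. -/
def squareKernel (η : ℝ × ℝ → ℝ) (S : ℝ × ℝ → ℝ × ℝ) (p : ℝ × ℝ) : ℝ :=
  ∫ s in (0 : ℝ)..1, ∫ r in (0 : ℝ)..1,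
    η (S (s, r) - p) * cross (fderiv ℝ S (s, r) (1, 0)) (fderiv ℝ S (s, r) (0, 1))

theorem continuous_cross {X : Type*} [TopologicalSpace X] {f g : X → ℝ × ℝ} (hf : Continuous f)
    (hg : Continuous g) : Continuous fun x => cross (f x) (g x) := by
  unfold cross; fun_prop

/-- Three plane vectors satisfy `cross v w • u - cross u w • v + cross u v • w = 0`; apply `l`. -/
theorem cross_identity (l : ℝ × ℝ →L[ℝ] ℝ) (u v w : ℝ × ℝ) :
    l u * cross v w - l v * cross u w = -(l w * cross u v) := by
  have h : ∀ x : ℝ × ℝ, l x = x.1 * l (1, 0) + x.2 * l (0, 1) := by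
    intro x
    conv_lhs => rw [show x = x.1 • ((1, 0) : ℝ × ℝ) + x.2 • ((0, 1) : ℝ × ℝ) by ext <;> simp]
    rw [map_add, map_smul, map_smul, smul_eq_mul, smul_eq_mul]
  rw [h u, h v, h w]
  unfold cross
  ring

/-- The divergence theorem for the pullback by `S` of the one-form `η(x - p) cross(dx, w)`. The
second derivatives of `S` cancel by symmetry, and `cross_identity` turns the remaining terms into a
derivative of `η` along `w`. -/
theorem green_square {η : ℝ × ℝ → ℝ} (hη : ContDiff ℝ ∞ η) {S : ℝ × ℝ → ℝ × ℝ}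
    (hS : ContDiff ℝ ∞ S) (p w : ℝ × ℝ) :
    (∫ r in (0 : ℝ)..1, η (S (1, r) - p) * cross (fderiv ℝ S (1, r) (0, 1)) w)
      - (∫ r in (0 : ℝ)..1, η (S (0, r) - p) * cross (fderiv ℝ S (0, r) (0, 1)) w)
      - (∫ s in (0 : ℝ)..1, η (S (s, 1) - p) * cross (fderiv ℝ S (s, 1) (1, 0)) w)
      + (∫ s in (0 : ℝ)..1, η (S (s, 0) - p) * cross (fderiv ℝ S (s, 0) (1, 0)) w)
    = ∫ s in (0 : ℝ)..1, ∫ r in (0 : ℝ)..1,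
        -(fderiv ℝ η (S (s, r) - p) w) *
          cross (fderiv ℝ S (s, r) (1, 0)) (fderiv ℝ S (s, r) (0, 1)) := by
  have hS1 : ContDiff ℝ ∞ (fderiv ℝ S) := hS.fderiv_right (by simp)
  have hη1 : ContDiff ℝ ∞ (fderiv ℝ η) := hη.fderiv_right (by simp)
  have hSd := fun x => (hS.differentiable (by simp) x).hasFDerivAt
  have hS1d := fun x => (hS1.differentiable (by simp) x).hasFDerivAt
  have hηd := fun x => (hη.differentiable (by simp) x).hasFDerivAt
  have key : ∀ v : ℝ × ℝ, ∀ x, HasFDerivAt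
      (fun x => η (S x - p) * cross (fderiv ℝ S x v) w) _ x := fun v x =>
    ((hηd (S x - p)).comp x ((hSd x).sub_const p)).mul
      ((((hS1d x).clm_apply (hasFDerivAt_const v x)).fst.mul_const w.2).sub
        (((hS1d x).clm_apply (hasFDerivAt_const v x)).snd.mul_const w.1))
  have hcS : Continuous S := hS.continuous
  have hcS1 : Continuous (fderiv ℝ S) := hS1.continuous
  have hcη : Continuous η := hη.continuous
  have hcη1 : Continuous (fderiv ℝ η) := hη1.continuous
  have hcont : ∀ v, Continuous (fun x => η (S x - p) * cross (fderiv ℝ S x v) w) := fun v => by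
    unfold cross; fun_prop
  have heq : ∀ x : ℝ × ℝ, fderiv ℝ (fun x => η (S x - p) * cross (fderiv ℝ S x (0, 1)) w) x (1, 0)
      + fderiv ℝ (fun x => -(η (S x - p) * cross (fderiv ℝ S x (1, 0)) w)) x (0, 1)
      = -(fderiv ℝ η (S x - p) w) * cross (fderiv ℝ S x (1, 0)) (fderiv ℝ S x (0, 1)) := by
    intro x
    have hsym : fderiv ℝ (fderiv ℝ S) x (1, 0) (0, 1) = fderiv ℝ (fderiv ℝ S) x (0, 1) (1, 0) :=
      (hS.contDiffAt.isSymmSndFDerivAt (by simpa using WithTop.coe_le_coe.2 (le_top : (2 : ℕ∞) ≤ ⊤))) _ _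
    have hid := cross_identity (fderiv ℝ η (S x - p)) (fderiv ℝ S x (1, 0)) (fderiv ℝ S x (0, 1)) w
    rw [fderiv_fun_neg, (key (0, 1) x).fderiv, (key (1, 0) x).fderiv]
    simp only [_root_.add_apply, _root_.smul_apply,
      _root_.neg_apply, _root_.sub_apply, ContinuousLinearMap.comp_apply,
      ContinuousLinearMap.flip_apply, ContinuousLinearMap.coe_fst', ContinuousLinearMap.coe_snd',
      smul_eq_mul, hsym, _root_.zero_apply, map_zero, zero_add]
    rw [neg_mul, ← hid]
    unfold cross
    ring
  have hint : (fun x => fderiv ℝ (fun x => η (S x - p) * cross (fderiv ℝ S x (0, 1)) w) x (1, 0)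
      + fderiv ℝ (fun x => -(η (S x - p) * cross (fderiv ℝ S x (1, 0)) w)) x (0, 1)) =
      fun x => -(fderiv ℝ η (S x - p) w) *
        cross (fderiv ℝ S x (1, 0)) (fderiv ℝ S x (0, 1)) := funext heq
  have hG := integral2_divergence_prod_of_hasFDerivAt
    (fun x => η (S x - p) * cross (fderiv ℝ S x (0, 1)) w)
    (fun x => -(η (S x - p) * cross (fderiv ℝ S x (1, 0)) w))
    (fderiv ℝ fun x => η (S x - p) * cross (fderiv ℝ S x (0, 1)) w)
    (fderiv ℝ fun x => -(η (S x - p) * cross (fderiv ℝ S x (1, 0)) w)) 0 0 1 1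
    (hcont _).continuousOn (hcont _).neg.continuousOn
    (fun x _ => (key (0, 1) x).differentiableAt.hasFDerivAt)
    (fun x _ => (key (1, 0) x).differentiableAt.fun_neg.hasFDerivAt) (by
      rw [hint]
      refine ContinuousOn.integrableOn_compact (isCompact_uIcc.prod isCompact_uIcc)
        (Continuous.continuousOn ?_)
      unfold cross; fun_prop)
  have hpt := fun s r : ℝ => heq (s, r)
  simp only [hpt] at hG
  rw [hG]
  simp only [intervalIntegral.integral_neg]
  ring

theorem integral_swap_of_continuous {f : ℝ → ℝ → ℝ} (hf : Continuous (Function.uncurry f)) :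
    ∫ x in (0 : ℝ)..1, ∫ y in (0 : ℝ)..1, f x y = ∫ y in (0 : ℝ)..1, ∫ x in (0 : ℝ)..1, f x y := by
  simp only [intervalIntegral.integral_of_le zero_le_one]
  refine integral_integral_swap ?_
  rw [Measure.prod_restrict]
  exact (hf.continuousOn.integrableOn_compact (isCompact_Icc.prod isCompact_Icc)).mono_set
    (prod_mono Ioc_subset_Icc_self Ioc_subset_Icc_self)

/-- Stokes' theorem for a smeared intersection of a square with a curve. -/
theorem stokes_square {η : ℝ × ℝ → ℝ} (hη : ContDiff ℝ ∞ η) {S : ℝ × ℝ → ℝ × ℝ}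
    (hS : ContDiff ℝ ∞ S) {δ : ℝ → ℝ × ℝ} (hδ : ContDiff ℝ ∞ δ) :
    curveKernel η (fun r => S (1, r)) δ - curveKernel η (fun r => S (0, r)) δ
      - curveKernel η (fun s => S (s, 1)) δ + curveKernel η (fun s => S (s, 0)) δ
    = squareKernel η S (δ 1) - squareKernel η S (δ 0) := by
  have hcS : Continuous S := hS.continuous
  have hcS1 : Continuous (fderiv ℝ S) := hS.continuous_fderiv (by simp)
  have hcη : Continuous η := hη.continuous
  have hcη1 : Continuous (fderiv ℝ η) := hη.continuous_fderiv (by simp)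
  have hcδ : Continuous δ := hδ.continuous
  have hcδ1 : Continuous (deriv δ) := hδ.continuous_deriv (by simp)
  have hSd := fun x => (hS.differentiable (by simp) x).hasFDerivAt
  have d1 : ∀ a r, deriv (fun r => S (a, r)) r = fderiv ℝ S (a, r) (0, 1) := fun a r =>
    ((hSd (a, r)).comp_hasDerivAt r ((hasDerivAt_const r a).prodMk (hasDerivAt_id r))).deriv
  have d2 : ∀ a s, deriv (fun s => S (s, a)) s = fderiv ℝ S (s, a) (1, 0) := fun a s =>
    ((hSd (s, a)).comp_hasDerivAt s ((hasDerivAt_id s).prodMk (hasDerivAt_const s a))).deriv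
  unfold curveKernel squareKernel
  simp only [d1, d2]
  have ii : ∀ (g : ℝ → ℝ × ℝ) (v : ℝ × ℝ), Continuous g → IntervalIntegrable (fun t =>
      ∫ s in (0 : ℝ)..1, η (S (g s) - δ t) * cross (fderiv ℝ S (g s) v) (deriv δ t))
      volume 0 1 := by
    intro g v hg
    refine (intervalIntegral.continuous_parametric_intervalIntegral_of_continuous' ?_ 0 1
      ).intervalIntegrable _ _
    unfold cross; fun_prop
  have jj : ∀ p : ℝ × ℝ, IntervalIntegrable (fun s => ∫ r in (0 : ℝ)..1, η (S (s, r) - p) *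
      cross (fderiv ℝ S (s, r) (1, 0)) (fderiv ℝ S (s, r) (0, 1))) volume 0 1 := by
    intro p
    refine (intervalIntegral.continuous_parametric_intervalIntegral_of_continuous' ?_ 0 1
      ).intervalIntegrable _ _
    unfold cross; fun_prop
  have i1 := ii (fun r => (1, r)) (0, 1) (by fun_prop)
  have i2 := ii (fun r => (0, r)) (0, 1) (by fun_prop)
  have i3 := ii (fun r => (r, 1)) (1, 0) (by fun_prop)
  have i4 := ii (fun r => (r, 0)) (1, 0) (by fun_prop)
  rw [← intervalIntegral.integral_sub i1 i2, ← intervalIntegral.integral_sub (i1.sub i2) i3,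
    ← intervalIntegral.integral_add ((i1.sub i2).sub i3) i4]
  -- For each fixed `t` the four edge terms are the boundary integral with `p = δ t` and `w = deriv
  -- δ t`.
  simp only [green_square hη hS]
  rw [← intervalIntegral.integral_sub (jj _) (jj _), integral_swap_of_continuous]
  · refine intervalIntegral.integral_congr fun s _ => ?_
    rw [integral_swap_of_continuous, ← intervalIntegral.integral_sub]
    · refine intervalIntegral.integral_congr fun r _ => ?_
      rw [intervalIntegral.integral_mul_const, ← sub_mul]
      congr 1
      -- The integrand produced by `green_square` is a total derivative in `t`, so integrating in
      -- `t` first leaves only the end points of `δ`.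
      have hd : ∀ t, HasDerivAt (fun t => η (S (s, r) - δ t))
          (-(fderiv ℝ η (S (s, r) - δ t) (deriv δ t))) t := fun t => by
        have := ((hη.differentiable (by simp) (S (s, r) - δ t)).hasFDerivAt.comp_hasDerivAt t
          ((hδ.differentiable (by simp) t).hasDerivAt.const_sub (S (s, r))))
        rw [map_neg] at this
        exact this
      rw [intervalIntegral.integral_eq_sub_of_hasDerivAt (fun t _ => hd t)]
      exact Continuous.intervalIntegrable (by fun_prop) _ _
    all_goals first
      | (refine Continuous.intervalIntegrable ?_ _ _; unfold cross; fun_prop)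
      | (unfold cross; fun_prop)
  · refine intervalIntegral.continuous_parametric_intervalIntegral_of_continuous' (f := fun (x : ℝ × ℝ) r =>
      -(fderiv ℝ η (S (x.2, r) - δ x.1) (deriv δ x.1)) *
          cross (fderiv ℝ S (x.2, r) (1, 0)) (fderiv ℝ S (x.2, r) (0, 1))) ?_ 0 1
    unfold cross; fun_prop

/-! ### Mollifiers -/

/-- A smooth even approximation of the Dirac mass of the plane. -/
def mollifier (n : ℕ) : ℝ × ℝ → ℝ :=
  ContDiffBump.normed (⟨1 / (2 * ((n : ℝ) + 1)), 1 / ((n : ℝ) + 1), by positivity, by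
    have : (0 : ℝ) < n + 1 := by positivity
    gcongr; linarith⟩ : ContDiffBump (0 : ℝ × ℝ)) volume

theorem contDiff_mollifier (n : ℕ) : ContDiff ℝ ∞ (mollifier n) :=
  ContDiffBump.contDiff_normed _

theorem integral_mollifier (n : ℕ) : ∫ x, mollifier n x = 1 :=
  ContDiffBump.integral_normed _

theorem mollifier_neg (n : ℕ) (x : ℝ × ℝ) : mollifier n (-x) = mollifier n x :=
  ContDiffBump.normed_neg _ x

theorem norm_lt_of_mollifier_ne_zero {n : ℕ} {x : ℝ × ℝ} (h : mollifier n x ≠ 0) :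
    ‖x‖ < 1 / ((n : ℝ) + 1) := by
  have h1 : x ∈ Function.support (mollifier n) := h
  unfold mollifier at h1
  rw [ContDiffBump.support_normed_eq] at h1
  simpa using h1

theorem norm_lt_one_of_mollifier_ne_zero {n : ℕ} {x : ℝ × ℝ} (h : mollifier n x ≠ 0) :
    ‖x‖ < 1 := by
  refine (norm_lt_of_mollifier_ne_zero h).trans_le ?_
  rw [div_le_one (by positivity)]
  have : (0 : ℝ) ≤ n := by positivity
  linarith

theorem eventually_mollifier_support {ε : ℝ} (hε : 0 < ε) :
    ∀ᶠ n : ℕ in atTop, ∀ x, mollifier n x ≠ 0 → ‖x‖ < ε := by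
  have := (tendsto_one_div_add_atTop_nhds_zero_nat (𝕜 := ℝ)).eventually_lt_const hε
  filter_upwards [this] with n hn x hx
  exact (norm_lt_of_mollifier_ne_zero hx).trans hn

/-- The mollifiers eventually vanish on a compact set of nonzero vectors. -/
theorem eventually_mollifier_eq_zero {X : Type*} [TopologicalSpace X] {K : Set X} (hK : IsCompact K)
    {f : X → ℝ × ℝ} (hf : ContinuousOn f K) (h0 : ∀ x ∈ K, f x ≠ 0) :
    ∀ᶠ n : ℕ in atTop, ∀ x ∈ K, mollifier n (f x) = 0 := by
  rcases K.eq_empty_or_nonempty with rfl | hne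
  · simp
  obtain ⟨x₀, hx₀, hmin⟩ := hK.exists_isMinOn hne hf.norm
  filter_upwards [eventually_mollifier_support (norm_pos_iff.2 (h0 x₀ hx₀))] with n hn x hx
  by_contra h
  exact absurd (hn _ h) (not_lt.2 (hmin hx))

/-! ### Transversal crossings and the limit of the smeared number -/

/-- The differential of `(s, t) ↦ γ s - δ t`. -/
def differenceDeriv (u v : ℝ × ℝ) : ℝ × ℝ →L[ℝ] ℝ × ℝ :=
  (ContinuousLinearMap.fst ℝ ℝ ℝ).smulRight u - (ContinuousLinearMap.snd ℝ ℝ ℝ).smulRight v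

theorem det_differenceDeriv (u v : ℝ × ℝ) : (differenceDeriv u v).det = -cross u v := by
  rw [ContinuousLinearMap.det, ← LinearMap.det_toMatrix (Module.Basis.finTwoProd ℝ),
    Matrix.det_fin_two]
  simp [LinearMap.toMatrix_apply, differenceDeriv, cross]
  ring

theorem hasStrictFDerivAt_difference {γ δ : ℝ → ℝ × ℝ} (hγ : ContDiff ℝ ∞ γ)
    (hδ : ContDiff ℝ ∞ δ) (p : ℝ × ℝ) :
    HasStrictFDerivAt (fun p : ℝ × ℝ => γ p.1 - δ p.2)
      (differenceDeriv (deriv γ p.1) (deriv δ p.2)) p := by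
  have h1 := (hγ.contDiffAt.hasStrictDerivAt (x := p.1) (by simp)).hasStrictFDerivAt.comp p
    (hasStrictFDerivAt_fst (𝕜 := ℝ) (E := ℝ) (F := ℝ) (p := p))
  have h2 := (hδ.contDiffAt.hasStrictDerivAt (x := p.2) (by simp)).hasStrictFDerivAt.comp p
    (hasStrictFDerivAt_snd (𝕜 := ℝ) (E := ℝ) (F := ℝ) (p := p))
  refine (h1.sub h2).congr_fderiv ?_
  ext <;> simp [differenceDeriv]

/-- Two smooth curves meet in an isolated way at a transversal crossing. -/
theorem exists_nhd_crossing {γ δ : ℝ → ℝ × ℝ} (hγ : ContDiff ℝ ∞ γ) (hδ : ContDiff ℝ ∞ δ)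
    {p : ℝ × ℝ} (hp : cross (deriv γ p.1) (deriv δ p.2) ≠ 0) :
    ∃ V : Set (ℝ × ℝ), IsOpen V ∧ p ∈ V ∧ InjOn (fun p : ℝ × ℝ => γ p.1 - δ p.2) V ∧
      (∀ U ⊆ V, IsOpen U → IsOpen ((fun p : ℝ × ℝ => γ p.1 - δ p.2) '' U)) ∧
      ∀ q ∈ V, SignType.sign (cross (deriv γ q.1) (deriv δ q.2)) =
        SignType.sign (cross (deriv γ p.1) (deriv δ p.2)) := by
  have hdet : (differenceDeriv (deriv γ p.1) (deriv δ p.2)).det ≠ 0 := by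
    rw [det_differenceDeriv]; exact neg_ne_zero.2 hp
  -- Transversality is the invertibility of the differential of `γ s - δ t`, so the inverse function
  -- theorem gives injectivity and openness near `p`.
  have hs : HasStrictFDerivAt (fun p : ℝ × ℝ => γ p.1 - δ p.2)
      ((ContinuousLinearMap.toContinuousLinearEquivOfDetNeZero _ hdet : (ℝ × ℝ) ≃L[ℝ] (ℝ × ℝ)) :
        ℝ × ℝ →L[ℝ] ℝ × ℝ) p := by
    simpa using hasStrictFDerivAt_difference hγ hδ p
  set h := hs.toOpenPartialHomeomorph _ with hh
  have hcoe : (h : ℝ × ℝ → ℝ × ℝ) = fun p : ℝ × ℝ => γ p.1 - δ p.2 :=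
    hs.toOpenPartialHomeomorph_coe
  have hc : Continuous fun q : ℝ × ℝ => cross (deriv γ q.1) (deriv δ q.2) :=
    continuous_cross ((hγ.continuous_deriv (by simp)).comp continuous_fst)
      ((hδ.continuous_deriv (by simp)).comp continuous_snd)
  have hsign : IsOpen {q : ℝ × ℝ | SignType.sign (cross (deriv γ q.1) (deriv δ q.2)) =
        SignType.sign (cross (deriv γ p.1) (deriv δ p.2))} := by
    rcases lt_or_gt_of_ne hp with hlt | hgt
    · simp only [sign_neg hlt, sign_eq_neg_one_iff]
      exact isOpen_lt hc continuous_const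
    · simp only [sign_pos hgt, sign_eq_one_iff]
      exact isOpen_lt continuous_const hc
  refine ⟨h.source ∩ _, h.open_source.inter hsign, ⟨hs.mem_toOpenPartialHomeomorph_source, rfl⟩,
    ?_, ?_, fun q hq => hq.2⟩
  · rw [← hcoe]; exact h.injOn.mono inter_subset_left
  · intro U hU hUo
    rw [← hcoe]
    exact h.isOpen_image_of_subset_source hUo (hU.trans inter_subset_left)

/-- The parameters at which two curves on the unit interval meet. -/
def meets (γ δ : ℝ → ℝ × ℝ) : Set (ℝ × ℝ) :=
  {p | p.1 ∈ Icc (0 : ℝ) 1 ∧ p.2 ∈ Icc (0 : ℝ) 1 ∧ γ p.1 = δ p.2}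

theorem isCompact_meets {γ δ : ℝ → ℝ × ℝ} (hγ : Continuous γ) (hδ : Continuous δ) :
    IsCompact (meets γ δ) := by
  have : meets γ δ = (Icc (0 : ℝ) 1 ×ˢ Icc (0 : ℝ) 1) ∩ {p | γ p.1 = δ p.2} := by
    ext p; simp only [meets, mem_ofPred_eq, mem_inter_iff, mem_prod, and_assoc]
  rw [this]
  exact (isCompact_Icc.prod isCompact_Icc).inter_right
    (isClosed_eq (hγ.comp continuous_fst) (hδ.comp continuous_snd))

theorem curveKernel_eq_setIntegral {η : ℝ × ℝ → ℝ} (hη : Continuous η) {γ δ : ℝ → ℝ × ℝ}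
    (hγ : ContDiff ℝ ∞ γ) (hδ : ContDiff ℝ ∞ δ) :
    curveKernel η γ δ = ∫ p in Icc (0 : ℝ) 1 ×ˢ Icc (0 : ℝ) 1,
      η (γ p.1 - δ p.2) * cross (deriv γ p.1) (deriv δ p.2) := by
  have hγ0 := hγ.continuous
  have hδ0 := hδ.continuous
  have hγ1 : Continuous (deriv γ) := hγ.continuous_deriv (by simp)
  have hδ1 : Continuous (deriv δ) := hδ.continuous_deriv (by simp)
  unfold curveKernel
  rw [integral_swap_of_continuous (by unfold cross; fun_prop), Measure.volume_eq_prod,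
    setIntegral_prod]
  · simp only [intervalIntegral.integral_of_le zero_le_one, integral_Icc_eq_integral_Ioc]
  · refine ContinuousOn.integrableOn_compact (isCompact_Icc.prod isCompact_Icc)
        (Continuous.continuousOn ?_)
    unfold cross; fun_prop

/-- Change variables by `(s, t) ↦ γ s - δ t`: the absolute Jacobian is `|cross|`, the sign is
constant on `U`, and the image contains the support of `η`, whose integral is one. -/
theorem curveKernel_local {γ δ : ℝ → ℝ × ℝ} (hγ : ContDiff ℝ ∞ γ) (hδ : ContDiff ℝ ∞ δ)
    {U : Set (ℝ × ℝ)} (hU : MeasurableSet U)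
    (hinj : InjOn (fun p : ℝ × ℝ => γ p.1 - δ p.2) U) {η : ℝ × ℝ → ℝ} (hη1 : ∫ x, η x = 1)
    (hη : ∀ x, η x ≠ 0 → x ∈ (fun p : ℝ × ℝ => γ p.1 - δ p.2) '' U) {ε : SignType}
    (hε : ∀ q ∈ U, SignType.sign (cross (deriv γ q.1) (deriv δ q.2)) = ε) :
    ∫ p in U, η (γ p.1 - δ p.2) * cross (deriv γ p.1) (deriv δ p.2) = ((ε : ℤ) : ℝ) := by
  have h1 := integral_image_eq_integral_abs_det_fderiv_smul volume hU
    (fun p _ => (hasStrictFDerivAt_difference hγ hδ p).hasFDerivAt.hasFDerivWithinAt) hinj η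
  rw [setIntegral_eq_integral_of_forall_compl_eq_zero (fun x hx => by
    by_contra h; exact hx (hη x h)), hη1] at h1
  have h2 : ∫ p in U, η (γ p.1 - δ p.2) * cross (deriv γ p.1) (deriv δ p.2) =
      ∫ p in U, ((ε : ℤ) : ℝ) *
        (|(differenceDeriv (deriv γ p.1) (deriv δ p.2)).det| • η (γ p.1 - δ p.2)) := by
    refine setIntegral_congr_fun hU fun p hp => ?_
    simp only [det_differenceDeriv, abs_neg, smul_eq_mul, ← hε p hp]
    rw [← mul_assoc]
    have := sign_mul_abs (cross (deriv γ p.1) (deriv δ p.2))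
    rw [show (((SignType.sign (cross (deriv γ p.1) (deriv δ p.2)) : SignType) : ℤ) : ℝ) =
      ((SignType.sign (cross (deriv γ p.1) (deriv δ p.2)) : SignType) : ℝ) by
        cases SignType.sign (cross (deriv γ p.1) (deriv δ p.2)) <;> simp, this, mul_comm]
  rw [h2, integral_const_mul, ← h1, mul_one]

/-- Meeting parameters are isolated and form a compact set, hence are finitely many. On disjoint
neighbourhoods of them `curveKernel_local` gives the signs; on the compact remainder of the square
`γ s - δ t` stays away from zero, where narrow mollifiers vanish. -/
theorem meets_finite_and_eventually {γ δ : ℝ → ℝ × ℝ} (hγ : ContDiff ℝ ∞ γ)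
    (hδ : ContDiff ℝ ∞ δ)
    (hgen : ∀ p ∈ meets γ δ, p.1 ∈ Ioo (0 : ℝ) 1 ∧ p.2 ∈ Ioo (0 : ℝ) 1 ∧
      cross (deriv γ p.1) (deriv δ p.2) ≠ 0) :
    (meets γ δ).Finite ∧ ∀ᶠ n : ℕ in atTop, curveKernel (mollifier n) γ δ =
      ∑ᶠ p ∈ meets γ δ, ((SignType.sign (cross (deriv γ p.1) (deriv δ p.2)) : ℤ) : ℝ) := by
  set D := fun p : ℝ × ℝ => γ p.1 - δ p.2 with hD
  have hDc : Continuous D := (hγ.continuous.comp continuous_fst).sub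
    (hδ.continuous.comp continuous_snd)
  have hmem : ∀ p ∈ meets γ δ, D p = 0 := fun p hp => sub_eq_zero.2 hp.2.2
  have hV : ∀ p, ∃ V : Set (ℝ × ℝ), p ∈ meets γ δ → (IsOpen V ∧ p ∈ V ∧ InjOn D V ∧
      (∀ U ⊆ V, IsOpen U → IsOpen (D '' U)) ∧
      ∀ q ∈ V, SignType.sign (cross (deriv γ q.1) (deriv δ q.2)) =
        SignType.sign (cross (deriv γ p.1) (deriv δ p.2))) := fun p => by
    by_cases hp : p ∈ meets γ δ
    · obtain ⟨V, h⟩ := exists_nhd_crossing hγ hδ (hgen p hp).2.2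
      exact ⟨V, fun _ => h⟩
    · exact ⟨∅, fun h => absurd h hp⟩
  choose V hV using hV
  have hfin : (meets γ δ).Finite := by
    obtain ⟨t, ht, hcov⟩ := (isCompact_meets hγ.continuous hδ.continuous).elim_nhds_subcover V
      fun p hp => (hV p hp).1.mem_nhds (hV p hp).2.1
    refine t.finite_toSet.subset fun p hp => ?_
    obtain ⟨q, hq, hpq⟩ := mem_iUnion₂.1 (hcov hp)
    have := (hV q (ht q hq)).2.2.1 hpq (hV q (ht q hq)).2.1
      ((hmem p hp).trans (hmem q (ht q hq)).symm)
    exact this ▸ hq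
  refine ⟨hfin, ?_⟩
  obtain ⟨W, hW, hdisj⟩ := hfin.t2_separation
  -- Each neighbourhood must lie in the square of integration, so that no part of a local degree is
  -- cut off; this is why crossings are required at interior parameters.
  set U : ℝ × ℝ → Set (ℝ × ℝ) := fun p => V p ∩ W p ∩ (Ioo 0 1 ×ˢ Ioo 0 1) with hUdef
  have hUo : ∀ p ∈ meets γ δ, IsOpen (U p) := fun p hp =>
    ((hV p hp).1.inter (hW p).2).inter (isOpen_Ioo.prod isOpen_Ioo)
  have hpU : ∀ p ∈ meets γ δ, p ∈ U p := fun p hp =>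
    ⟨⟨(hV p hp).2.1, (hW p).1⟩, (hgen p hp).1, (hgen p hp).2.1⟩
  have hUV : ∀ p, U p ⊆ V p := fun p => inter_subset_left.trans inter_subset_left
  have hUQ : ∀ p, U p ⊆ Icc (0 : ℝ) 1 ×ˢ Icc (0 : ℝ) 1 := fun p =>
    inter_subset_right.trans (prod_mono Ioo_subset_Icc_self Ioo_subset_Icc_self)
  have hloc : ∀ᶠ n : ℕ in atTop, ∀ p ∈ meets γ δ, ∀ x, mollifier n x ≠ 0 → x ∈ D '' U p := by
    rw [hfin.eventually_all]
    intro p hp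
    obtain ⟨ε, hε, hball⟩ := Metric.isOpen_iff.1 ((hV p hp).2.2.2.1 _ (hUV p) (hUo p hp)) 0
      ⟨p, hpU p hp, hmem p hp⟩
    filter_upwards [eventually_mollifier_support hε] with n hn x hx
    exact hball (by simpa using hn x hx)
  have hout : ∀ᶠ n : ℕ in atTop,
      ∀ q ∈ (Icc (0 : ℝ) 1 ×ˢ Icc (0 : ℝ) 1) \ ⋃ p ∈ meets γ δ, U p, mollifier n (D q) = 0 := by
    refine eventually_mollifier_eq_zero
      ((isCompact_Icc.prod isCompact_Icc).diff (isOpen_biUnion hUo)) hDc.continuousOn ?_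
    intro q hq h0
    have hqm : q ∈ meets γ δ := ⟨hq.1.1, hq.1.2, sub_eq_zero.1 h0⟩
    exact hq.2 (mem_biUnion hqm (hpU q hqm))
  filter_upwards [hloc, hout] with n hn hn0
  rw [curveKernel_eq_setIntegral (contDiff_mollifier n).continuous hγ hδ]
  have hmeas : ∀ p ∈ meets γ δ, MeasurableSet (U p) := fun p hp => (hUo p hp).measurableSet
  have hint : IntegrableOn (fun p : ℝ × ℝ => mollifier n (γ p.1 - δ p.2) *
      cross (deriv γ p.1) (deriv δ p.2)) (Icc (0 : ℝ) 1 ×ˢ Icc (0 : ℝ) 1) := by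
    have hγ0 := hγ.continuous
    have hδ0 := hδ.continuous
    have hγ1 : Continuous (deriv γ) := hγ.continuous_deriv (by simp)
    have hδ1 : Continuous (deriv δ) := hδ.continuous_deriv (by simp)
    have hη := (contDiff_mollifier n).continuous
    refine ContinuousOn.integrableOn_compact (isCompact_Icc.prod isCompact_Icc)
        (Continuous.continuousOn ?_)
    unfold cross; fun_prop
  have hsub : (⋃ p ∈ hfin.toFinset, U p) ⊆ Icc (0 : ℝ) 1 ×ˢ Icc (0 : ℝ) 1 :=
    iUnion₂_subset fun p _ => hUQ p
  rw [setIntegral_eq_of_subset_of_forall_sdiff_eq_zero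
    (measurableSet_Icc.prod measurableSet_Icc) hsub (fun q hq => by
      rw [hn0 q (by simpa using hq), zero_mul]),
    integral_biUnion_finset _ (fun p hp => hmeas p (hfin.mem_toFinset.1 hp))
      (fun p hp q hq hpq => (hdisj (by simpa using hp) (by simpa using hq) hpq).mono
        (inter_subset_left.trans inter_subset_right) (inter_subset_left.trans inter_subset_right))
      (fun p _ => hint.mono_set (hUQ p)), finsum_mem_eq_finite_toFinset_sum _ hfin]
  refine Finset.sum_congr rfl fun p hp => ?_
  have hp' := hfin.mem_toFinset.1 hp
  exact curveKernel_local hγ hδ (hmeas p hp') ((hV p hp').2.2.1.mono (hUV p))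
    (integral_mollifier n) (hn p hp') fun q hq => (hV p hp').2.2.2.2 q (hUV p hq)

/-! ### Parametrizations of simplices by intervals and squares -/

namespace SmoothSimplex

/-- A smooth extension of a simplex to the ambient space of the standard simplex. -/
def extension {n : ℕ} (σ : SmoothSimplex n) : (Fin (n + 1) → ℝ) → ℝ × ℝ :=
  Classical.choose σ.smooth'

theorem contDiff_extension {n : ℕ} (σ : SmoothSimplex n) : ContDiff ℝ ∞ σ.extension :=
  (Classical.choose_spec σ.smooth').1

theorem toFun_eq_extension {n : ℕ} (σ : SmoothSimplex n) (x : stdSimplex ℝ (Fin (n + 1))) :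
    σ.toFun x = σ.extension (x : Fin (n + 1) → ℝ) :=
  (Classical.choose_spec σ.smooth').2 x

theorem continuous_toFun {n : ℕ} (σ : SmoothSimplex n) : Continuous σ.toFun := by
  have h : σ.toFun = σ.extension ∘ Subtype.val := funext σ.toFun_eq_extension
  rw [h]
  exact σ.contDiff_extension.continuous.comp continuous_subtype_val

/-- A smooth curve that agrees with a `1`-simplex on the unit interval. -/
def curve (σ : SmoothSimplex 1) (s : ℝ) : ℝ × ℝ := σ.extension ![1 - s, s]

/-- A smooth map that gives a parametrization of a `2`-simplex by the unit square. -/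
def square (σ : SmoothSimplex 2) (p : ℝ × ℝ) : ℝ × ℝ :=
  σ.extension ![1 - p.1, p.1 * (1 - p.2), p.1 * p.2]

/-- The point which is a `0`-simplex. -/
def point (σ : SmoothSimplex 0) : ℝ × ℝ := σ.extension ![1]

theorem contDiff_curve (σ : SmoothSimplex 1) : ContDiff ℝ ∞ σ.curve := by
  refine σ.contDiff_extension.comp (contDiff_pi.2 fun i => ?_)
  fin_cases i <;> simp <;> fun_prop

theorem contDiff_square (σ : SmoothSimplex 2) : ContDiff ℝ ∞ σ.square := by
  refine σ.contDiff_extension.comp (contDiff_pi.2 fun i => ?_)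
  fin_cases i <;> simp <;> fun_prop

theorem mem_stdSimplex_pair {s : ℝ} (hs : s ∈ Icc (0 : ℝ) 1) :
    ![1 - s, s] ∈ stdSimplex ℝ (Fin 2) := by
  refine ⟨fun i => ?_, by simp [Fin.sum_univ_two]⟩
  fin_cases i <;> simp [hs.1, hs.2]

theorem exists_curve_eq (σ : SmoothSimplex 1) {s : ℝ} (hs : s ∈ Icc (0 : ℝ) 1) :
    ∃ x : stdSimplex ℝ (Fin 2), σ.curve s = σ.toFun x :=
  ⟨⟨_, mem_stdSimplex_pair hs⟩, (σ.toFun_eq_extension ⟨_, mem_stdSimplex_pair hs⟩).symm⟩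

theorem path_eq_curve (σ : SmoothSimplex 1) {s : ℝ} (hs : s ∈ Icc (0 : ℝ) 1) :
    σ.path s = σ.curve s := by
  rw [path, toFun_eq_extension, curve, projIcc_of_mem _ hs]
  rfl

theorem deriv_path (σ : SmoothSimplex 1) {s : ℝ} (hs : s ∈ Ioo (0 : ℝ) 1) :
    deriv σ.path s = deriv σ.curve s :=
  EventuallyEq.deriv_eq (by
    filter_upwards [isOpen_Ioo.mem_nhds hs] with x hx
    exact σ.path_eq_curve (Ioo_subset_Icc_self hx))

theorem exists_square_eq (σ : SmoothSimplex 2) {s r : ℝ} (hs : s ∈ Icc (0 : ℝ) 1)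
    (hr : r ∈ Icc (0 : ℝ) 1) :
    ∃ x : stdSimplex ℝ (Fin 3), σ.square (s, r) = σ.toFun x := by
  have hx : ![1 - s, s * (1 - r), s * r] ∈ stdSimplex ℝ (Fin 3) := by
    refine ⟨fun i => ?_, by simp [Fin.sum_univ_three]; ring⟩
    have h1 := mul_nonneg hs.1 (sub_nonneg.2 hr.2)
    have h2 := mul_nonneg hs.1 hr.1
    fin_cases i
    · simpa using hs.2
    · exact h1
    · exact h2
  exact ⟨⟨_, hx⟩, (σ.toFun_eq_extension ⟨_, hx⟩).symm⟩

theorem toFun_eq_point (p : SmoothSimplex 0) (x : stdSimplex ℝ (Fin 1)) :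
    p.toFun x = p.point := by
  rw [toFun_eq_extension, point]
  congr 1
  ext i
  fin_cases i
  simp

theorem face_extension {n : ℕ} (σ : SmoothSimplex (n + 1)) (i : Fin (n + 2))
    {x : Fin (n + 1) → ℝ} (hx : x ∈ stdSimplex ℝ (Fin (n + 1))) :
    (σ.face i).extension x = σ.extension (FunOnFinite.linearMap ℝ ℝ i.succAbove x) := by
  exact ((σ.face i).toFun_eq_extension ⟨x, hx⟩).symm.trans (σ.toFun_eq_extension _)

theorem face_curve (σ : SmoothSimplex 2) (i : Fin 3) {s : ℝ} (hs : s ∈ Icc (0 : ℝ) 1) :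
    (σ.face i).curve s =
      σ.square (![(1, s), (s, 1), (s, 0)] i) := by
  rw [curve, face_extension _ _ (mem_stdSimplex_pair hs), square]
  congr 1
  ext j
  rw [FunOnFinite.linearMap_apply_apply]
  fin_cases i <;> fin_cases j <;>
    simp [Fin.sum_univ_two, Finset.sum_filter, Fin.succAbove, Fin.lt_def]

theorem face_point (σ : SmoothSimplex 1) (i : Fin 2) :
    (σ.face i).point = σ.curve (![1, 0] i) := by
  rw [point, face_extension _ _ (by refine ⟨fun i => ?_, by simp⟩; fin_cases i; simp), curve]
  congr 1
  ext j
  rw [FunOnFinite.linearMap_apply_apply]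
  fin_cases i <;> fin_cases j <;>
    simp [Finset.filter_singleton, Fin.succAbove, Fin.lt_def]

end SmoothSimplex

/-- Extensions of simplices are chosen independently, so the curve of a face or of a deck translate
is controlled only on the unit interval. Agreement on the open interval also fixes the derivatives
there. -/
theorem curveKernel_congr {η : ℝ × ℝ → ℝ} {γ γ' δ δ' : ℝ → ℝ × ℝ} (h : EqOn γ γ' (Ioo 0 1))
    (h' : EqOn δ δ' (Ioo 0 1)) : curveKernel η γ δ = curveKernel η γ' δ' := by
  have hd : ∀ {a b : ℝ → ℝ × ℝ}, EqOn a b (Ioo 0 1) → EqOn (deriv a) (deriv b) (Ioo 0 1) :=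
    fun hab s hs => EventuallyEq.deriv_eq (hab.eventuallyEq_of_mem (isOpen_Ioo.mem_nhds hs))
  refine intervalIntegral.integral_congr_Ioo_of_le zero_le_one fun t ht => ?_
  refine intervalIntegral.integral_congr_Ioo_of_le zero_le_one fun s hs => ?_
  simp only [h hs, h' ht, hd h hs, hd h' ht]

/-- `η` is even and `cross` is antisymmetric. This transfers statements about the first chain to the
second one. -/
theorem curveKernel_swap {η : ℝ × ℝ → ℝ} (hc : Continuous η) (hη : ∀ x, η (-x) = η x)
    {γ δ : ℝ → ℝ × ℝ} (hγ : ContDiff ℝ ∞ γ) (hδ : ContDiff ℝ ∞ δ) :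
    curveKernel η γ δ = -curveKernel η δ γ := by
  have hγ0 := hγ.continuous
  have hδ0 := hδ.continuous
  have hγ1 : Continuous (deriv γ) := hγ.continuous_deriv (by simp)
  have hδ1 : Continuous (deriv δ) := hδ.continuous_deriv (by simp)
  unfold curveKernel
  rw [integral_swap_of_continuous (by unfold cross; fun_prop)]
  simp only [← intervalIntegral.integral_neg]
  refine intervalIntegral.integral_congr fun t _ => ?_
  refine intervalIntegral.integral_congr fun s _ => ?_
  rw [← hη, neg_sub]
  unfold cross
  ring

/-! ### Smeared intersections of simplices with translates -/

/-- The translation of the strip by `m` turns. -/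
def turn (m : ℤ) : ℝ × ℝ := (0, 2 * Real.pi * m)

theorem turn_add (m n : ℤ) : turn (m + n) = turn m + turn n := by
  ext <;> simp [turn]; ring

theorem turn_one : turn 1 = (0, 2 * Real.pi) := by simp [turn]

/-- The smeared intersection number of a `1`-simplex with a translate of another one. -/
def curveCurve (n : ℕ) (σ τ : SmoothSimplex 1) (m : ℤ) : ℝ :=
  curveKernel (mollifier n) σ.curve fun t => τ.curve t + turn m

/-- The smeared intersection number of a `2`-simplex with a translate of a `0`-simplex. -/
def squarePoint (n : ℕ) (σ : SmoothSimplex 2) (p : SmoothSimplex 0) (m : ℤ) : ℝ :=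
  squareKernel (mollifier n) σ.square (p.point + turn m)

/-- In the parametrization of the triangle by a square, the edge `s = 0` is collapsed to a vertex
and contributes nothing; the other three edges are the faces, with their simplicial signs. -/
theorem squareKernel_sub_square {η : ℝ × ℝ → ℝ} (hη : ContDiff ℝ ∞ η) (σ : SmoothSimplex 2)
    (τ : SmoothSimplex 1) (v : ℝ × ℝ) :
    curveKernel η (σ.face 0).curve (fun t => τ.curve t + v)
      - curveKernel η (σ.face 1).curve (fun t => τ.curve t + v)
      + curveKernel η (σ.face 2).curve (fun t => τ.curve t + v)
    = squareKernel η σ.square ((τ.face 0).point + v)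
      - squareKernel η σ.square ((τ.face 1).point + v) := by
  have h := stokes_square hη σ.contDiff_square (δ := fun t => τ.curve t + v)
    (τ.contDiff_curve.add contDiff_const)
  have h0 : curveKernel η (fun r => σ.square (0, r)) (fun t => τ.curve t + v) = 0 := by
    have : (fun r => σ.square (0, r)) = fun _ => σ.square (0, 0) := by
      ext1 r; simp [SmoothSimplex.square]
    rw [this]
    simp [curveKernel, cross]
  rw [h0, sub_zero] at h
  have hf := fun i => curveKernel_congr (η := η)
    (fun s hs => σ.face_curve i (Ioo_subset_Icc_self hs)) (eqOn_refl (fun t => τ.curve t + v) _)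
  rw [hf 0, hf 1, hf 2, τ.face_point, τ.face_point]
  exact h

theorem curveCurve_face (n : ℕ) (σ : SmoothSimplex 2) (τ : SmoothSimplex 1) (m : ℤ) :
    curveCurve n (σ.face 0) τ m - curveCurve n (σ.face 1) τ m + curveCurve n (σ.face 2) τ m
      = squarePoint n σ (τ.face 0) m - squarePoint n σ (τ.face 1) m :=
  squareKernel_sub_square (contDiff_mollifier n) σ τ (turn m)

theorem deck_curve (σ : SmoothSimplex 1) {s : ℝ} (hs : s ∈ Icc (0 : ℝ) 1) :
    σ.deck.curve s = σ.curve s + turn 1 := by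
  rw [← SmoothSimplex.path_eq_curve _ hs, ← SmoothSimplex.path_eq_curve _ hs, turn_one]
  rfl

theorem deck_point (p : SmoothSimplex 0) : p.deck.point = p.point + turn 1 := by
  have x : stdSimplex ℝ (Fin 1) := Classical.arbitrary _
  rw [← SmoothSimplex.toFun_eq_point _ x, ← SmoothSimplex.toFun_eq_point _ x, turn_one]
  rfl

theorem curveKernel_add {η : ℝ × ℝ → ℝ} (γ δ : ℝ → ℝ × ℝ) (v w : ℝ × ℝ) :
    curveKernel η (fun s => γ s + v) (fun s => δ s + w) =
      curveKernel η γ fun s => δ s + (w - v) := by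
  unfold curveKernel
  simp only [deriv_add_const]
  refine intervalIntegral.integral_congr fun t _ => ?_
  refine intervalIntegral.integral_congr fun s _ => ?_
  congr 2
  abel

theorem curveCurve_deck (n : ℕ) (σ τ : SmoothSimplex 1) (m : ℤ) :
    curveCurve n σ.deck τ (m + 1) = curveCurve n σ τ m := by
  unfold curveCurve
  rw [curveKernel_congr (fun s hs => deck_curve σ (Ioo_subset_Icc_self hs)) (eqOn_refl _ _),
    curveKernel_add, turn_add, add_sub_cancel_right]

theorem squarePoint_deck (n : ℕ) (σ : SmoothSimplex 2) (p : SmoothSimplex 0) (m : ℤ) :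
    squarePoint n σ p.deck m = squarePoint n σ p (m + 1) := by
  unfold squarePoint
  rw [deck_point, turn_add, add_assoc, add_comm (turn 1)]

theorem curveCurve_swap (n : ℕ) (σ τ : SmoothSimplex 1) (m : ℤ) :
    curveCurve n σ τ m = -curveCurve n τ σ (-m) := by
  unfold curveCurve
  rw [curveKernel_swap (contDiff_mollifier n).continuous (mollifier_neg n) σ.contDiff_curve
    (τ.contDiff_curve.add contDiff_const)]
  have h := curveKernel_add (η := mollifier n) τ.curve σ.curve (turn m) 0
  simp only [add_zero] at h
  rw [h]
  congr 3
  ext s <;> simp [turn]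

/-! ### Locality of the kernels -/

/-- A family of kernels on simplices which is concentrated near the intersections. -/
def IsLocal {i j : ℕ} (N : ℕ → SmoothSimplex i → SmoothSimplex j → ℤ → ℝ) : Prop :=
  ∀ n σ τ m, N n σ τ m ≠ 0 → ∃ x y, mollifier n (σ.toFun x - (τ.toFun y + turn m)) ≠ 0

theorem integral_unit_eq_zero {f : ℝ → ℝ} (h : ∀ x ∈ Icc (0 : ℝ) 1, f x = 0) :
    ∫ x in (0 : ℝ)..1, f x = 0 := by
  rw [intervalIntegral.integral_congr (g := fun _ => (0 : ℝ)) (fun x hx => h x (by simpa using hx))]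
  simp

theorem isLocal_curveCurve : IsLocal curveCurve := by
  intro n σ τ m h
  by_contra! hxy
  refine h (integral_unit_eq_zero fun t ht => integral_unit_eq_zero fun s hs => ?_)
  obtain ⟨x, hx⟩ := σ.exists_curve_eq hs
  obtain ⟨y, hy⟩ := τ.exists_curve_eq ht
  beta_reduce
  rw [hx, hy, hxy, zero_mul]

theorem isLocal_squarePoint : IsLocal squarePoint := by
  intro n σ τ m h
  by_contra! hxy
  refine h (integral_unit_eq_zero fun t ht => integral_unit_eq_zero fun s hs => ?_)
  obtain ⟨x, hx⟩ := σ.exists_square_eq ht hs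
  rw [hx, ← τ.toFun_eq_point (Classical.arbitrary _), hxy, zero_mul]

/-- Simplices are compact. Since every mollifier is supported in the unit ball, this makes the sums
over translates finite, uniformly in the mollifier. -/
theorem exists_bound_turn {i j : ℕ} (σ : SmoothSimplex i) (τ : SmoothSimplex j) :
    ∃ M : Finset ℤ, ∀ x y m, ‖σ.toFun x - (τ.toFun y + turn m)‖ < 1 → m ∈ M := by
  obtain ⟨C, hC⟩ := (isCompact_range σ.continuous_toFun).isBounded.exists_norm_le
  obtain ⟨C', hC'⟩ := (isCompact_range τ.continuous_toFun).isBounded.exists_norm_le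
  refine ⟨Finset.Icc (-⌈C + C' + 1⌉) ⌈C + C' + 1⌉, fun x y m h => ?_⟩
  have h1 : ‖turn m‖ ≤ C + C' + 1 := by
    have : turn m = σ.toFun x - τ.toFun y - (σ.toFun x - (τ.toFun y + turn m)) := by abel
    rw [this]
    refine (norm_sub_le _ _).trans (add_le_add ((norm_sub_le _ _).trans ?_) h.le)
    exact add_le_add (hC _ ⟨x, rfl⟩) (hC' _ ⟨y, rfl⟩)
  have h2 : |(m : ℝ)| ≤ ‖turn m‖ := by
    refine le_trans ?_ (norm_snd_le (turn m))
    simp only [turn, norm_mul, Real.norm_eq_abs, abs_two, abs_of_pos Real.pi_pos]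
    nlinarith [abs_nonneg (m : ℝ), Real.pi_gt_three]
  have h3 := abs_le.1 ((h2.trans h1).trans (Int.le_ceil _))
  rw [Finset.mem_Icc]
  exact ⟨by exact_mod_cast h3.1, by exact_mod_cast h3.2⟩

theorem IsLocal.exists_finset {i j : ℕ} {N : ℕ → SmoothSimplex i → SmoothSimplex j → ℤ → ℝ}
    (hN : IsLocal N) (σ : SmoothSimplex i) (τ : SmoothSimplex j) :
    ∃ M : Finset ℤ, ∀ n m, N n σ τ m ≠ 0 → m ∈ M := by
  obtain ⟨M, hM⟩ := exists_bound_turn σ τ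
  refine ⟨M, fun n m h => ?_⟩
  obtain ⟨x, y, hxy⟩ := hN n σ τ m h
  exact hM x y m (norm_lt_one_of_mollifier_ne_zero hxy)

theorem IsLocal.eventually_eq_zero {i j : ℕ} {N : ℕ → SmoothSimplex i → SmoothSimplex j → ℤ → ℝ}
    (hN : IsLocal N) (σ : SmoothSimplex i) (τ : SmoothSimplex j) (m : ℤ)
    (h : ∀ x y, σ.toFun x ≠ τ.toFun y + turn m) : ∀ᶠ n in atTop, N n σ τ m = 0 := by
  have hc : Continuous fun p : stdSimplex ℝ (Fin (i + 1)) × stdSimplex ℝ (Fin (j + 1)) =>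
      σ.toFun p.1 - (τ.toFun p.2 + turn m) :=
    (σ.continuous_toFun.comp continuous_fst).sub
      ((τ.continuous_toFun.comp continuous_snd).add continuous_const)
  filter_upwards [eventually_mollifier_eq_zero isCompact_univ hc.continuousOn
    fun p _ => sub_ne_zero.2 (h p.1 p.2)] with n hn
  by_contra hne
  obtain ⟨x, y, hxy⟩ := hN n σ τ m hne
  exact hxy (hn (x, y) trivial)

variable {k : ℕ}

/-! ### The flat pairing -/

/-- The weights of the pairing in the basis `u_a`. -/
def pairingWeight (k a : ℕ) : ℂ := (-1) ^ a * ((a ! : ℂ) * ((k - a)! : ℂ) / (k ! : ℂ))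

theorem topPairing_eq (k : ℕ) (m m' : Fin (k + 1) → ℂ) :
    topPairing k m m' = (2 * Real.pi * Complex.I) ^ k *
      ∑ a : Fin (k + 1), pairingWeight k a * m a * m' a.rev := by
  unfold topPairing
  congr 1
  refine Finset.sum_congr rfl fun a _ => ?_
  rw [Finset.sum_eq_single a.rev]
  · have : (a : ℕ) + (a.rev : ℕ) = k := by rw [Fin.val_rev]; omega
    rw [if_pos this, pairingWeight, show (k - a : ℕ) = (a.rev : ℕ) by omega]
  · intro b _ hb
    rw [if_neg]
    intro h
    apply hb
    ext
    rw [Fin.val_rev]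
    omega
  · simp

theorem topPairing_swap (k : ℕ) (m m' : Fin (k + 1) → ℂ) :
    topPairing k m m' = (-1) ^ k * topPairing k m' m := by
  rw [topPairing_eq, topPairing_eq, mul_left_comm]
  congr 1
  rw [Finset.mul_sum, ← Equiv.sum_comp Fin.revPerm]
  refine Finset.sum_congr rfl fun a _ => ?_
  have ha : (a : ℕ) ≤ k := by omega
  have : pairingWeight k (a.rev : Fin (k + 1)) = (-1) ^ k * pairingWeight k a := by
    unfold pairingWeight
    have hpow : (-1 : ℂ) ^ (k - a : ℕ) = (-1) ^ k * (-1) ^ (a : ℕ) := by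
      rw [← mul_left_inj' (pow_ne_zero (a : ℕ) (neg_ne_zero.2 (one_ne_zero (α := ℂ)))), ← pow_add,
        Nat.sub_add_cancel ha, mul_assoc, ← mul_pow]
      simp
    rw [Fin.val_rev, show k + 1 - (a + 1 : ℕ) = k - a by omega, Nat.sub_sub_self ha, hpow]
    ring
  simp only [Fin.revPerm_apply, this, Fin.rev_rev]
  ring

/-- The flat pairing as a bilinear form. -/
def topForm (k : ℕ) : (Fin (k + 1) → ℂ) →ₗ[ℂ] (Fin (k + 1) → ℂ) →ₗ[ℂ] ℂ :=
  LinearMap.mk₂ ℂ (topPairing k)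
    (fun e e' f => by
      simp only [topPairing_eq, ← mul_add, ← add_mul, ← Finset.sum_add_distrib, Pi.add_apply])
    (fun c e f => by
      simp only [topPairing_eq, smul_eq_mul, Pi.smul_apply, Finset.mul_sum]
      refine Finset.sum_congr rfl fun a _ => by ring)
    (fun e f f' => by
      simp only [topPairing_eq, ← mul_add, ← Finset.sum_add_distrib, Pi.add_apply])
    (fun c e f => by
      simp only [topPairing_eq, smul_eq_mul, Pi.smul_apply, Finset.mul_sum]
      refine Finset.sum_congr rfl fun a _ => by ring)

theorem topForm_apply (k : ℕ) (v w : Fin (k + 1) → ℂ) : topForm k v w = topPairing k v w := rfl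

/-- The pairing as a bilinear map on the values of sections at `0` and `- 2 π i m`. -/
def turnPairing (k : ℕ) (m : ℤ) : MultiSection k →ₗ[ℂ] MultiSection k →ₗ[ℂ] ℂ :=
  (topForm k).compl₁₂ (LinearMap.proj 0) (LinearMap.proj (-(2 * Real.pi * Complex.I * m)))

theorem turnPairing_apply (k : ℕ) (m : ℤ) (e f : MultiSection k) :
    turnPairing k m e f = topPairing k (e 0) (f (-(2 * Real.pi * Complex.I * m))) := rfl

/-- Infinitesimal flatness of the pairing: `z∇` is skew for it. Only entries next to the diagonal
are nonzero, and there the claim is a relation between consecutive factorials. -/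
theorem pairingWeight_connection (k : ℕ) (z : ℂ) (a c : Fin (k + 1)) :
    pairingWeight k a * connectionMatrix k z a c +
      pairingWeight k c * connectionMatrix k z c.rev a.rev = 0 := by
  have h : ∀ a c : ℕ, a ≤ k → a = c + 1 →
      pairingWeight k a * ((k : ℂ) - (c : ℕ)) + pairingWeight k c * a = 0 := by
    clear a c
    rintro _ c ha rfl
    unfold pairingWeight
    obtain ⟨b, rfl⟩ := Nat.exists_eq_add_of_le ha
    rw [show c + 1 + b - c = b + 1 by omega, Nat.add_sub_cancel_left, Nat.factorial_succ,
      Nat.factorial_succ]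
    push_cast
    ring
  have ha : (a : ℕ) ≤ k := by omega
  have hc : (c : ℕ) ≤ k := by omega
  simp only [connectionMatrix, Matrix.of_apply, Fin.val_rev]
  split_ifs with h1 h2 h3 h4 h5 h6 h7 <;> try omega
  · rw [Nat.cast_sub (by omega)]
    have := h a c ha h1
    push_cast
    rw [show (k : ℂ) - (k + 1 - (a + 1)) = a by ring]
    exact this
  · have := h c a hc h4.symm
    rw [Nat.cast_sub (by omega)]
    push_cast
    linear_combination z * this
  · simp

theorem topPairing_const {e f : MultiSection k} (he : IsFlat k e) (hf : IsFlat k f) (ζ : ℂ) :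
    topPairing k (e ζ) (f ζ) = topPairing k (e 0) (f 0) := by
  have hd : ∀ ζ, HasDerivAt (fun ζ => topPairing k (e ζ) (f ζ)) 0 ζ := by
    intro ζ
    simp only [topPairing_eq]
    have he' := fun a => hasDerivAt_pi.1 (he ζ) a
    have hf' := fun a => hasDerivAt_pi.1 (hf ζ) a
    have := (HasDerivAt.fun_sum (u := Finset.univ) fun (a : Fin (k + 1)) _ =>
      ((he' a).const_mul (pairingWeight k a)).mul (hf' a.rev)).const_mul
        ((2 * Real.pi * Complex.I) ^ k : ℂ)
    refine this.congr_deriv ?_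
    rw [mul_eq_zero]
    right
    simp only [Pi.neg_apply, Matrix.mulVec, dotProduct, mul_neg, neg_mul, Finset.sum_neg_distrib,
      Finset.sum_add_distrib, ← neg_add, neg_eq_zero]
    have h2 : ∑ a : Fin (k + 1), pairingWeight k a * e ζ a *
        ∑ c, connectionMatrix k (Complex.exp ζ) a.rev c * f ζ c =
        ∑ a : Fin (k + 1), ∑ c : Fin (k + 1), pairingWeight k c *
          connectionMatrix k (Complex.exp ζ) c.rev a.rev * e ζ c * f ζ a.rev := by
      rw [Finset.sum_comm]
      refine Finset.sum_congr rfl fun a _ => ?_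
      rw [Finset.mul_sum, ← Equiv.sum_comp Fin.revPerm]
      refine Finset.sum_congr rfl fun c _ => ?_
      simp only [Fin.revPerm_apply]
      ring
    rw [h2, ← Finset.sum_add_distrib]
    refine Finset.sum_eq_zero fun a _ => ?_
    rw [Finset.mul_sum, Finset.sum_mul, ← Finset.sum_add_distrib]
    refine Finset.sum_eq_zero fun c _ => ?_
    linear_combination (e ζ c * f ζ a.rev) * pairingWeight_connection k (Complex.exp ζ) a c
  exact is_const_of_deriv_eq_zero (fun x => (hd x).differentiableAt) (fun x => (hd x).deriv) ζ 0

theorem exp_sub_turn (ζ : ℂ) (m : ℤ) :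
    Complex.exp (ζ + 2 * Real.pi * Complex.I * m) = Complex.exp ζ := by
  rw [mul_comm (2 * Real.pi * Complex.I), Complex.exp_periodic.int_mul m ζ]

theorem IsFlat.shift {e : MultiSection k} (he : IsFlat k e) (m : ℤ) :
    IsFlat k fun ζ => e (ζ + 2 * Real.pi * Complex.I * m) := by
  intro ζ
  have := HasDerivAt.comp_add_const ζ (2 * Real.pi * Complex.I * m) (he (ζ + _))
  rwa [exp_sub_turn] at this

/-- Where `σ` meets the translate of `τ` by `m` turns, the logarithmic coordinates differ by `2πim`.
Flatness makes the pairing of the two branches a function of `m` alone, so it can be taken out of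
the smeared integrals. -/
theorem topPairing_turn {e f : MultiSection k} (he : IsFlat k e) (hf : IsFlat k f) (m : ℤ)
    (ζ : ℂ) :
    topPairing k (e ζ) (f (ζ - 2 * Real.pi * Complex.I * m)) = turnPairing k m e f := by
  have := topPairing_const he (hf.shift (-m)) ζ
  rw [turnPairing_apply]
  simpa [sub_eq_add_neg] using this

theorem turnPairing_swap {e f : MultiSection k} (he : IsFlat k e) (hf : IsFlat k f) (m : ℤ) :
    turnPairing k m e f = (-1) ^ k * turnPairing k (-m) f e := by
  rw [← topPairing_turn he hf m (2 * Real.pi * Complex.I * m), topPairing_swap, sub_self,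
    turnPairing_apply]
  simp

theorem turnPairing_shift_left {e f : MultiSection k} (he : IsFlat k e) (hf : IsFlat k f)
    (m : ℤ) : turnPairing k (m + 1) e f =
      turnPairing k m (fun ζ => e (ζ + 2 * Real.pi * Complex.I)) f := by
  rw [← topPairing_turn he hf (m + 1) (2 * Real.pi * Complex.I), turnPairing_apply, zero_add]
  congr 2
  push_cast
  ring

theorem turnPairing_shift_right (e f : MultiSection k) (m : ℤ) : turnPairing k m e f =
      turnPairing k (m + 1) e (fun ζ => f (ζ + 2 * Real.pi * Complex.I)) := by
  rw [turnPairing_apply, turnPairing_apply]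
  congr 2
  push_cast
  ring

/-! ### Smeared intersection pairings of chains -/

variable {i j : ℕ}

/-- The bilinear pairing of coefficients attached to a kernel with finite support in `m`. -/
def kernelPairing (k : ℕ) (N : ℤ → ℝ) : MultiSection k →ₗ[ℂ] MultiSection k →ₗ[ℂ] ℂ :=
  ∑ᶠ m : ℤ, (N m : ℂ) • turnPairing k m

theorem kernelPairing_eq_sum {N : ℤ → ℝ} {M : Finset ℤ} (hM : ∀ m, N m ≠ 0 → m ∈ M)
    (e f : MultiSection k) :
    kernelPairing k N e f = ∑ m ∈ M, (N m : ℂ) * turnPairing k m e f := by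
  rw [kernelPairing, finsum_eq_sum_of_support_subset (s := M)]
  · simp
  · intro m hm
    refine hM m fun h => hm ?_
    simp [h]

theorem kernelPairing_eq_finsum {N : ℤ → ℝ} {M : Finset ℤ} (hM : ∀ m, N m ≠ 0 → m ∈ M)
    (e f : MultiSection k) :
    kernelPairing k N e f = ∑ᶠ m : ℤ, (N m : ℂ) * turnPairing k m e f := by
  rw [kernelPairing_eq_sum hM, finsum_eq_sum_of_support_subset]
  intro m hm
  refine hM m fun h => hm ?_
  simp [h]

/-- The bilinear pairing of chains attached to a kernel on simplices. -/
def chainPairing (k : ℕ) (N : SmoothSimplex i → SmoothSimplex j → ℤ → ℝ) :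
    Chain k i →ₗ[ℂ] Chain k j →ₗ[ℂ] ℂ :=
  Finsupp.lsum ℂ fun σ => LinearMap.flip (Finsupp.lsum ℂ fun τ =>
    (kernelPairing k (N σ τ)).flip)

theorem chainPairing_single (N : SmoothSimplex i → SmoothSimplex j → ℤ → ℝ)
    (σ : SmoothSimplex i) (τ : SmoothSimplex j) (e f : MultiSection k) :
    chainPairing k N (Finsupp.single σ e) (Finsupp.single τ f) = kernelPairing k (N σ τ) e f := by
  simp [chainPairing]

theorem chainPairing_eq_sum (N : SmoothSimplex i → SmoothSimplex j → ℤ → ℝ)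
    (a : Chain k i) (b : Chain k j) :
    chainPairing k N a b =
      a.sum fun σ e => b.sum fun τ f => kernelPairing k (N σ τ) e f := by
  simp [chainPairing, Finsupp.sum, LinearMap.sum_apply]

/-! ### Dual growth conditions and the vanishing of boundaries -/

/-- Two growth conditions are dual if flat sections that satisfy them are orthogonal. -/
def IsDual (G G' : MultiSection k → ℝ × ℝ → Prop) : Prop :=
  ∀ e f, IsFlat k e → IsFlat k f → ∀ p ∈ boundaryStrip, ∀ m : ℤ, G e (p + turn m) → G' f p →
    turnPairing k m e f = 0

theorem turn_mem_boundaryStrip {p : ℝ × ℝ} {m : ℤ} :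
    p + turn m ∈ boundaryStrip ↔ p ∈ boundaryStrip := by
  simp [boundaryStrip, turn]

/-- For each of the finitely many relevant `m`, either `σ` misses the translate of `τ` and the
kernel eventually vanishes, or they meet. In the latter case the common point lies on the boundary,
because one simplex does, and both growth conditions hold there, so duality kills the coefficient.
-/
theorem eventually_kernelPairing_eq_zero
    {N : ℕ → SmoothSimplex i → SmoothSimplex j → ℤ → ℝ} (hN : IsLocal N)
    {G G' : MultiSection k → ℝ × ℝ → Prop} (hG : IsDual G G') {σ : SmoothSimplex i}
    {τ : SmoothSimplex j} {e f : MultiSection k} (he : Admissible G σ e) (hf : Admissible G' τ f)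
    (h : (∀ x, σ.toFun x ∈ boundaryStrip) ∨ ∀ y, τ.toFun y ∈ boundaryStrip) :
    ∀ᶠ n in atTop, kernelPairing k (N n σ τ) e f = 0 := by
  obtain ⟨M, hM⟩ := hN.exists_finset σ τ
  have key : ∀ m ∈ M, ∀ᶠ n in atTop, (N n σ τ m : ℂ) * turnPairing k m e f = 0 := by
    intro m _
    by_cases hxy : ∀ x y, σ.toFun x ≠ τ.toFun y + turn m
    · filter_upwards [hN.eventually_eq_zero σ τ m hxy] with n hn
      simp [hn]
    · push Not at hxy
      obtain ⟨x, y, hxy⟩ := hxy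
      have hb : τ.toFun y ∈ boundaryStrip := by
        rcases h with h | h
        · rw [← turn_mem_boundaryStrip (m := m), ← hxy]; exact h x
        · exact h y
      have h0 : turnPairing k m e f = 0 := hG e f he.1 hf.1 _ hb m
        (by rw [← hxy]; exact he.2 x (by rw [hxy, turn_mem_boundaryStrip]; exact hb)) (hf.2 y hb)
      simp [h0]
  filter_upwards [(Finset.eventually_all M).2 key] with n hn
  rw [kernelPairing_eq_sum (hM n)]
  exact Finset.sum_eq_zero hn

theorem eventually_span {ι : Type*} {l : Filter ι} {E F : Type*} [AddCommGroup E] [Module ℂ E]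
    [AddCommGroup F] [Module ℂ F] (P : ι → E →ₗ[ℂ] F →ₗ[ℂ] ℂ) {s : Set E} {t : Set F}
    (h : ∀ x ∈ s, ∀ y ∈ t, ∀ᶠ n in l, P n x y = 0) {x : E} (hx : x ∈ Submodule.span ℂ s) {y : F}
    (hy : y ∈ Submodule.span ℂ t) : ∀ᶠ n in l, P n x y = 0 := by
  induction hx using Submodule.span_induction with
  | mem x hx =>
    induction hy using Submodule.span_induction with
    | mem y hy => exact h x hx y hy
    | zero => simp
    | add y z _ _ hy hz => filter_upwards [hy, hz] with n h1 h2; simp [h1, h2]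
    | smul c y _ hy => filter_upwards [hy] with n h1; simp [h1]
  | zero => simp
  | add y z _ _ hy hz => filter_upwards [hy, hz] with n h1 h2; simp [h1, h2]
  | smul c y _ hy => filter_upwards [hy] with n h1; simp [h1]

/-- Null generators vanish for two reasons: those on the boundary by duality, once the mollifier is
narrow; differences of two lifts for every mollifier, by shifting the summation over `m` by one. -/
theorem eventually_chainPairing_null_right {G G' : MultiSection k → ℝ × ℝ → Prop}
    (hG : IsDual G G') {c : Chain k 2} (hc : c ∈ twistedChains G 2) {d : Chain k 0}
    (hd : d ∈ nullChains G' 0) :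
    ∀ᶠ n in atTop, chainPairing k (squarePoint n) c d = 0 := by
  refine eventually_span (fun n => chainPairing k (squarePoint n)) ?_ hc hd
  rintro _ ⟨σ, e, he, rfl⟩ _ (⟨p, g, hg, hb, rfl⟩ | ⟨p, g, hg, rfl⟩)
  · simp only [chainPairing_single]
    exact eventually_kernelPairing_eq_zero isLocal_squarePoint hG he hg (Or.inr hb)
  · refine Eventually.of_forall fun n => ?_
    obtain ⟨M, hM⟩ := isLocal_squarePoint.exists_finset σ p
    obtain ⟨M', hM'⟩ := isLocal_squarePoint.exists_finset σ p.deck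
    rw [map_sub, chainPairing_single, chainPairing_single, kernelPairing_eq_finsum (hM' n),
      kernelPairing_eq_finsum (hM n), sub_eq_zero, ← finsum_comp_equiv (Equiv.addRight (1 : ℤ))
        (f := fun m => (squarePoint n σ p m : ℂ) * _)]
    refine finsum_congr fun m => ?_
    rw [squarePoint_deck, turnPairing_shift_right]
    rfl

theorem eventually_chainPairing_null_left {G G' : MultiSection k → ℝ × ℝ → Prop}
    (hG : IsDual G G') {c : Chain k 1} (hc : c ∈ nullChains G 1) {d : Chain k 1}
    (hd : d ∈ twistedChains G' 1) :
    ∀ᶠ n in atTop, chainPairing k (curveCurve n) c d = 0 := by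
  refine eventually_span (fun n => chainPairing k (curveCurve n)) ?_ hc hd
  rintro _ (⟨σ, e, he, hb, rfl⟩ | ⟨σ, e, he, rfl⟩) _ ⟨τ, f, hf, rfl⟩
  · simp only [chainPairing_single]
    exact eventually_kernelPairing_eq_zero isLocal_curveCurve hG he hf (Or.inl hb)
  · refine Eventually.of_forall fun n => ?_
    obtain ⟨M, hM⟩ := isLocal_curveCurve.exists_finset σ τ
    obtain ⟨M', hM'⟩ := isLocal_curveCurve.exists_finset σ.deck τ
    rw [map_sub, LinearMap.sub_apply, chainPairing_single, chainPairing_single,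
      kernelPairing_eq_finsum (hM' n), kernelPairing_eq_finsum (hM n), sub_eq_zero,
      ← finsum_comp_equiv (Equiv.addRight (1 : ℤ))
        (f := fun m => (curveCurve n σ.deck τ m : ℂ) * _)]
    refine finsum_congr fun m => ?_
    rw [Equiv.coe_addRight, curveCurve_deck, turnPairing_shift_left he.1 hf.1]

/-- Stokes' theorem for chains: `curveCurve_face` for each translate, weighted by `turnPairing` and
summed over a finite set that serves all five kernels. -/
theorem chainPairing_boundary (n : ℕ) (c : Chain k 2) (b : Chain k 1) :
    chainPairing k (curveCurve n) (boundary k 1 c) b =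
      chainPairing k (squarePoint n) c (boundary k 0 b) := by
  have : (chainPairing k (curveCurve n)).comp (boundary k 1) =
      (chainPairing k (squarePoint n)).compl₂ (boundary k 0) := by
    refine Finsupp.lhom_ext fun σ e => ?_
    refine Finsupp.lhom_ext fun τ f => ?_
    have e2 : ∀ g : Fin (0 + 2) → ℂ, ∑ x, g x = g 0 + g 1 := Fin.sum_univ_two
    have e3 : ∀ g : Fin (1 + 2) → ℂ, ∑ x, g x = g 0 + g 1 + g 2 := Fin.sum_univ_three
    simp only [LinearMap.comp_apply, LinearMap.compl₂_apply, boundary, Finsupp.lsum_single,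
      LinearMap.sum_apply, LinearMap.smul_apply, Finsupp.lsingle_apply, map_sum, map_smul,
      chainPairing_single, e2, e3]
    obtain ⟨M0, h0⟩ := isLocal_curveCurve.exists_finset (σ.face 0) τ
    obtain ⟨M1, h1⟩ := isLocal_curveCurve.exists_finset (σ.face 1) τ
    obtain ⟨M2, h2⟩ := isLocal_curveCurve.exists_finset (σ.face 2) τ
    obtain ⟨M3, h3⟩ := isLocal_squarePoint.exists_finset σ (τ.face 0)
    obtain ⟨M4, h4⟩ := isLocal_squarePoint.exists_finset σ (τ.face 1)
    set M := M0 ∪ M1 ∪ M2 ∪ M3 ∪ M4 with hM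
    rw [kernelPairing_eq_sum (M := M) (fun m h => by simp [hM, h0 n m h]),
      kernelPairing_eq_sum (M := M) (fun m h => by simp [hM, h1 n m h]),
      kernelPairing_eq_sum (M := M) (fun m h => by simp [hM, h2 n m h]),
      kernelPairing_eq_sum (M := M) (fun m h => by simp [hM, h3 n m h]),
      kernelPairing_eq_sum (M := M) (fun m h => by simp [hM, h4 n m h])]
    simp only [Finset.smul_sum, ← Finset.sum_add_distrib]
    refine Finset.sum_congr rfl fun m _ => ?_
    have := congrArg (fun x : ℝ => (x : ℂ)) (curveCurve_face n σ τ m)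
    push_cast at this
    simp only [smul_eq_mul]
    norm_num
    linear_combination (turnPairing k m e f) * this
  exact LinearMap.congr_fun (LinearMap.congr_fun this c) b

/-- Up to a null chain `a` is the boundary of some `c`; by adjunction it pairs with `b` as `c` does
with the boundary of `b`, which is null since `b` is a cycle. -/
theorem eventually_chainPairing_boundaries {G G' : MultiSection k → ℝ × ℝ → Prop}
    (hG : IsDual G G') {a : Chain k 1} (ha : a ∈ twistedBoundaries G) {b : Chain k 1}
    (hb : b ∈ twistedCycles G') :
    ∀ᶠ n in atTop, chainPairing k (curveCurve n) a b = 0 := by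
  obtain ⟨_, ⟨c, hc, rfl⟩, d, hd, rfl⟩ := Submodule.mem_sup.1 ha
  filter_upwards [eventually_chainPairing_null_right hG hc hb.2,
    eventually_chainPairing_null_left hG hd hb.1] with n h1 h2
  rw [map_add, LinearMap.add_apply, h2, chainPairing_boundary, h1, add_zero]

theorem IsFlat.add {e f : MultiSection k} (he : IsFlat k e) (hf : IsFlat k f) :
    IsFlat k (e + f) := fun ζ => by
  refine ((he ζ).add (hf ζ)).congr_deriv ?_
  rw [Pi.add_apply, Matrix.mulVec_add, neg_add]

theorem IsFlat.smul (c : ℂ) {e : MultiSection k} (he : IsFlat k e) : IsFlat k (c • e) := fun ζ => by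
  refine ((he ζ).const_smul c).congr_deriv ?_
  rw [Pi.smul_apply, Matrix.mulVec_smul, smul_neg]

theorem isFlat_zero : IsFlat k 0 := fun ζ => by
  refine (hasDerivAt_const ζ (0 : Fin (k + 1) → ℂ)).congr_deriv ?_
  simp

theorem isFlat_of_mem_twistedChains {n : ℕ} {G : MultiSection k → ℝ × ℝ → Prop} {a : Chain k n}
    (ha : a ∈ twistedChains G n) (σ : SmoothSimplex n) : IsFlat k (a σ) := by
  induction ha using Submodule.span_induction with
  | mem x hx =>
    obtain ⟨τ, e, he, rfl⟩ := hx
    classical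
    rw [Finsupp.single_apply]
    split_ifs
    · exact he.1
    · exact isFlat_zero
  | zero => exact isFlat_zero
  | add x y _ _ hx hy => exact hx.add hy
  | smul c x _ hx => exact hx.smul c

/-- The minus sign comes from the kernel and `(-1)^k` from the symmetry of the pairing; exchanging
the simplices replaces `m` by `-m`. Flatness of the coefficients is what makes the weights
comparable. -/
theorem chainPairing_swap (n : ℕ) {G G' : MultiSection k → ℝ × ℝ → Prop} {a b : Chain k 1}
    (ha : a ∈ twistedChains G 1) (hb : b ∈ twistedChains G' 1) :
    chainPairing k (curveCurve n) a b = -((-1) ^ k * chainPairing k (curveCurve n) b a) := by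
  rw [chainPairing_eq_sum, chainPairing_eq_sum, Finsupp.sum_comm]
  simp only [Finsupp.sum, Finset.mul_sum, ← Finset.sum_neg_distrib]
  refine Finset.sum_congr rfl fun τ _ => Finset.sum_congr rfl fun σ _ => ?_
  obtain ⟨M, hM⟩ := isLocal_curveCurve.exists_finset σ τ
  obtain ⟨M', hM'⟩ := isLocal_curveCurve.exists_finset τ σ
  rw [kernelPairing_eq_finsum (hM n), kernelPairing_eq_sum (hM' n),
    ← finsum_comp_equiv (Equiv.neg ℤ), finsum_eq_sum_of_support_subset (s := M'), Finset.mul_sum,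
    ← Finset.sum_neg_distrib]
  · refine Finset.sum_congr rfl fun m _ => ?_
    rw [Equiv.neg_apply, curveCurve_swap, turnPairing_swap (isFlat_of_mem_twistedChains ha σ)
      (isFlat_of_mem_twistedChains hb τ), neg_neg]
    push_cast
    ring
  · intro m hm
    refine hM' n m fun h => hm ?_
    simp [curveCurve_swap n σ τ, h]

/-- The crossings split disjointly according to the number `m` of turns between the two lifts. On
each piece the coefficient pairing is constant, and the signs are counted by
`meets_finite_and_eventually`. -/
theorem eventually_kernelPairing_eq_crossings {σ τ : SmoothSimplex 1} {e f : MultiSection k}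
    (he : IsFlat k e) (hf : IsFlat k f)
    (h : ∀ p ∈ crossings σ τ, p.1 ∈ Ioo (0 : ℝ) 1 ∧ p.2 ∈ Ioo (0 : ℝ) 1 ∧
      σ.path p.1 ∈ openStrip ∧ crossingDet σ τ p ≠ 0) :
    ∀ᶠ n in atTop, kernelPairing k (curveCurve n σ τ) e f = ∑ᶠ p ∈ crossings σ τ,
      ((SignType.sign (crossingDet σ τ p) : ℤ) : ℂ) *
        topPairing k (e (logCoord (σ.path p.1))) (f (logCoord (τ.path p.2))) := by
  obtain ⟨M, hM⟩ := isLocal_curveCurve.exists_finset σ τ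
  obtain ⟨M', hM'⟩ := exists_bound_turn σ τ
  set Z : ℤ → Set (ℝ × ℝ) := fun m => meets σ.curve fun t => τ.curve t + turn m with hZ
  have hpath : ∀ m, ∀ p ∈ Z m, σ.path p.1 = τ.path p.2 + turn m := fun m p hp => by
    rw [σ.path_eq_curve hp.1, τ.path_eq_curve hp.2.1]
    exact hp.2.2
  have hmem : ∀ m, Z m ⊆ crossings σ τ := fun m p hp => ⟨hp.1, hp.2.1, m, hpath m p hp⟩
  have hdet : ∀ m, ∀ p ∈ Z m, cross (deriv σ.curve p.1) (deriv (fun t => τ.curve t + turn m) p.2) =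
      crossingDet σ τ p := fun m p hp => by
    have := h p (hmem m hp)
    rw [crossingDet, σ.deriv_path this.1, τ.deriv_path this.2.1, deriv_add_const]
    rfl
  have hfin := fun m => meets_finite_and_eventually σ.contDiff_curve
    (τ.contDiff_curve.add (contDiff_const (c := turn m))) (fun p hp =>
      ⟨(h p (hmem m hp)).1, (h p (hmem m hp)).2.1, by
        have := hdet m p hp
        exact this ▸ (h p (hmem m hp)).2.2.2⟩)
  have hcr : crossings σ τ = ⋃ m ∈ (↑(M ∪ M') : Set ℤ), Z m := by
    ext p
    rw [mem_iUnion₂]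
    constructor
    · rintro ⟨h1, h2, m, hm⟩
      rw [σ.path_eq_curve h1, τ.path_eq_curve h2] at hm
      refine ⟨m, ?_, h1, h2, hm⟩
      obtain ⟨x, hx⟩ := σ.exists_curve_eq h1
      obtain ⟨y, hy⟩ := τ.exists_curve_eq h2
      have : m ∈ M' := hM' x y m (by
        rw [← hx, ← hy, show σ.curve p.1 = τ.curve p.2 + turn m from hm, sub_self, norm_zero]
        exact one_pos)
      simp [this]
    · rintro ⟨m, _, hp⟩
      exact hmem m hp
  have hdisj : (↑(M ∪ M') : Set ℤ).PairwiseDisjoint Z := by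
    intro m _ m' _ hne
    rw [Function.onFun, Set.disjoint_left]
    intro p hp hp'
    have h1 : τ.curve p.2 + turn m = τ.curve p.2 + turn m' := hp.2.2.symm.trans hp'.2.2
    have h2 := congrArg Prod.snd (add_left_cancel h1)
    simp only [turn] at h2
    have h3 : (m : ℝ) = m' := mul_left_cancel₀ (by positivity : (2 * Real.pi) ≠ 0) h2
    exact hne (by exact_mod_cast h3)
  have hlog : ∀ m, ∀ p ∈ Z m, topPairing k (e (logCoord (σ.path p.1))) (f (logCoord (τ.path p.2)))
      = turnPairing k m e f := by
    intro m p hp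
    rw [← topPairing_turn he hf m (logCoord (σ.path p.1))]
    congr 2
    rw [hpath m p hp]
    simp only [logCoord, turn, Prod.fst_add, Prod.snd_add, add_zero]
    push_cast
    ring
  have hev : ∀ᶠ n in atTop, ∀ m ∈ M ∪ M', curveCurve n σ τ m =
      ∑ᶠ p ∈ Z m, ((SignType.sign (cross (deriv σ.curve p.1)
        (deriv (fun t => τ.curve t + turn m) p.2)) : ℤ) : ℝ) :=
    (Finset.eventually_all _).2 fun m _ => (hfin m).2
  filter_upwards [hev] with n hn
  rw [kernelPairing_eq_sum (M := M ∪ M') (fun m h => Finset.mem_union_left _ (hM n m h)), hcr,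
    finsum_mem_biUnion hdisj (Finset.finite_toSet _) (fun m _ => (hfin m).1), finsum_mem_coe_finset]
  refine Finset.sum_congr rfl fun m hm => ?_
  have hZf : (Z m).Finite := (hfin m).1
  rw [hn m hm, finsum_mem_eq_finite_toFinset_sum _ hZf, finsum_mem_eq_finite_toFinset_sum _ hZf]
  push_cast
  rw [Finset.sum_mul]
  refine Finset.sum_congr rfl fun p hp => ?_
  have hp' : p ∈ Z m := by simpa using hp
  rw [hlog m p hp', hdet m p hp']
  congr 1
  cases SignType.sign (crossingDet σ τ p) <;> simp

theorem eventually_chainPairing_eq_intersectionNumber {G G' : MultiSection k → ℝ × ℝ → Prop}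
    {a b : Chain k 1} (ha : a ∈ twistedChains G 1) (hb : b ∈ twistedChains G' 1)
    (h : InGeneralPosition a b) :
    ∀ᶠ n in atTop, chainPairing k (curveCurve n) a b = intersectionNumber a b := by
  have hev : ∀ᶠ n in atTop, ∀ σ ∈ a.support, ∀ τ ∈ b.support,
      kernelPairing k (curveCurve n σ τ) (a σ) (b τ) = ∑ᶠ p ∈ crossings σ τ,
      ((SignType.sign (crossingDet σ τ p) : ℤ) : ℂ) *
        topPairing k (a σ (logCoord (σ.path p.1))) (b τ (logCoord (τ.path p.2))) :=
    (Finset.eventually_all _).2 fun σ hσ => (Finset.eventually_all _).2 fun τ hτ =>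
      eventually_kernelPairing_eq_crossings (isFlat_of_mem_twistedChains ha σ)
        (isFlat_of_mem_twistedChains hb τ) (h σ hσ τ hτ)
  filter_upwards [hev] with n hn
  rw [chainPairing_eq_sum, intersectionNumber]
  exact Finset.sum_congr rfl fun σ hσ => Finset.sum_congr rfl fun τ hτ => hn σ hσ τ hτ

/-! ### Rapid decay and moderate growth are dual -/

theorem nhdsWithin_openStrip_neBot {p : ℝ × ℝ} (hp : p ∈ boundaryStrip) :
    (𝓝[openStrip] p).NeBot := by
  rw [← mem_closure_iff_nhdsWithin_neBot]
  have : openStrip = Ioo (0 : ℝ) 1 ×ˢ (univ : Set ℝ) := by ext q; simp [openStrip]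
  rw [this, closure_prod_eq, closure_Ioo zero_ne_one]
  refine ⟨?_, by simp⟩
  rcases hp with h | h <;> rw [h] <;> simp

theorem tendsto_boundary {p : ℝ × ℝ} (hp : p ∈ boundaryStrip) :
    Tendsto (fun q : ℝ × ℝ => q.1 * (1 - q.1)) (𝓝[openStrip] p) (𝓝 0) := by
  have h : Continuous fun q : ℝ × ℝ => q.1 * (1 - q.1) := by fun_prop
  have h0 : p.1 * (1 - p.1) = 0 := by rcases hp with h | h <;> simp [h]
  exact h0 ▸ (h.tendsto p).mono_left nhdsWithin_le_nhds

theorem tendsto_add_turn (p : ℝ × ℝ) (m : ℤ) :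
    Tendsto (fun q => q + turn m) (𝓝[openStrip] p) (𝓝[openStrip] (p + turn m)) := by
  refine tendsto_nhdsWithin_iff.2 ⟨?_, ?_⟩
  · exact ((continuous_id.add continuous_const).tendsto p).mono_left nhdsWithin_le_nhds
  · filter_upwards [self_mem_nhdsWithin] with q hq
    simpa [openStrip, turn] using hq

theorem logCoord_add_turn (q : ℝ × ℝ) (m : ℤ) :
    logCoord (q + turn m) = logCoord q + 2 * Real.pi * Complex.I * m := by
  simp only [logCoord, turn, Prod.fst_add, Prod.snd_add, add_zero]
  push_cast
  ring

/-- The pairing of the two flat sections is constant, while the decay of one beats the growth of the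
other, so the constant is zero. -/
theorem isDual_rapidDecay_moderateGrowth (k : ℕ) :
    IsDual (RapidDecayAt k) (ModerateGrowthAt k) := by
  intro e f he hf p hp m hG hG'
  have := nhdsWithin_openStrip_neBot hp
  obtain ⟨N, hN⟩ := hG'
  -- One order of decay more than the growth exponent `N` leaves a factor `ρ (1 - ρ)`, which tends
  -- to zero.
  have hE := (hG (N + 1)).comp_tendsto (tendsto_add_turn p m)
  have hO : (fun q => topPairing k (e (logCoord (q + turn m))) (f (logCoord q)))
      =O[𝓝[openStrip] p] fun q : ℝ × ℝ => q.1 * (1 - q.1) := by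
    simp only [topPairing_eq]
    refine (Asymptotics.IsBigO.fun_sum fun a _ => ?_).const_mul_left _
    have h1 := (Asymptotics.isBigO_pi.1 hE a).const_mul_left (pairingWeight k a)
    have h2 := Asymptotics.isBigO_pi.1 hN a.rev
    refine (h1.mul h2).congr' EventuallyEq.rfl ?_
    filter_upwards [self_mem_nhdsWithin] with q hq
    have : q.1 * (1 - q.1) ≠ 0 := (mul_pos hq.1 (sub_pos.2 hq.2)).ne'
    simp only [Function.comp_apply, turn, Prod.fst_add, add_zero]
    field_simp
    ring
  have hc : ∀ q, topPairing k (e (logCoord (q + turn m))) (f (logCoord q)) =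
      turnPairing k m e f := fun q => by
    rw [← topPairing_turn he hf m (logCoord (q + turn m)), logCoord_add_turn, add_sub_cancel_right]
  simp only [hc] at hO
  exact tendsto_nhds_unique tendsto_const_nhds (hO.trans_tendsto (tendsto_boundary hp))

theorem IsDual.symm {G G' : MultiSection k → ℝ × ℝ → Prop} (h : IsDual G G') : IsDual G' G := by
  intro e f he hf p hp m h1 h2
  rw [turnPairing_swap he hf, h f e hf he (p + turn m) (turn_mem_boundaryStrip.2 hp) (-m) ?_ h1,
    mul_zero]
  rwa [add_assoc, ← turn_add, add_neg_cancel, show turn 0 = 0 by simp [turn], add_zero]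

/-! ### Descent of the intersection number to homology -/

theorem sub_mem_twistedBoundaries {G : MultiSection k → ℝ × ℝ → Prop} {a a' : Chain k 1}
    {ha : a ∈ twistedCycles G} {ha' : a' ∈ twistedCycles G}
    (h : homologyClass a ha = homologyClass a' ha') : a - a' ∈ twistedBoundaries G :=
  (Submodule.Quotient.eq _).1 (congrArg Subtype.val h)

/-- The intersection number of cycles in general position depends only on homology classes. -/
theorem intersectionNumber_eq_of_homologous {a a' b b' : Chain k 1} {ha : a ∈ rdCycles k}
    {ha' : a' ∈ rdCycles k} {hb : b ∈ modCycles k} {hb' : b' ∈ modCycles k}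
    (haa : homologyClass a ha = homologyClass a' ha')
    (hbb : homologyClass b hb = homologyClass b' hb') (h : InGeneralPosition a b)
    (h' : InGeneralPosition a' b') : intersectionNumber a b = intersectionNumber a' b' := by
  have hd := isDual_rapidDecay_moderateGrowth k
  -- One mollifier serves all four statements. First `a` is replaced by `a'` against `b`, then `b`
  -- by `b'` against `a'`; the mixed pair need not be in general position, because only the smeared
  -- number is used for it.
  obtain ⟨n, h1, h2, h3, h4⟩ := (((eventually_chainPairing_eq_intersectionNumber ha.1 hb.1 h).and
    ((eventually_chainPairing_eq_intersectionNumber ha'.1 hb'.1 h').and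
    ((eventually_chainPairing_boundaries hd (sub_mem_twistedBoundaries haa) hb).and
    (eventually_chainPairing_boundaries hd.symm (sub_mem_twistedBoundaries hbb) ha')))).exists)
  rw [← h1, ← h2]
  rw [map_sub, LinearMap.sub_apply, sub_eq_zero] at h3
  rw [h3, ← sub_eq_zero, ← map_sub, chainPairing_swap n ha'.1 ((twistedCycles _).sub_mem hb hb').1,
    h4, mul_zero, neg_zero]

theorem hasBettiPairing_of_generalPosition {a a' b b' : Chain k 1} {ha : a ∈ rdCycles k}
    {ha' : a' ∈ rdCycles k} {hb : b ∈ modCycles k} {hb' : b' ∈ modCycles k}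
    (haa : homologyClass a' ha' = homologyClass a ha)
    (hbb : homologyClass b' hb' = homologyClass b hb) (h : InGeneralPosition a' b') :
    HasBettiPairing (homologyClass a ha) (homologyClass b hb) (intersectionNumber a' b') :=
  ⟨⟨a', ha', b', hb', haa, hbb, h⟩, fun _ _ _ _ h1 h2 h3 =>
    intersectionNumber_eq_of_homologous (h1.trans haa.symm) (h2.trans hbb.symm) h3 h⟩

/-! ### Solutions of the Bessel equation on the universal cover -/

/-- `f` solves `f'' = e^ζ f` on `U`, with first derivative `f'`. -/
def SolvesBessel (U : Set ℂ) (f f' : ℂ → ℂ) : Prop :=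
  ∀ ζ ∈ U, HasDerivAt f (f' ζ) ζ ∧ HasDerivAt f' (Complex.exp ζ * f ζ) ζ

/-- The Wronskian of two functions with given derivatives. -/
def wronskian (f f' g g' : ℂ → ℂ) (ζ : ℂ) : ℂ := f ζ * g' ζ - f' ζ * g ζ

theorem SolvesBessel.mono {U V : Set ℂ} {f f' : ℂ → ℂ} (h : SolvesBessel U f f') (hV : V ⊆ U) :
    SolvesBessel V f f' := fun ζ hζ => h ζ (hV hζ)

theorem SolvesBessel.linear {U : Set ℂ} {f f' g g' : ℂ → ℂ} (hf : SolvesBessel U f f')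
    (hg : SolvesBessel U g g') (a b : ℂ) :
    SolvesBessel U (fun ζ => a * f ζ + b * g ζ) (fun ζ => a * f' ζ + b * g' ζ) := fun ζ hζ =>
  ⟨((hf ζ hζ).1.const_mul a).add ((hg ζ hζ).1.const_mul b),
    (((hf ζ hζ).2.const_mul a).add ((hg ζ hζ).2.const_mul b)).congr_deriv (by ring)⟩

/-- The Wronskian of two solutions is constant; its value is found from a limit at `-∞`. -/
theorem wronskian_eq_of_tendsto {U : Set ℂ} (hU : IsOpen U) (hU' : IsPreconnected U)
    (hR : ∀ x : ℝ, (x : ℂ) ∈ U) {f f' g g' : ℂ → ℂ} (hf : SolvesBessel U f f')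
    (hg : SolvesBessel U g g') {w : ℂ}
    (hw : Tendsto (fun x : ℝ => wronskian f f' g g' x) atBot (𝓝 w)) {ζ : ℂ} (hζ : ζ ∈ U) :
    wronskian f f' g g' ζ = w := by
  have hd : ∀ ζ ∈ U, HasDerivAt (wronskian f f' g g') 0 ζ := fun ζ hζ =>
    (((hf ζ hζ).1.mul (hg ζ hζ).2).sub ((hf ζ hζ).2.mul (hg ζ hζ).1)).congr_deriv (by ring)
  have hc : ∀ x : ℝ, wronskian f f' g g' x = wronskian f f' g g' ζ := fun x =>
    hU.is_const_of_deriv_eq_zero hU' (fun ζ hζ => (hd ζ hζ).differentiableAt.differentiableWithinAt)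
      (fun ζ hζ => (hd ζ hζ).deriv) (hR x) hζ
  simp only [hc] at hw
  exact tendsto_nhds_unique tendsto_const_nhds hw

theorem wronskian_const {U : Set ℂ} (hU : IsOpen U) (hU' : IsPreconnected U)
    {f f' g g' : ℂ → ℂ} (hf : SolvesBessel U f f')
    (hg : SolvesBessel U g g') {ζ ξ : ℂ} (hζ : ζ ∈ U) (hξ : ξ ∈ U) :
    wronskian f f' g g' ζ = wronskian f f' g g' ξ := by
  have hd : ∀ ζ ∈ U, HasDerivAt (wronskian f f' g g') 0 ζ := fun ζ hζ =>
    (((hf ζ hζ).1.mul (hg ζ hζ).2).sub ((hf ζ hζ).2.mul (hg ζ hζ).1)).congr_deriv (by ring)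
  exact hU.is_const_of_deriv_eq_zero hU'
    (fun ζ hζ => (hd ζ hζ).differentiableAt.differentiableWithinAt)
      (fun ζ hζ => (hd ζ hζ).deriv) hζ hξ

/-- The linear relation between three plane vectors, with Wronskians as coefficients. It expands a
solution in a basis as soon as its Wronskians with the basis are known. -/
theorem wronskian_plucker (f f' g g' h h' : ℂ → ℂ) (ζ : ℂ) :
    f ζ * wronskian g g' h h' ζ + g ζ * wronskian h h' f f' ζ + h ζ * wronskian f f' g g' ζ = 0 := by
  unfold wronskian; ring

theorem wronskian_plucker' (f f' g g' h h' : ℂ → ℂ) (ζ : ℂ) :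
    f' ζ * wronskian g g' h h' ζ + g' ζ * wronskian h h' f f' ζ + h' ζ * wronskian f f' g g' ζ
      = 0 := by
  unfold wronskian; ring

theorem wronskian_swap (f f' g g' : ℂ → ℂ) (ζ : ℂ) :
    wronskian f f' g g' ζ = -wronskian g g' f f' ζ := by
  unfold wronskian; ring

/-! ### Entire series in `e^ζ` -/

/-- The coefficients of an entire power series. -/
def EntireCoeff (c : ℕ → ℂ) : Prop := ∀ r : ℝ, 0 ≤ r → Summable fun n => ‖c n‖ * r ^ n

/-- The series `∑ c_n e^(nζ)`. -/
def expSeries (c : ℕ → ℂ) (ζ : ℂ) : ℂ := ∑' n, c n * Complex.exp (n * ζ)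

theorem EntireCoeff.nat_mul {c : ℕ → ℂ} (hc : EntireCoeff c) :
    EntireCoeff fun n => (n : ℂ) * c n := by
  intro r hr
  refine Summable.of_nonneg_of_le (fun n => by positivity) (fun n => ?_) (hc (2 * r) (by positivity))
  have h2 : (n : ℝ) ≤ 2 ^ n := by exact_mod_cast n.lt_two_pow_self.le
  rw [norm_mul, Complex.norm_natCast, mul_pow]
  calc (n : ℝ) * ‖c n‖ * r ^ n = n * (‖c n‖ * r ^ n) := by ring
    _ ≤ 2 ^ n * (‖c n‖ * r ^ n) := by gcongr
    _ = ‖c n‖ * (2 ^ n * r ^ n) := by ring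

theorem EntireCoeff.of_le {c d : ℕ → ℂ} (hc : EntireCoeff c) (h : ∀ n, ‖d n‖ ≤ ‖c n‖) :
    EntireCoeff d := fun r hr =>
  Summable.of_nonneg_of_le (fun n => by positivity)
    (fun n => mul_le_mul_of_nonneg_right (h n) (by positivity)) (hc r hr)

theorem norm_expSeries_term (c : ℕ → ℂ) (n : ℕ) (ζ : ℂ) :
    ‖c n * Complex.exp (n * ζ)‖ = ‖c n‖ * Real.exp ζ.re ^ n := by
  rw [norm_mul, Complex.norm_exp, ← Real.exp_nat_mul]
  simp

theorem EntireCoeff.summable {c : ℕ → ℂ} (hc : EntireCoeff c) (ζ : ℂ) :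
    Summable fun n => c n * Complex.exp (n * ζ) := by
  refine Summable.of_norm ?_
  simp only [norm_expSeries_term]
  exact hc _ (Real.exp_pos _).le

theorem EntireCoeff.hasDerivAt {c : ℕ → ℂ} (hc : EntireCoeff c) (ζ : ℂ) :
    HasDerivAt (expSeries c) (expSeries (fun n => (n : ℂ) * c n) ζ) ζ := by
  have hopen : IsOpen {w : ℂ | w.re < ζ.re + 1} := isOpen_lt Complex.continuous_re continuous_const
  have hconv : IsPreconnected {w : ℂ | w.re < ζ.re + 1} :=
    (convex_halfSpace_re_lt (ζ.re + 1)).isPreconnected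
  have hmem : ζ ∈ {w : ℂ | w.re < ζ.re + 1} := lt_add_one ζ.re
  have hg : ∀ (n : ℕ) (w : ℂ), w ∈ {w : ℂ | w.re < ζ.re + 1} → HasDerivAt
      (fun w : ℂ => c n * Complex.exp (n * w)) ((n : ℂ) * c n * Complex.exp (n * w)) w := by
    intro n w _
    refine ((((hasDerivAt_id w).const_mul (n : ℂ)).cexp).const_mul (c n)).congr_deriv ?_
    simp only [id]
    ring
  have hg' : ∀ (n : ℕ) (w : ℂ), w ∈ {w : ℂ | w.re < ζ.re + 1} →
      ‖(n : ℂ) * c n * Complex.exp (n * w)‖ ≤ ‖(n : ℂ) * c n‖ * Real.exp (ζ.re + 1) ^ n := by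
    intro n w hw
    rw [norm_expSeries_term (fun n => (n : ℂ) * c n)]
    have : w.re ≤ ζ.re + 1 := le_of_lt hw
    gcongr
  exact hasDerivAt_tsum_of_isPreconnected (hc.nat_mul _ (Real.exp_pos _).le) hopen hconv hg hg'
    hmem (hc.summable ζ) hmem

theorem expSeries_periodic (c : ℕ → ℂ) (ζ : ℂ) :
    expSeries c (ζ + 2 * Real.pi * Complex.I) = expSeries c ζ := by
  unfold expSeries
  congr 1
  ext n
  have := Complex.exp_periodic.nat_mul n (n * ζ)
  rw [mul_add, this]

theorem exp_mul_expSeries {c d : ℕ → ℂ} (hd : EntireCoeff d) (h0 : d 0 = 0)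
    (h : ∀ n, d (n + 1) = c n) (ζ : ℂ) : expSeries d ζ = Complex.exp ζ * expSeries c ζ := by
  unfold expSeries
  rw [(hd.summable ζ).tsum_eq_zero_add, h0, zero_mul, zero_add, ← tsum_mul_left]
  congr 1
  ext n
  rw [h, Nat.cast_succ, add_mul, one_mul, Complex.exp_add]
  ring

theorem norm_expSeries_sub_le {c : ℕ → ℂ} (hc : EntireCoeff c) {x : ℝ} (hx : x ≤ 0) :
    ‖expSeries c x - c 0‖ ≤ Real.exp x * ∑' n, ‖c n‖ := by
  have hs : Summable fun n => ‖c n‖ := by simpa using hc 1 zero_le_one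
  unfold expSeries
  rw [(hc.summable x).tsum_eq_zero_add]
  simp only [Nat.cast_zero, zero_mul, Complex.exp_zero, mul_one, add_sub_cancel_left]
  have hle : ∀ n : ℕ, ‖c (n + 1) * Complex.exp ((n + 1 : ℕ) * x)‖ ≤ Real.exp x * ‖c (n + 1)‖ := by
    intro n
    rw [norm_expSeries_term, Complex.ofReal_re, mul_comm, pow_succ']
    have : Real.exp x ^ n ≤ 1 := pow_le_one₀ (Real.exp_pos _).le (Real.exp_le_one_iff.2 hx)
    have := Real.exp_pos x
    gcongr
    nlinarith
  have hs1 : Summable fun n => Real.exp x * ‖c (n + 1)‖ :=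
    ((summable_nat_add_iff 1).2 hs).mul_left _
  refine (tsum_of_norm_bounded hs1.hasSum hle).trans ?_
  rw [tsum_mul_left, hs.tsum_eq_zero_add]
  gcongr
  linarith [norm_nonneg (c 0)]

theorem isBigO_expSeries {c : ℕ → ℂ} (hc : EntireCoeff c) :
    (fun x : ℝ => expSeries c x - c 0) =O[atBot] Real.exp := by
  refine Asymptotics.IsBigO.of_bound (∑' n, ‖c n‖) ?_
  filter_upwards [eventually_le_atBot 0] with x hx
  rw [Real.norm_eq_abs, abs_of_pos (Real.exp_pos x), mul_comm]
  exact norm_expSeries_sub_le hc hx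

/-- The coefficients of the first solution. -/
def coeffI (n : ℕ) : ℂ := ((n ! : ℂ) ^ 2)⁻¹

/-- The coefficients of the holomorphic part of the second solution. -/
def coeffL (n : ℕ) : ℂ := -2 * (harmonic n : ℚ) * coeffI n

theorem entireCoeff_coeffI : EntireCoeff coeffI := by
  intro r hr
  refine Summable.of_nonneg_of_le (fun n => by positivity) (fun n => ?_)
    (Real.summable_pow_div_factorial r)
  have h1 : (1 : ℝ) ≤ n ! := by exact_mod_cast n.factorial_pos
  rw [coeffI, norm_inv, norm_pow, Complex.norm_natCast, div_eq_mul_inv, mul_comm]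
  gcongr
  nlinarith

theorem harmonic_le (n : ℕ) : harmonic n ≤ n := by
  induction n with
  | zero => simp
  | succ n ih =>
    rw [harmonic_succ]
    push_cast
    have : (((n : ℚ) + 1))⁻¹ ≤ 1 := inv_le_one_of_one_le₀ (by linarith [n.cast_nonneg (α := ℚ)])
    linarith

theorem entireCoeff_coeffL : EntireCoeff coeffL := by
  have h2 : EntireCoeff fun n => (n : ℂ) * coeffI n := entireCoeff_coeffI.nat_mul
  have h3 : EntireCoeff fun n => (2 : ℂ) * ((n : ℂ) * coeffI n) := fun r hr => by
    refine ((h2 r hr).mul_left 2).congr fun n => ?_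
    simp only [norm_mul, Complex.norm_ofNat]
    ring
  refine h3.of_le fun n => ?_
  have hh : (0 : ℚ) ≤ harmonic n := by unfold harmonic; positivity
  have : ‖((harmonic n : ℚ) : ℂ)‖ ≤ n := by
    rw [show ((harmonic n : ℚ) : ℂ) = (((harmonic n : ℚ) : ℝ) : ℂ) by push_cast; rfl,
      Complex.norm_real, Real.norm_of_nonneg (by exact_mod_cast hh)]
    exact_mod_cast harmonic_le n
  simp only [coeffL, norm_mul, norm_neg, Complex.norm_ofNat, Complex.norm_natCast]
  rw [mul_assoc]
  gcongr

theorem coeffI_succ (n : ℕ) : ((n : ℂ) + 1) ^ 2 * coeffI (n + 1) = coeffI n := by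
  unfold coeffI
  rw [Nat.factorial_succ]
  have : (n ! : ℂ) ≠ 0 := by exact_mod_cast n.factorial_ne_zero
  have : (n : ℂ) + 1 ≠ 0 := by exact_mod_cast n.succ_ne_zero
  push_cast
  field_simp

/-- Frobenius recursion for `ζ * solI ζ + expSeries coeffL ζ`: the inhomogeneous term comes from `2
* solI'` in the second derivative of `ζ * solI ζ`. -/
theorem coeffL_succ (n : ℕ) :
    2 * ((n : ℂ) + 1) * coeffI (n + 1) + ((n : ℂ) + 1) ^ 2 * coeffL (n + 1) = coeffL n := by
  have h1 : (n : ℂ) + 1 ≠ 0 := by exact_mod_cast n.succ_ne_zero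
  unfold coeffL
  rw [← coeffI_succ n, harmonic_succ]
  push_cast
  field_simp
  ring

/-- The solution that is holomorphic in `e^ζ`. -/
def solI : ℂ → ℂ := expSeries coeffI
/-- The derivative of `solI`. -/
def solI' : ℂ → ℂ := expSeries fun n => (n : ℂ) * coeffI n
/-- The logarithmic solution. -/
def solL (ζ : ℂ) : ℂ := ζ * solI ζ + expSeries coeffL ζ
/-- The derivative of `solL`. -/
def solL' (ζ : ℂ) : ℂ := solI ζ + ζ * solI' ζ + expSeries (fun n => (n : ℂ) * coeffL n) ζ

theorem solvesBessel_solI : SolvesBessel univ solI solI' := fun ζ _ => by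
  refine ⟨entireCoeff_coeffI.hasDerivAt ζ, ?_⟩
  refine (entireCoeff_coeffI.nat_mul.hasDerivAt ζ).congr_deriv ?_
  refine exp_mul_expSeries entireCoeff_coeffI.nat_mul.nat_mul (by simp) (fun n => ?_) ζ
  rw [← coeffI_succ n]
  push_cast
  ring

theorem solvesBessel_solL : SolvesBessel univ solL solL' := fun ζ _ => by
  have hI := solvesBessel_solI ζ trivial
  refine ⟨?_, ?_⟩
  · refine (((hasDerivAt_id ζ).mul hI.1).add (entireCoeff_coeffL.hasDerivAt ζ)).congr_deriv ?_
    simp [solL']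
  · refine ((hI.1.add ((hasDerivAt_id ζ).mul hI.2)).add
      (entireCoeff_coeffL.nat_mul.hasDerivAt ζ)).congr_deriv ?_
    have hd : EntireCoeff fun n => (n : ℂ) * ((n : ℂ) * coeffL n) :=
      entireCoeff_coeffL.nat_mul.nat_mul
    have key : 2 * solI' ζ + expSeries (fun n => (n : ℂ) * ((n : ℂ) * coeffL n)) ζ =
        Complex.exp ζ * expSeries coeffL ζ := by
      unfold solI' expSeries
      rw [← tsum_mul_left, ← (Summable.mul_left 2 (entireCoeff_coeffI.nat_mul.summable ζ)).tsum_add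
        (hd.summable ζ), (Summable.add (Summable.mul_left 2
          (entireCoeff_coeffI.nat_mul.summable ζ)) (hd.summable ζ)).tsum_eq_zero_add,
        ← tsum_mul_left]
      simp only [Nat.cast_zero, zero_mul, mul_zero, zero_add]
      congr 1
      ext n
      rw [← coeffL_succ n, Nat.cast_succ, add_mul (n : ℂ) 1 ζ, one_mul, Complex.exp_add]
      ring
    simp only [id, solL]
    linear_combination key

theorem solL_add (ζ : ℂ) : solL (ζ + 2 * Real.pi * Complex.I) =
    solL ζ + 2 * Real.pi * Complex.I * solI ζ := by
  simp only [solL, solI, expSeries_periodic]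
  ring

theorem solL'_add (ζ : ℂ) : solL' (ζ + 2 * Real.pi * Complex.I) =
    solL' ζ + 2 * Real.pi * Complex.I * solI' ζ := by
  simp only [solL', solI, solI', expSeries_periodic]
  ring

theorem solI_add (ζ : ℂ) : solI (ζ + 2 * Real.pi * Complex.I) = solI ζ := expSeries_periodic _ ζ

theorem solI'_add (ζ : ℂ) : solI' (ζ + 2 * Real.pi * Complex.I) = solI' ζ := expSeries_periodic _ ζ

theorem tendsto_mul_exp_atBot : Tendsto (fun x : ℝ => x * Real.exp x) atBot (𝓝 0) := by
  have h := (Real.tendsto_pow_mul_exp_neg_atTop_nhds_zero 1).comp tendsto_neg_atBot_atTop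
  simpa [Function.comp_def] using h.neg

/-- A function with the behaviour of a value of a solution that tends to `1` at `-∞`. -/
def IsRegularAtBot (f f' : ℂ → ℂ) : Prop :=
  Tendsto (fun x : ℝ => f x) atBot (𝓝 1) ∧ (fun x : ℝ => f' x) =O[atBot] Real.exp

theorem IsRegularAtBot.tendsto_deriv {f f' : ℂ → ℂ} (h : IsRegularAtBot f f') :
    Tendsto (fun x : ℝ => f' x) atBot (𝓝 0) := h.2.trans_tendsto Real.tendsto_exp_atBot

/-- The logarithmic solution grows like `x`, so in a Wronskian with it the exponential rate of `f'`
is needed, not just its convergence to zero. -/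
theorem IsRegularAtBot.tendsto_mul_deriv {f f' : ℂ → ℂ} (h : IsRegularAtBot f f') :
    Tendsto (fun x : ℝ => (x : ℂ) * f' x) atBot (𝓝 0) := by
  have h1 : (fun x : ℝ => (x : ℂ)) =O[atBot] fun x : ℝ => x :=
    Asymptotics.IsBigO.of_bound 1 (Eventually.of_forall fun x => by simp)
  exact (h1.mul h.2).trans_tendsto tendsto_mul_exp_atBot

theorem isRegularAtBot_solI : IsRegularAtBot solI solI' := by
  constructor
  · have h := (isBigO_expSeries entireCoeff_coeffI).trans_tendsto Real.tendsto_exp_atBot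
    have := h.add_const (coeffI 0)
    simpa [coeffI, solI] using this
  · have := isBigO_expSeries entireCoeff_coeffI.nat_mul
    simpa [solI'] using this

theorem tendsto_expSeries_zero {c : ℕ → ℂ} (hc : EntireCoeff c) (h0 : c 0 = 0) :
    Tendsto (fun x : ℝ => expSeries c x) atBot (𝓝 0) := by
  have h := (isBigO_expSeries hc).trans_tendsto Real.tendsto_exp_atBot
  simpa [h0] using h

theorem IsRegularAtBot.tendsto_wronskian_solL {f f' : ℂ → ℂ} (h : IsRegularAtBot f f') :
    Tendsto (fun x : ℝ => wronskian f f' solL solL' x) atBot (𝓝 1) := by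
  have hI := isRegularAtBot_solI
  have h1 := (hI.1.add hI.tendsto_mul_deriv).add
    (tendsto_expSeries_zero entireCoeff_coeffL.nat_mul (by simp))
  have h2 := (h.tendsto_mul_deriv.mul hI.1).add
    (h.tendsto_deriv.mul (tendsto_expSeries_zero entireCoeff_coeffL (by simp [coeffL])))
  have := (h.1.mul h1).sub h2
  simp only [add_zero, mul_one, mul_zero, sub_zero] at this
  refine this.congr fun x => ?_
  simp only [wronskian, solL, solL']
  ring

theorem IsRegularAtBot.tendsto_wronskian {f f' g g' : ℂ → ℂ} (h : IsRegularAtBot f f')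
    (hg : IsRegularAtBot g g') : Tendsto (fun x : ℝ => wronskian f f' g g' x) atBot (𝓝 0) := by
  simpa [wronskian] using (h.1.mul hg.tendsto_deriv).sub (h.tendsto_deriv.mul hg.1)

theorem wronskian_solI_solL (ζ : ℂ) : wronskian solI solI' solL solL' ζ = 1 :=
  wronskian_eq_of_tendsto isOpen_univ isPreconnected_univ (fun _ => trivial) solvesBessel_solI
    solvesBessel_solL isRegularAtBot_solI.tendsto_wronskian_solL trivial

/-- A solution that is regular at `-∞` is `solI`. -/
theorem eq_solI {f f' : ℂ → ℂ} (hf : SolvesBessel univ f f') (h : IsRegularAtBot f f') :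
    f = solI ∧ f' = solI' := by
  have h1 : ∀ ζ, wronskian f f' solL solL' ζ = 1 := fun ζ =>
    wronskian_eq_of_tendsto isOpen_univ isPreconnected_univ (fun _ => trivial) hf
      solvesBessel_solL h.tendsto_wronskian_solL trivial
  have h2 : ∀ ζ, wronskian f f' solI solI' ζ = 0 := fun ζ =>
    wronskian_eq_of_tendsto isOpen_univ isPreconnected_univ (fun _ => trivial) hf
      solvesBessel_solI (h.tendsto_wronskian isRegularAtBot_solI) trivial
  constructor <;> ext ζ
  · have := wronskian_plucker f f' solI solI' solL solL' ζ
    rw [wronskian_solI_solL, h2, wronskian_swap solL, h1] at this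
    linear_combination this
  · have := wronskian_plucker' f f' solI solI' solL solL' ζ
    rw [wronskian_solI_solL, h2, wronskian_swap solL, h1] at this
    linear_combination this

/-! ### Integral representations of the Bessel functions -/

/-- The integrand of the Bessel integrals. -/
def besselTerm (n : ℤ) (t y : ℂ) : ℂ := y ^ n * Complex.exp (-(t / 2) * (y + 1 / y))

theorem hasDerivAt_besselTerm (n : ℤ) (t : ℂ) {y : ℂ} (hy : y ≠ 0) :
    HasDerivAt (fun t => besselTerm n t y)
      (-(besselTerm (n + 1) t y + besselTerm (n - 1) t y) / 2) t := by
  have h : HasDerivAt (fun t : ℂ => -(t / 2) * (y + 1 / y)) (-(1 / 2) * (y + 1 / y)) t :=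
    (((hasDerivAt_id t).div_const 2).neg).mul_const _
  refine (h.cexp.const_mul (y ^ n)).congr_deriv ?_
  unfold besselTerm
  rw [zpow_add_one₀ hy, zpow_sub_one₀ hy]
  field_simp

theorem hasDerivAt_besselTerm_right (n : ℤ) (t : ℂ) {y : ℂ} (hy : y ≠ 0) :
    HasDerivAt (fun y => besselTerm n t y)
      (((n : ℂ) * besselTerm n t y - t / 2 * (besselTerm (n + 1) t y - besselTerm (n - 1) t y)) / y)
      y := by
  have h : HasDerivAt (fun y : ℂ => -(t / 2) * (y + 1 / y)) (-(t / 2) * (1 - 1 / y ^ 2)) y := by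
    have h1 : HasDerivAt (fun y : ℂ => y + 1 / y) (1 - 1 / y ^ 2) y := by
      simp only [one_div]
      exact ((hasDerivAt_id y).add (hasDerivAt_inv hy)).congr_deriv (by ring)
    exact h1.const_mul _
  refine ((hasDerivAt_zpow n y (Or.inl hy)).mul h.cexp).congr_deriv ?_
  unfold besselTerm
  rw [zpow_add_one₀ hy, zpow_sub_one₀ hy]
  field_simp
  ring

theorem continuousOn_besselTerm (n : ℤ) (t : ℂ) : ContinuousOn (besselTerm n t) {0}ᶜ := fun _ hy =>
  (hasDerivAt_besselTerm_right n t hy).continuousAt.continuousWithinAt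

/-- Differentiation under the integral sign for the Bessel integrals. -/
theorem hasDerivAt_integral_besselTerm {X : Type*} [MeasurableSpace X] {μ : Measure X}
    {w y : X → ℂ} {t₀ : ℂ} {s : Set ℂ} (hs : s ∈ 𝓝 t₀) (hy : ∀ᵐ x ∂μ, y x ≠ 0)
    (hm : ∀ n t, AEStronglyMeasurable (fun x => w x * besselTerm n t (y x)) μ)
    (hb : ∀ n, ∃ g : X → ℝ, Integrable g μ ∧
      ∀ᵐ x ∂μ, ∀ t ∈ s, ‖w x * besselTerm n t (y x)‖ ≤ g x) (n : ℤ) :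
    HasDerivAt (fun t => ∫ x, w x * besselTerm n t (y x) ∂μ)
      (-((∫ x, w x * besselTerm (n + 1) t₀ (y x) ∂μ) +
        ∫ x, w x * besselTerm (n - 1) t₀ (y x) ∂μ) / 2) t₀ := by
  have hint : ∀ n, Integrable (fun x => w x * besselTerm n t₀ (y x)) μ := fun n => by
    obtain ⟨g, hg, hgb⟩ := hb n
    exact hg.mono' (hm n t₀) (hgb.mono fun x hx => hx t₀ (mem_of_mem_nhds hs))
  obtain ⟨g, hg, hgb⟩ := hb (n + 1)
  obtain ⟨g', hg', hgb'⟩ := hb (n - 1)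
  have hF : ∀ t x, w x * (-(besselTerm (n + 1) t (y x) + besselTerm (n - 1) t (y x)) / 2) =
      -(1 / 2) * (w x * besselTerm (n + 1) t (y x) + w x * besselTerm (n - 1) t (y x)) :=
    fun t x => by ring
  have := (hasDerivAt_integral_of_dominated_loc_of_deriv_le (μ := μ)
    (F := fun t x => w x * besselTerm n t (y x))
    (F' := fun t x => w x * (-(besselTerm (n + 1) t (y x) + besselTerm (n - 1) t (y x)) / 2))
    (bound := fun x => g x + g' x) hs (Eventually.of_forall fun t => hm n t) (hint n)
    (by simp only [hF]; exact ((hm _ _).add (hm _ _)).const_mul _)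
    (by
      filter_upwards [hgb, hgb'] with x h1 h2 t ht
      rw [hF, norm_mul]
      have h3 := (norm_add_le _ _).trans (add_le_add (h1 t ht) (h2 t ht))
      have h4 : ‖(-(1 / 2) : ℂ)‖ ≤ 1 := by norm_num
      nlinarith [norm_nonneg (w x * besselTerm (n + 1) t (y x) + w x * besselTerm (n - 1) t (y x))])
    (hg.add hg')
    (by
      filter_upwards [hy] with x hx t _
      exact (hasDerivAt_besselTerm n t hx).const_mul (w x))).2
  refine this.congr_deriv ?_
  simp only [hF]
  rw [integral_const_mul, integral_add (hint _) (hint _)]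
  ring

theorem tCoord_ne_zero (ζ : ℂ) : tCoord ζ ≠ 0 :=
  mul_ne_zero two_ne_zero (Complex.exp_ne_zero _)

theorem tCoord_sq (ζ : ℂ) : tCoord ζ ^ 2 = 4 * Complex.exp ζ := by
  rw [tCoord, mul_pow, ← Complex.exp_nat_mul]
  norm_num
  congr 1
  ring

theorem hasDerivAt_tCoord (ζ : ℂ) : HasDerivAt tCoord (tCoord ζ / 2) ζ := by
  refine ((((hasDerivAt_id ζ).div_const 2).cexp).const_mul 2).congr_deriv ?_
  simp only [id, tCoord]
  ring

/-- A solution of the Bessel equation in `t` gives a solution in `ζ`. -/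
theorem solvesBessel_of_moments {U : Set ℂ} {F₀ F₁ F₂ : ℂ → ℂ}
    (h0 : ∀ ζ ∈ U, HasDerivAt F₀ (-F₁ (tCoord ζ)) (tCoord ζ))
    (h1 : ∀ ζ ∈ U, HasDerivAt F₁ (-(F₂ (tCoord ζ) + F₀ (tCoord ζ)) / 2) (tCoord ζ))
    (h2 : ∀ ζ ∈ U, F₁ (tCoord ζ) = tCoord ζ / 2 * (F₂ (tCoord ζ) - F₀ (tCoord ζ))) :
    SolvesBessel U (fun ζ => F₀ (tCoord ζ)) (fun ζ => tCoord ζ / 2 * -F₁ (tCoord ζ)) := by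
  intro ζ hζ
  refine ⟨((h0 ζ hζ).comp ζ (hasDerivAt_tCoord ζ)).congr_deriv (by ring), ?_⟩
  refine (((hasDerivAt_tCoord ζ).div_const 2).mul
    (((h1 ζ hζ).comp ζ (hasDerivAt_tCoord ζ)).neg)).congr_deriv ?_
  have h4 := tCoord_sq ζ
  have h5 := h2 ζ hζ
  simp only [Function.comp_apply, Pi.neg_apply]
  linear_combination (-(tCoord ζ) / 4) * h5 + F₀ (tCoord ζ) / 4 * h4

/-! ### The function `I₀` -/

/-- The integrals of `y ^ n` against the generating function of the Bessel functions. -/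
def circleMoment (n : ℤ) (t : ℂ) : ℂ :=
  ∫ θ in Ioc (0 : ℝ) (2 * Real.pi), 1 * besselTerm n t (circleMap 0 1 θ)

theorem circleMap_ne_zero' (θ : ℝ) : circleMap 0 1 θ ≠ 0 := circleMap_ne_center one_ne_zero

theorem continuous_besselTerm_circleMap (n : ℤ) (t : ℂ) :
    Continuous fun θ : ℝ => besselTerm n t (circleMap 0 1 θ) :=
  (continuousOn_besselTerm n t).comp_continuous (continuous_circleMap 0 1)
    fun θ => circleMap_ne_zero' θ

theorem norm_besselTerm_circleMap (n : ℤ) (t : ℂ) (θ : ℝ) :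
    ‖besselTerm n t (circleMap 0 1 θ)‖ ≤ Real.exp |t.re| := by
  have h : circleMap 0 1 θ + 1 / circleMap 0 1 θ = ((2 * Real.cos θ : ℝ) : ℂ) := by
    simp only [circleMap_zero, Complex.ofReal_one, one_mul, one_div, ← Complex.exp_neg]
    push_cast
    rw [Complex.two_cos]
    simp [neg_mul]
  have hn : ‖circleMap 0 1 θ‖ = 1 := by simp
  rw [besselTerm, norm_mul, norm_zpow, hn, one_zpow, one_mul, Complex.norm_exp, h]
  refine Real.exp_le_exp.2 ?_
  have h1 : (-(t / 2) * ((2 * Real.cos θ : ℝ) : ℂ)).re = -(t.re * Real.cos θ) := by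
    rw [Complex.mul_re, Complex.ofReal_re, Complex.ofReal_im]
    simp
    ring
  rw [h1]
  refine (neg_le_abs _).trans ?_
  rw [abs_mul]
  exact mul_le_of_le_one_right (abs_nonneg _) (Real.abs_cos_le_one θ)

theorem norm_circleMoment_le (n : ℤ) (t : ℂ) :
    ‖circleMoment n t‖ ≤ 2 * Real.pi * Real.exp |t.re| := by
  have := norm_setIntegral_le_of_norm_le_const (μ := volume) (s := Ioc (0 : ℝ) (2 * Real.pi))
    (f := fun θ => 1 * besselTerm n t (circleMap 0 1 θ)) (C := Real.exp |t.re|) measure_Ioc_lt_top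
    (fun θ _ => by rw [one_mul]; exact norm_besselTerm_circleMap n t θ)
  refine this.trans (le_of_eq ?_)
  rw [Measure.real, Real.volume_Ioc, ENNReal.toReal_ofReal (by linarith [Real.pi_pos])]
  ring

theorem hasDerivAt_circleMoment (n : ℤ) (t : ℂ) : HasDerivAt (circleMoment n)
    (-(circleMoment (n + 1) t + circleMoment (n - 1) t) / 2) t := by
  refine hasDerivAt_integral_besselTerm (Metric.ball_mem_nhds t one_pos)
    (Eventually.of_forall circleMap_ne_zero')
    (fun n t => (continuous_const.mul
      (continuous_besselTerm_circleMap n t)).aestronglyMeasurable) (fun n => ?_) n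
  refine ⟨fun _ => Real.exp (|t.re| + 1), integrable_const _, Eventually.of_forall fun θ s hs => ?_⟩
  rw [one_mul]
  refine (norm_besselTerm_circleMap n s θ).trans (Real.exp_le_exp.2 ?_)
  have h1 : |s.re - t.re| ≤ 1 := by
    rw [← Complex.sub_re]
    exact (Complex.abs_re_le_norm _).trans (mem_ball_iff_norm.1 hs).le
  have h2 := abs_sub_abs_le_abs_sub s.re t.re
  linarith

/-- A derivative integrates to zero over a full period. For `n = 0` this gives the symmetry between
the moments `1` and `-1`, for `n = 1` the relation that `solvesBessel_of_moments` requires. -/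
theorem circleMoment_parts (n : ℤ) (t : ℂ) :
    (n : ℂ) * circleMoment n t = t / 2 * (circleMoment (n + 1) t - circleMoment (n - 1) t) := by
  have hd : ∀ θ : ℝ, HasDerivAt (fun θ : ℝ => besselTerm n t (circleMap 0 1 θ))
      (((n : ℂ) * besselTerm n t (circleMap 0 1 θ) - t / 2 *
        (besselTerm (n + 1) t (circleMap 0 1 θ) - besselTerm (n - 1) t (circleMap 0 1 θ)))
          * Complex.I) θ := fun θ => by
    refine ((hasDerivAt_besselTerm_right n t (circleMap_ne_zero' θ)).comp θ
      (hasDerivAt_circleMap 0 1 θ)).congr_deriv ?_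
    have := circleMap_ne_zero' θ
    field_simp
  have hc := fun n => (continuous_besselTerm_circleMap n t)
  have hi : ∀ n, IntegrableOn (fun θ : ℝ => besselTerm n t (circleMap 0 1 θ))
      (Ioc 0 (2 * Real.pi)) := fun n =>
    ((hc n).continuousOn.integrableOn_compact isCompact_Icc).mono_set Ioc_subset_Icc_self
  have hs : IntegrableOn (fun θ : ℝ => besselTerm (n + 1) t (circleMap 0 1 θ) -
      besselTerm (n - 1) t (circleMap 0 1 θ)) (Ioc 0 (2 * Real.pi)) := (hi _).sub (hi _)
  have h := intervalIntegral.integral_eq_sub_of_hasDerivAt (a := 0) (b := 2 * Real.pi)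
    (fun θ _ => hd θ) (Continuous.intervalIntegrable (by
      have := hc n; have := hc (n + 1); have := hc (n - 1); fun_prop) _ _)
  rw [show circleMap 0 1 (2 * Real.pi) = circleMap 0 1 0 by simp [circleMap], sub_self,
    intervalIntegral.integral_mul_const, intervalIntegral.integral_of_le (by positivity),
    integral_sub ((hi _).const_mul _) (hs.const_mul _), integral_const_mul,
    integral_const_mul, integral_sub (hi _) (hi _)] at h
  have h0 := (mul_eq_zero.1 h).resolve_right Complex.I_ne_zero
  simp only [circleMoment, one_mul]
  exact sub_eq_zero.1 h0

theorem besselI0_eq (t : ℂ) : besselI0 t = (2 * Real.pi : ℂ)⁻¹ * circleMoment 0 t := by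
  unfold besselI0 circleMoment circleIntegral
  rw [intervalIntegral.integral_of_le (by positivity)]
  have h : ∀ θ : ℝ, deriv (circleMap 0 1) θ • (Complex.exp (-(t / 2) *
      (circleMap 0 1 θ + 1 / circleMap 0 1 θ)) / circleMap 0 1 θ) =
      Complex.I * (1 * besselTerm 0 t (circleMap 0 1 θ)) := fun θ => by
    have := circleMap_ne_zero' θ
    rw [deriv_circleMap, smul_eq_mul, besselTerm, zpow_zero]
    field_simp
  simp only [h]
  rw [integral_const_mul, ← mul_assoc]
  congr 1
  have : (Real.pi : ℂ) ≠ 0 := by exact_mod_cast Real.pi_ne_zero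
  have := Complex.I_ne_zero
  field_simp

theorem circleMoment_neg_one (t : ℂ) : circleMoment (-1) t = circleMoment 1 t ∨ t = 0 := by
  have := circleMoment_parts 0 t
  simp only [Int.cast_zero, zero_mul, zero_add, zero_sub] at this
  rcases mul_eq_zero.1 this.symm with h | h
  · right; simpa using h
  · left; exact (sub_eq_zero.1 h).symm

theorem solvesBessel_circleMoment : SolvesBessel univ (fun ζ => circleMoment 0 (tCoord ζ))
    (fun ζ => tCoord ζ / 2 * -circleMoment 1 (tCoord ζ)) := by
  refine solvesBessel_of_moments (F₂ := circleMoment 2) (fun ζ _ => ?_) (fun ζ _ => ?_)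
    (fun ζ _ => ?_)
  · refine (hasDerivAt_circleMoment 0 _).congr_deriv ?_
    rw [zero_add, zero_sub, (circleMoment_neg_one _).resolve_right (tCoord_ne_zero ζ)]
    ring
  · exact hasDerivAt_circleMoment 1 _
  · simpa using circleMoment_parts 1 (tCoord ζ)

theorem deriv_besselI0 {t : ℂ} (ht : t ≠ 0) :
    deriv besselI0 t = (2 * Real.pi : ℂ)⁻¹ * -circleMoment 1 t := by
  rw [show besselI0 = fun t => (2 * Real.pi : ℂ)⁻¹ * circleMoment 0 t from funext besselI0_eq]
  refine (((hasDerivAt_circleMoment 0 t).const_mul _).congr_deriv ?_).deriv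
  rw [zero_add, zero_sub, (circleMoment_neg_one _).resolve_right ht]
  ring

theorem norm_besselI0_le (t : ℂ) : ‖besselI0 t‖ ≤ Real.exp |t.re| := by
  rw [besselI0_eq, norm_mul, norm_inv]
  have h : ‖(2 * Real.pi : ℂ)‖ = 2 * Real.pi := by simp [abs_of_pos Real.pi_pos]
  rw [h, inv_mul_le_iff₀ (by positivity)]
  exact norm_circleMoment_le 0 t

theorem norm_deriv_besselI0_le {t : ℂ} (ht : t ≠ 0) : ‖deriv besselI0 t‖ ≤ Real.exp |t.re| := by
  rw [deriv_besselI0 ht, norm_mul, norm_inv, norm_neg]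
  have h : ‖(2 * Real.pi : ℂ)‖ = 2 * Real.pi := by simp [abs_of_pos Real.pi_pos]
  rw [h, inv_mul_le_iff₀ (by positivity)]
  exact norm_circleMoment_le 1 t

/-- The function `I₀(2 √z)`. -/
def funI (ζ : ℂ) : ℂ := besselI0 (tCoord ζ)
/-- The logarithmic derivative `z ∂_z` of `funI`. -/
def funI' (ζ : ℂ) : ℂ := tCoord ζ / 2 * deriv besselI0 (tCoord ζ)

theorem solvesBessel_funI : SolvesBessel univ funI funI' := by
  have h := solvesBessel_circleMoment.linear solvesBessel_circleMoment (2 * Real.pi : ℂ)⁻¹ 0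
  convert h using 1
  · ext ζ; simp [funI, besselI0_eq]
  · ext ζ; simp only [funI', deriv_besselI0 (tCoord_ne_zero ζ)]; ring

theorem tCoord_ofReal (x : ℝ) : tCoord x = ((2 * Real.exp (x / 2) : ℝ) : ℂ) := by
  simp [tCoord]

theorem tendsto_tCoord_atBot : Tendsto (fun x : ℝ => tCoord x) atBot (𝓝 0) := by
  have h : Tendsto (fun x : ℝ => 2 * Real.exp (x / 2)) atBot (𝓝 (2 * 0)) :=
    (Real.tendsto_exp_atBot.comp (tendsto_id.atBot_div_const two_pos)).const_mul 2
  have := (Complex.continuous_ofReal.tendsto _).comp h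
  simp only [mul_zero, Complex.ofReal_zero] at this
  exact this.congr fun x => (tCoord_ofReal x).symm

theorem isRegularAtBot_funI : IsRegularAtBot funI funI' := by
  have hc : ∀ n, Continuous (circleMoment n) := fun n =>
    continuous_iff_continuousAt.2 fun t => (hasDerivAt_circleMoment n t).continuousAt
  have h2pi : (2 * Real.pi : ℂ) ≠ 0 := by
    exact_mod_cast mul_ne_zero two_ne_zero Real.pi_ne_zero
  have h0 : circleMoment 0 0 = 2 * Real.pi := by
    simp [circleMoment, besselTerm, Measure.real, Real.pi_pos.le]
  constructor
  · have := (((hc 0).tendsto 0).comp tendsto_tCoord_atBot).const_mul (2 * Real.pi : ℂ)⁻¹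
    rw [h0, inv_mul_cancel₀ h2pi] at this
    exact this.congr fun x => (besselI0_eq _).symm
  -- By `circleMoment_parts` with `n = 1`, the first moment is `t / 2` times a bounded function, so
  -- `funI'` carries the factor `t² = 4 e^x`.
  · have hb : (fun x : ℝ => circleMoment 2 (tCoord x) - circleMoment 0 (tCoord x))
        =O[atBot] fun _ => (1 : ℝ) :=
      (((((hc 2).sub (hc 0)).tendsto 0)).comp tendsto_tCoord_atBot).isBigO_one ℝ
    have he : (fun x : ℝ => -(2 * Real.pi : ℂ)⁻¹ * Complex.exp x) =O[atBot] Real.exp :=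
      Asymptotics.IsBigO.const_mul_left (Asymptotics.IsBigO.of_bound 1
        (Eventually.of_forall fun x => by rw [← Complex.ofReal_exp]; simp)) _
    have := he.mul hb
    simp only [mul_one] at this
    refine this.congr_left fun x => ?_
    have h1 := circleMoment_parts 1 (tCoord x)
    have h2 := tCoord_sq x
    norm_num at h1
    rw [funI', deriv_besselI0 (tCoord_ne_zero x), h1]
    linear_combination (2 * Real.pi : ℂ)⁻¹ / 4 * (circleMoment 2 (tCoord x) -
      circleMoment 0 (tCoord x)) * h2

theorem funI_eq : funI = solI := (eq_solI solvesBessel_funI isRegularAtBot_funI).1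

theorem funI'_eq : funI' = solI' := (eq_solI solvesBessel_funI isRegularAtBot_funI).2

/-! ### The function `K₀` -/

/-- The absolute value of the integrand of the integrals for `K₀`. -/
def rayTerm (n : ℤ) (x y : ℝ) : ℝ := y ^ (n - 1) * Real.exp (-(x / 2) * (y + 1 / y))

/-- The integrals of `y ^ n dy / y` against the generating function of the Bessel functions. -/
def rayMoment (n : ℤ) (t : ℂ) : ℂ := ∫ y in Ioi (0 : ℝ), (1 / (y : ℂ)) * besselTerm n t y

theorem norm_rayTerm (n : ℤ) (t : ℂ) {y : ℝ} (hy : 0 < y) :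
    ‖(1 / (y : ℂ)) * besselTerm n t y‖ = rayTerm n t.re y := by
  have hre : (-(t / 2) * ((y : ℂ) + 1 / y)).re = -(t.re / 2) * (y + 1 / y) := by
    rw [show (y : ℂ) + 1 / y = ((y + 1 / y : ℝ) : ℂ) by push_cast; rfl, Complex.mul_re,
      Complex.ofReal_re, Complex.ofReal_im]
    simp
  rw [besselTerm, norm_mul, norm_mul, Complex.norm_exp, hre, norm_zpow, norm_div, norm_one,
    Complex.norm_real, Real.norm_of_nonneg hy.le, rayTerm, zpow_sub_one₀ hy.ne']
  ring

theorem ofReal_rayTerm (n : ℤ) (x : ℝ) {y : ℝ} (hy : 0 < y) :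
    (1 / (y : ℂ)) * besselTerm n x y = (rayTerm n x y : ℂ) := by
  have : (y : ℂ) ≠ 0 := by exact_mod_cast hy.ne'
  rw [besselTerm, rayTerm, zpow_sub_one₀ hy.ne']
  push_cast
  ring

theorem rayTerm_nonneg (n : ℤ) (x : ℝ) {y : ℝ} (hy : 0 < y) : 0 ≤ rayTerm n x y := by
  unfold rayTerm; positivity

theorem rayTerm_anti (n : ℤ) {x x' y : ℝ} (hy : 0 < y) (hx : x' ≤ x) :
    rayTerm n x y ≤ rayTerm n x' y := by
  unfold rayTerm
  have : 0 < y + 1 / y := by positivity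
  gcongr

/-- Both `y` and `1 / y` are at most `w = y + 1 / y`, so every power of `y`, positive or negative,
is at most a power of `w`, which the exponential series dominates. -/
theorem exists_zpow_mul_exp_le (m : ℤ) {c : ℝ} (hc : 0 < c) :
    ∃ C : ℝ, ∀ y : ℝ, 0 < y → y ^ m * Real.exp (-c * (y + 1 / y)) ≤ C := by
  obtain ⟨N, hN⟩ := m.eq_nat_or_neg
  refine ⟨N ! / c ^ N, fun y hy => ?_⟩
  set w := y + 1 / y with hw
  have hw0 : 0 < w := by positivity
  have h1 : y ^ m ≤ w ^ N := by
    rcases hN with rfl | rfl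
    · rw [zpow_natCast]
      have : y ≤ w := by rw [hw]; linarith [one_div_pos.2 hy]
      gcongr
    · rw [zpow_neg, zpow_natCast, ← inv_pow]
      have : y⁻¹ ≤ w := by rw [hw, one_div]; linarith
      gcongr
  have h2 := Real.pow_div_factorial_le_exp (c * w) (by positivity) N
  rw [div_le_iff₀ (by positivity), mul_pow] at h2
  rw [neg_mul, Real.exp_neg, ← div_eq_mul_inv, div_le_div_iff₀ (Real.exp_pos _) (by positivity)]
  calc y ^ m * c ^ N ≤ w ^ N * c ^ N := by gcongr
    _ ≤ _ := by linarith

theorem exists_rayTerm_le (n : ℤ) {x : ℝ} (hx : 0 < x) :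
    ∃ C : ℝ, ∀ y : ℝ, 0 < y → rayTerm n x y ≤ C * Real.exp (-(x / 4) * y) := by
  obtain ⟨C, hC⟩ := exists_zpow_mul_exp_le (n - 1) (by positivity : 0 < x / 4)
  refine ⟨C, fun y hy => ?_⟩
  -- Half of the exponent absorbs the power of `y`, the other half keeps the decay.
  have hsplit : rayTerm n x y = y ^ (n - 1) * Real.exp (-(x / 4) * (y + 1 / y)) *
      Real.exp (-(x / 4) * (y + 1 / y)) := by
    rw [rayTerm, mul_assoc, ← Real.exp_add]
    ring_nf
  rw [hsplit]
  have h1 := hC y hy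
  have h0 : 0 ≤ y ^ (n - 1) * Real.exp (-(x / 4) * (y + 1 / y)) := by positivity
  refine mul_le_mul h1 (Real.exp_le_exp.2 ?_) (Real.exp_pos _).le (h0.trans h1)
  have : 0 < 1 / y := by positivity
  nlinarith

theorem integrableOn_exp_neg_mul {c : ℝ} (hc : 0 < c) :
    IntegrableOn (fun y : ℝ => Real.exp (-c * y)) (Ioi 0) :=
  integrableOn_exp_mul_Ioi (neg_neg_of_pos hc) 0

theorem continuousOn_rayTerm (n : ℤ) (x : ℝ) : ContinuousOn (rayTerm n x) (Ioi 0) := by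
  unfold rayTerm
  refine ContinuousOn.mul (fun y hy => (continuousAt_zpow₀ y _ (Or.inl (ne_of_gt hy))).continuousWithinAt) ?_
  refine Real.continuous_exp.comp_continuousOn (continuousOn_const.mul (continuousOn_id.add ?_))
  exact continuousOn_const.div continuousOn_id fun y hy => ne_of_gt hy

theorem integrableOn_rayTerm (n : ℤ) {x : ℝ} (hx : 0 < x) : IntegrableOn (rayTerm n x) (Ioi 0) := by
  obtain ⟨C, hC⟩ := exists_rayTerm_le n hx
  refine Integrable.mono' ((integrableOn_exp_neg_mul (by positivity : 0 < x / 4)).const_mul C)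
    ((continuousOn_rayTerm n x).aestronglyMeasurable measurableSet_Ioi) ?_
  filter_upwards [ae_restrict_mem measurableSet_Ioi] with y hy
  rw [Real.norm_of_nonneg (rayTerm_nonneg n x hy)]
  exact hC y hy

theorem aestronglyMeasurable_ray (n : ℤ) (t : ℂ) : AEStronglyMeasurable
    (fun y : ℝ => (1 / (y : ℂ)) * besselTerm n t y) (volume.restrict (Ioi 0)) := by
  have h0 : ∀ y ∈ Ioi (0 : ℝ), (y : ℂ) ≠ 0 := fun y hy => by exact_mod_cast (ne_of_gt hy)
  refine ContinuousOn.aestronglyMeasurable ?_ measurableSet_Ioi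
  refine (continuousOn_const.div Complex.continuous_ofReal.continuousOn h0).mul ?_
  exact (continuousOn_besselTerm n t).comp Complex.continuous_ofReal.continuousOn h0

theorem hasDerivAt_rayMoment (n : ℤ) {t : ℂ} (ht : 0 < t.re) : HasDerivAt (rayMoment n)
    (-(rayMoment (n + 1) t + rayMoment (n - 1) t) / 2) t := by
  have hs : {s : ℂ | t.re / 2 < s.re} ∈ 𝓝 t :=
    (isOpen_lt continuous_const Complex.continuous_re).mem_nhds (show t.re / 2 < t.re by linarith)
  refine hasDerivAt_integral_besselTerm (w := fun y : ℝ => 1 / (y : ℂ))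
    (y := fun y : ℝ => (y : ℂ)) hs ?_ aestronglyMeasurable_ray (fun n => ?_) n
  · filter_upwards [ae_restrict_mem measurableSet_Ioi] with y hy
    exact_mod_cast (ne_of_gt hy)
  · refine ⟨rayTerm n (t.re / 2), integrableOn_rayTerm n (by positivity), ?_⟩
    filter_upwards [ae_restrict_mem measurableSet_Ioi] with y hy s hs
    rw [norm_rayTerm n s hy]
    exact rayTerm_anti n hy (le_of_lt hs)

theorem integrableOn_ray (n : ℤ) {t : ℂ} (ht : 0 < t.re) :
    IntegrableOn (fun y : ℝ => (1 / (y : ℂ)) * besselTerm n t y) (Ioi 0) := by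
  refine (integrableOn_rayTerm n ht).mono' (aestronglyMeasurable_ray n t) ?_
  filter_upwards [ae_restrict_mem measurableSet_Ioi] with y hy
  exact (norm_rayTerm n t hy).le

theorem norm_besselTerm_ofReal (n : ℤ) (t : ℂ) {y : ℝ} (hy : 0 < y) :
    ‖besselTerm n t y‖ = rayTerm (n + 1) t.re y := by
  have h := norm_rayTerm n t hy
  rw [norm_mul, norm_div, norm_one, Complex.norm_real, Real.norm_of_nonneg hy.le, one_div,
    inv_mul_eq_iff_eq_mul₀ hy.ne'] at h
  rw [h, rayTerm, rayTerm, zpow_sub_one₀ hy.ne', add_sub_cancel_right]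
  field_simp

theorem rayMoment_parts (n : ℤ) {t : ℂ} (ht : 0 < t.re) :
    (n : ℂ) * rayMoment n t = t / 2 * (rayMoment (n + 1) t - rayMoment (n - 1) t) := by
  -- At `y = 0` the division by zero in `besselTerm` yields a value that need not be the limit from
  -- the right (it is `1` for `n = 0`); `g` has the limit `0` there.
  set g : ℝ → ℂ := fun y => if y = 0 then 0 else besselTerm n t y with hg
  have hd : ∀ y ∈ Ioi (0 : ℝ), HasDerivAt g
      ((n : ℂ) * ((1 / (y : ℂ)) * besselTerm n t y) - t / 2 *
        ((1 / (y : ℂ)) * besselTerm (n + 1) t y - (1 / (y : ℂ)) * besselTerm (n - 1) t y)) y := by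
    intro y hy
    have hy0 : (y : ℂ) ≠ 0 := by exact_mod_cast (ne_of_gt hy)
    have h := (hasDerivAt_besselTerm_right n t hy0).comp_ofReal
    refine (h.congr_of_eventuallyEq ?_).congr_deriv (by ring)
    filter_upwards [isOpen_Ioi.mem_nhds hy] with x hx
    have hx0 : x ≠ 0 := ne_of_gt (mem_Ioi.1 hx)
    simp [hg, hx0]
  have hcont : ContinuousWithinAt g (Ici 0) 0 := by
    obtain ⟨C, hC⟩ := exists_zpow_mul_exp_le (n - 1) (by positivity : 0 < t.re / 2)
    have hb : ∀ y ∈ Ici (0 : ℝ), ‖g y‖ ≤ C * y := by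
      intro y hy
      rcases eq_or_lt_of_le (show (0 : ℝ) ≤ y from hy) with h | h
      · simp [hg, ← h]
      · rw [show g y = besselTerm n t y by simp [hg, h.ne'], norm_besselTerm_ofReal n t h, rayTerm]
        rw [show n + 1 - 1 = (n - 1) + 1 by ring, zpow_add_one₀ h.ne']
        have := mul_le_mul_of_nonneg_right (hC y h) h.le
        linarith
    have h0 : g 0 = 0 := by simp [hg]
    rw [ContinuousWithinAt, h0]
    refine squeeze_zero_norm' (eventually_mem_nhdsWithin.mono hb) ?_
    have : Tendsto (fun y : ℝ => C * y) (𝓝 0) (𝓝 (C * 0)) := (continuous_const.mul continuous_id).tendsto 0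
    rw [mul_zero] at this
    exact this.mono_left nhdsWithin_le_nhds
  have hlim : Tendsto g atTop (𝓝 0) := by
    obtain ⟨C, hC⟩ := exists_rayTerm_le (n + 1) ht
    have hexp : Tendsto (fun y : ℝ => C * Real.exp (-(t.re / 4) * y)) atTop (𝓝 (C * 0)) := by
      refine (Real.tendsto_exp_atBot.comp ?_).const_mul C
      exact tendsto_id.const_mul_atTop_of_neg (by linarith)
    rw [mul_zero] at hexp
    refine squeeze_zero_norm' ?_ hexp
    filter_upwards [eventually_gt_atTop 0] with y hy
    rw [show g y = besselTerm n t y by simp [hg, hy.ne'], norm_besselTerm_ofReal n t hy]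
    exact hC y hy
  have hi := fun n => integrableOn_ray n ht
  have hs : IntegrableOn (fun y : ℝ => (1 / (y : ℂ)) * besselTerm (n + 1) t y -
      (1 / (y : ℂ)) * besselTerm (n - 1) t y) (Ioi 0) := (hi _).sub (hi _)
  have h := integral_Ioi_of_hasDerivAt_of_tendsto hcont hd
    (((hi _).const_mul _).sub (hs.const_mul _)) hlim
  rw [integral_sub ((hi _).const_mul _) (hs.const_mul _), integral_const_mul, integral_const_mul,
    integral_sub (hi _) (hi _)] at h
  simp only [hg, if_true, sub_zero] at h
  exact sub_eq_zero.1 h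

theorem rayMoment_neg_one {t : ℂ} (ht : 0 < t.re) : rayMoment (-1) t = rayMoment 1 t := by
  have h := rayMoment_parts 0 ht
  simp only [Int.cast_zero, zero_mul, zero_add, zero_sub] at h
  have h0 : t / 2 ≠ 0 := div_ne_zero (fun h => by simp [h] at ht) two_ne_zero
  exact (sub_eq_zero.1 ((mul_eq_zero.1 h.symm).resolve_left h0)).symm

/-- The integral that bounds `K₀` and its derivative. -/
def rayBound (x : ℝ) : ℝ := ∫ y in Ioi (0 : ℝ), rayTerm 1 x y

theorem rayMoment_ofReal (n : ℤ) (x : ℝ) :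
    rayMoment n x = ((∫ y in Ioi (0 : ℝ), rayTerm n x y : ℝ) : ℂ) := by
  rw [rayMoment, ← integral_complex_ofReal]
  exact setIntegral_congr_fun measurableSet_Ioi fun y hy => ofReal_rayTerm n x hy

theorem norm_rayMoment_le (n : ℤ) (t : ℂ) :
    ‖rayMoment n t‖ ≤ ∫ y in Ioi (0 : ℝ), rayTerm n t.re y := by
  refine (norm_integral_le_integral_norm _).trans (le_of_eq ?_)
  exact setIntegral_congr_fun measurableSet_Ioi fun y hy => norm_rayTerm n t hy

theorem norm_rayMoment_one_le (t : ℂ) : ‖rayMoment 1 t‖ ≤ rayBound t.re := norm_rayMoment_le 1 t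

/-- Since `1 / y ≤ (1 + 1 / y²) / 2`, the term of index `0` is at most the mean of those of index
`1` and `-1`, whose integrals agree by `rayMoment_neg_one`. One bound then serves `K₀` and its
derivative. -/
theorem norm_rayMoment_zero_le {t : ℂ} (ht : 0 < t.re) : ‖rayMoment 0 t‖ ≤ rayBound t.re := by
  refine (norm_rayMoment_le 0 t).trans ?_
  have h1 : ∫ y in Ioi (0 : ℝ), rayTerm (-1) t.re y = rayBound t.re := by
    have := rayMoment_neg_one (t := (t.re : ℂ)) (by simpa using ht)
    rw [rayMoment_ofReal, rayMoment_ofReal] at this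
    exact_mod_cast this
  have h2 : ∫ y in Ioi (0 : ℝ), rayTerm 0 t.re y ≤
      ∫ y in Ioi (0 : ℝ), (1 / 2) * (rayTerm 1 t.re y + rayTerm (-1) t.re y) := by
    refine setIntegral_mono_on (integrableOn_rayTerm 0 ht)
      (((integrableOn_rayTerm 1 ht).add (integrableOn_rayTerm (-1) ht)).const_mul _)
      measurableSet_Ioi fun y hy => ?_
    have hy0 : (0 : ℝ) < y := hy
    simp only [rayTerm]
    rw [← add_mul, ← mul_assoc]
    gcongr
    norm_num
    rw [← inv_pow]
    nlinarith [sq_nonneg (y⁻¹ - 1)]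
  rw [integral_const_mul, integral_add (integrableOn_rayTerm 1 ht) (integrableOn_rayTerm (-1) ht),
    h1] at h2
  refine h2.trans (le_of_eq ?_)
  rw [rayBound]
  ring

theorem rayTerm_one (x y : ℝ) : rayTerm 1 x y = Real.exp (-(x / 2) * (y + 1 / y)) := by
  simp [rayTerm]

theorem integral_exp_half {x : ℝ} (hx : 0 < x) :
    ∫ y in Ioi (0 : ℝ), Real.exp (-(x / 2) * y) = 2 / x := by
  rw [integral_exp_mul_Ioi (by linarith) 0]
  simp

theorem rayBound_le {x : ℝ} (hx : 0 < x) : rayBound x ≤ 2 / x := by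
  rw [← integral_exp_half hx]
  refine setIntegral_mono_on (integrableOn_rayTerm 1 hx)
    (integrableOn_exp_neg_mul (by positivity)) measurableSet_Ioi fun y hy => ?_
  rw [rayTerm_one]
  have : 0 < 1 / y := one_div_pos.2 hy
  exact Real.exp_le_exp.2 (by nlinarith)

/-- Restrict the integral to `y > 1`, where `1 / y ≤ 1`. With `rayBound_le` this squeezes `x / 2 *
rayBound x` to `1` as `x → 0`, which normalizes the logarithmic singularity of `K₀`. -/
theorem rayBound_ge {x : ℝ} (hx : 0 < x) : 2 / x * Real.exp (-x) ≤ rayBound x := by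
  have h1 : ∫ y in Ioi (1 : ℝ), Real.exp (-(x / 2)) * Real.exp (-(x / 2) * y) =
      2 / x * Real.exp (-x) := by
    rw [integral_const_mul, integral_exp_mul_Ioi (by linarith) 1]
    rw [mul_one, neg_div_neg_eq, mul_div_assoc', ← Real.exp_add]
    ring_nf
  have hi : IntegrableOn (rayTerm 1 x) (Ioi 1) :=
    (integrableOn_rayTerm 1 hx).mono_set (Ioi_subset_Ioi zero_le_one)
  rw [← h1]
  refine (setIntegral_mono_on ((integrableOn_exp_mul_Ioi (by linarith) 1).const_mul _) hi
    measurableSet_Ioi fun y hy => ?_).trans (setIntegral_mono_set (integrableOn_rayTerm 1 hx) ?_ ?_)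
  · rw [rayTerm_one, ← Real.exp_add]
    have hy1 : (1 : ℝ) < y := hy
    have : 1 / y ≤ 1 := by rw [div_le_one (by linarith)]; exact hy1.le
    exact Real.exp_le_exp.2 (by nlinarith)
  · filter_upwards [ae_restrict_mem measurableSet_Ioi] with y hy
    exact rayTerm_nonneg 1 x hy
  · exact (Ioi_subset_Ioi zero_le_one).eventuallyLE

theorem rayBound_nonneg (x : ℝ) : 0 ≤ rayBound x :=
  setIntegral_nonneg measurableSet_Ioi fun _ hy => rayTerm_nonneg 1 x hy

/-- The minimum of `y + 1 / y` is `2`, so lowering the parameter from `x` to `1` gains `e^{1 - x}`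
and leaves a fixed integrable function. -/
theorem rayBound_le_exp {x : ℝ} (hx : 1 ≤ x) :
    rayBound x ≤ Real.exp 1 * rayBound 1 * Real.exp (-x) := by
  have h : ∀ y ∈ Ioi (0 : ℝ), rayTerm 1 x y ≤ Real.exp (1 - x) * rayTerm 1 1 y := by
    intro y hy
    have hy0 : (0 : ℝ) < y := hy
    rw [rayTerm_one, rayTerm_one, ← Real.exp_add]
    refine Real.exp_le_exp.2 ?_
    have h2 : 2 ≤ y + 1 / y := by
      have : y + 1 / y - 2 = (y - 1) ^ 2 / y := by field_simp; ring
      have : 0 ≤ (y - 1) ^ 2 / y := by positivity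
      linarith
    nlinarith
  refine (setIntegral_mono_on (integrableOn_rayTerm 1 (by linarith))
    ((integrableOn_rayTerm 1 one_pos).const_mul _) measurableSet_Ioi h).trans (le_of_eq ?_)
  rw [integral_const_mul, sub_eq_add_neg, Real.exp_add, rayBound]
  ring

theorem besselK0_eq (t : ℂ) : besselK0 t = 1 / 2 * rayMoment 0 t := by
  unfold besselK0 rayMoment
  congr 1
  refine integral_congr_ae (Eventually.of_forall fun y => ?_)
  simp only [besselTerm, zpow_zero, one_mul]
  ring

theorem deriv_besselK0 {t : ℂ} (ht : 0 < t.re) : deriv besselK0 t = 1 / 2 * -rayMoment 1 t := by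
  rw [show besselK0 = fun t => 1 / 2 * rayMoment 0 t from funext besselK0_eq]
  refine (((hasDerivAt_rayMoment 0 ht).const_mul _).congr_deriv ?_).deriv
  rw [zero_add, zero_sub, rayMoment_neg_one ht]
  ring

theorem norm_besselK0_le {t : ℂ} (ht : 0 < t.re) : ‖besselK0 t‖ ≤ rayBound t.re := by
  rw [besselK0_eq, norm_mul]
  have := norm_rayMoment_zero_le ht
  norm_num
  linarith [norm_nonneg (rayMoment 0 t)]

theorem norm_deriv_besselK0_le {t : ℂ} (ht : 0 < t.re) : ‖deriv besselK0 t‖ ≤ rayBound t.re := by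
  rw [deriv_besselK0 ht, norm_mul, norm_neg]
  have := norm_rayMoment_one_le t
  norm_num
  linarith [norm_nonneg (rayMoment 1 t)]

/-! ### `K₀(2 √z)` on the principal strip -/

/-- The strip over `ℂ ∖ ℝ_{≤ 0}`. -/
def principalStrip : Set ℂ := {ζ | |ζ.im| < Real.pi}

theorem isOpen_principalStrip : IsOpen principalStrip :=
  isOpen_lt Complex.continuous_im.abs continuous_const

theorem isPreconnected_principalStrip : IsPreconnected principalStrip := by
  have : principalStrip = {z : ℂ | -Real.pi < z.im} ∩ {z : ℂ | z.im < Real.pi} := by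
    ext z; exact abs_lt (a := z.im)
  rw [this]
  exact ((convex_halfSpace_im_gt _).inter (convex_halfSpace_im_lt _)).isPreconnected

theorem ofReal_mem_principalStrip (x : ℝ) : (x : ℂ) ∈ principalStrip := by
  simp [principalStrip, Real.pi_pos]

theorem tCoord_re (ζ : ℂ) : (tCoord ζ).re = 2 * (Real.exp (ζ.re / 2) * Real.cos (ζ.im / 2)) := by
  rw [tCoord, Complex.mul_re, Complex.exp_re]
  simp

theorem tCoord_re_pos {ζ : ℂ} (hζ : ζ ∈ principalStrip) : 0 < (tCoord ζ).re := by
  rw [tCoord_re]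
  have h := abs_lt.1 (show |ζ.im| < Real.pi from hζ)
  have := Real.cos_pos_of_mem_Ioo (x := ζ.im / 2) ⟨by linarith, by linarith⟩
  positivity

/-- The function `K₀(2 √z)`. -/
def funK (ζ : ℂ) : ℂ := besselK0 (tCoord ζ)
/-- The logarithmic derivative `z ∂_z` of `funK`. -/
def funK' (ζ : ℂ) : ℂ := tCoord ζ / 2 * deriv besselK0 (tCoord ζ)

theorem solvesBessel_funK : SolvesBessel principalStrip funK funK' := by
  have h : SolvesBessel principalStrip (fun ζ => rayMoment 0 (tCoord ζ))
      (fun ζ => tCoord ζ / 2 * -rayMoment 1 (tCoord ζ)) := by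
    refine solvesBessel_of_moments (F₂ := rayMoment 2) (fun ζ hζ => ?_) (fun ζ hζ => ?_)
      (fun ζ hζ => ?_)
    · refine (hasDerivAt_rayMoment 0 (tCoord_re_pos hζ)).congr_deriv ?_
      rw [zero_add, zero_sub, rayMoment_neg_one (tCoord_re_pos hζ)]
      ring
    · exact hasDerivAt_rayMoment 1 (tCoord_re_pos hζ)
    · simpa using rayMoment_parts 1 (tCoord_re_pos hζ)
  have h1 := h.linear h (1 / 2) 0
  have e1 : EqOn funK (fun ζ => 1 / 2 * rayMoment 0 (tCoord ζ) + 0 * rayMoment 0 (tCoord ζ))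
      principalStrip := fun ζ _ => by simp [funK, besselK0_eq]
  have e2 : EqOn funK' (fun ζ => 1 / 2 * (tCoord ζ / 2 * -rayMoment 1 (tCoord ζ)) +
      0 * (tCoord ζ / 2 * -rayMoment 1 (tCoord ζ))) principalStrip := fun ζ hζ => by
    simp only [funK', deriv_besselK0 (tCoord_re_pos hζ)]; ring
  intro ζ hζ
  have hn := isOpen_principalStrip.mem_nhds hζ
  rw [e1 hζ, e2 hζ]
  exact ⟨(h1 ζ hζ).1.congr_of_eventuallyEq (e1.eventuallyEq_of_mem hn),
    (h1 ζ hζ).2.congr_of_eventuallyEq (e2.eventuallyEq_of_mem hn)⟩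

/-- At `-∞`, `funK'` tends to `-1/2` and `solI` to `1`. The other product is harmless even with the
crude bound `funK = O(e^{-x/2})`, because `solI' = O(e^x)`. -/
theorem tendsto_wronskian_funK :
    Tendsto (fun x : ℝ => wronskian funK funK' solI solI' x) atBot (𝓝 (1 / 2)) := by
  have hre : ∀ x : ℝ, (tCoord x).re = 2 * Real.exp (x / 2) := fun x => by
    rw [tCoord_ofReal, Complex.ofReal_re]
  have hpos : ∀ x : ℝ, 0 < (tCoord x).re := fun x => by rw [hre]; positivity
  have ht0 : Tendsto (fun x : ℝ => 2 * Real.exp (x / 2)) atBot (𝓝 0) := by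
    have := (Complex.continuous_re.tendsto 0).comp tendsto_tCoord_atBot
    exact this.congr hre
  have hK' : Tendsto (fun x : ℝ => funK' x) atBot (𝓝 (-(1 / 2))) := by
    have hlim : Tendsto (fun x : ℝ => (2 * Real.exp (x / 2)) / 2 * rayBound (2 * Real.exp (x / 2)))
        atBot (𝓝 1) := by
      have hl : Tendsto (fun x : ℝ => Real.exp (-(2 * Real.exp (x / 2)))) atBot (𝓝 1) := by
        have := (Real.continuous_exp.tendsto 0).comp (by simpa using ht0.neg)
        simpa [Function.comp_def] using this
      refine tendsto_of_tendsto_of_tendsto_of_le_of_le hl tendsto_const_nhds (fun x => ?_)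
        fun x => ?_
      · have hp : 0 < 2 * Real.exp (x / 2) := by positivity
        have := mul_le_mul_of_nonneg_left (rayBound_ge hp) (by positivity :
          0 ≤ 2 * Real.exp (x / 2) / 2)
        refine le_trans (le_of_eq ?_) this
        field_simp
      · have hp : 0 < 2 * Real.exp (x / 2) := by positivity
        have := mul_le_mul_of_nonneg_left (rayBound_le hp) (by positivity :
          0 ≤ 2 * Real.exp (x / 2) / 2)
        refine this.trans (le_of_eq ?_)
        field_simp
    have := ((Complex.continuous_ofReal.tendsto _).comp hlim).const_mul (-(1 / 2) : ℂ)
    simp only [Complex.ofReal_one, mul_one] at this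
    refine this.congr fun x => ?_
    rw [funK', deriv_besselK0 (hpos x), tCoord_ofReal, rayMoment_ofReal]
    simp only [Function.comp_apply, rayBound]
    push_cast
    ring
  have hKI : Tendsto (fun x : ℝ => funK x * solI' x) atBot (𝓝 0) := by
    have hK : (fun x : ℝ => funK x) =O[atBot] fun x : ℝ => Real.exp (-(x / 2)) := by
      refine Asymptotics.IsBigO.of_bound 1 (Eventually.of_forall fun x => ?_)
      rw [one_mul, Real.norm_of_nonneg (Real.exp_pos _).le]
      refine (norm_besselK0_le (hpos x)).trans ?_
      rw [hre]
      refine (rayBound_le (by positivity)).trans (le_of_eq ?_)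
      rw [Real.exp_neg]
      field_simp
    refine (hK.mul isRegularAtBot_solI.2).trans_tendsto ?_
    have : Tendsto (fun x : ℝ => Real.exp (x / 2)) atBot (𝓝 0) :=
      Real.tendsto_exp_atBot.comp (tendsto_id.atBot_div_const two_pos)
    refine this.congr fun x => ?_
    rw [← Real.exp_add]
    ring_nf
  have := hKI.sub (hK'.mul isRegularAtBot_solI.1)
  simp only [zero_sub, mul_one, neg_neg] at this
  exact this

/-- On the principal strip, `K₀(2 √z)` is a combination of the two entire solutions. -/
theorem exists_funK_eq : ∃ c : ℂ, ∀ ζ ∈ principalStrip,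
    funK ζ = c * solI ζ - 1 / 2 * solL ζ ∧ funK' ζ = c * solI' ζ - 1 / 2 * solL' ζ := by
  have hI := solvesBessel_solI.mono (subset_univ principalStrip)
  have hL := solvesBessel_solL.mono (subset_univ principalStrip)
  -- The coefficient of `solI` is left as a Wronskian: neither the monodromy nor the determinant
  -- depends on its value.
  refine ⟨wronskian funK funK' solL solL' 0, fun ζ hζ => ?_⟩
  have h0 : (0 : ℂ) ∈ principalStrip := by simpa using ofReal_mem_principalStrip 0
  have h1 := wronskian_const isOpen_principalStrip isPreconnected_principalStrip
    solvesBessel_funK hL hζ h0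
  have h2 := wronskian_eq_of_tendsto isOpen_principalStrip isPreconnected_principalStrip
    ofReal_mem_principalStrip solvesBessel_funK hI tendsto_wronskian_funK hζ
  constructor
  · have := wronskian_plucker funK funK' solI solI' solL solL' ζ
    rw [wronskian_solI_solL, h2, wronskian_swap solL, h1] at this
    linear_combination this
  · have := wronskian_plucker' funK funK' solI solI' solL solL' ζ
    rw [wronskian_solI_solL, h2, wronskian_swap solL, h1] at this
    linear_combination this

/-! ### The multivalued sections `e₀` and `e₁` -/

theorem SolvesBessel.isFlat {f f' : ℂ → ℂ} (h : SolvesBessel univ f f') :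
    IsFlat 1 fun ζ => ![f' ζ, -f ζ] := by
  intro ζ
  rw [hasDerivAt_pi]
  have hsum : ∀ g : Fin (1 + 1) → ℂ, ∑ i, g i = g 0 + g 1 := Fin.sum_univ_two
  refine Fin.forall_fin_two.2 ⟨(h ζ trivial).2.congr_deriv ?_, (h ζ trivial).1.neg.congr_deriv ?_⟩
  · rw [Pi.neg_apply, Matrix.mulVec, dotProduct, hsum]
    simp [connectionMatrix]
  · rw [Pi.neg_apply, Matrix.mulVec, dotProduct, hsum]
    simp [connectionMatrix]

theorem IsFlat.eq_of_eqOn {k : ℕ} {e f : MultiSection k} (he : IsFlat k e) (hf : IsFlat k f)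
    (h : ∀ ζ ∈ principalStrip, e ζ = f ζ) : e = f := by
  have hd : ∀ {g : MultiSection k}, IsFlat k g → AnalyticOnNhd ℂ g univ := fun hg =>
    (show Differentiable ℂ _ from fun ζ => (hg ζ).differentiableAt).differentiableOn.analyticOnNhd
      isOpen_univ
  refine (hd he).eq_of_eventuallyEq (hd hf) (z₀ := 0) ?_
  filter_upwards [isOpen_principalStrip.mem_nhds
    (by simpa using ofReal_mem_principalStrip 0 : (0 : ℂ) ∈ principalStrip)] with ζ hζ
  exact h ζ hζ

/-- By the identity theorem an entire flat extension is unique, so exhibiting one determines the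
choice made in `flatContinuation`. -/
theorem flatContinuation_eq {s e : MultiSection 1} (he : IsFlat 1 e)
    (hs : ∀ ζ ∈ principalStrip, e ζ = s ζ) : flatContinuation s = e := by
  have h := Classical.epsilon_spec
    (p := fun e => IsFlat 1 e ∧ ∀ ζ : ℂ, |ζ.im| < Real.pi → e ζ = s ζ) ⟨e, he, hs⟩
  exact h.1.eq_of_eqOn he fun ζ hζ => (h.2 ζ hζ).trans (hs ζ hζ).symm

theorem e0_eq : e0 = fun ζ => ![solI' ζ, -solI ζ] := by
  refine flatContinuation_eq solvesBessel_solI.isFlat fun ζ _ => ?_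
  rw [← funI_eq, ← funI'_eq]
  rfl

theorem exists_e1_eq : ∃ c : ℂ, IsFlat 1 e1 ∧ (∀ ζ ∈ principalStrip, e1 ζ = e1Principal ζ) ∧
    e1 = fun ζ => ![-(c * solI' ζ - 1 / 2 * solL' ζ) / (Real.pi * Complex.I),
      (c * solI ζ - 1 / 2 * solL ζ) / (Real.pi * Complex.I)] := by
  obtain ⟨c, hc⟩ := exists_funK_eq
  have hflat : IsFlat 1 fun ζ => ![-(c * solI' ζ - 1 / 2 * solL' ζ) / (Real.pi * Complex.I),
      (c * solI ζ - 1 / 2 * solL ζ) / (Real.pi * Complex.I)] := by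
    convert! (solvesBessel_solI.linear solvesBessel_solL (-c / (Real.pi * Complex.I))
      (1 / 2 / (Real.pi * Complex.I))).isFlat using 2 with ζ
    ext i
    fin_cases i <;> simp <;> ring
  have hs : ∀ ζ ∈ principalStrip, ![-(c * solI' ζ - 1 / 2 * solL' ζ) / (Real.pi * Complex.I),
      (c * solI ζ - 1 / 2 * solL ζ) / (Real.pi * Complex.I)] = e1Principal ζ := fun ζ hζ => by
    rw [← (hc ζ hζ).1, ← (hc ζ hζ).2]
    rfl
  have h : e1 = _ := flatContinuation_eq hflat hs
  exact ⟨c, h ▸ hflat, fun ζ hζ => (congrFun h ζ).trans (hs ζ hζ), h⟩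

theorem isFlat_e0 : IsFlat 1 e0 := e0_eq ▸ solvesBessel_solI.isFlat

theorem isFlat_e1 : IsFlat 1 e1 := exists_e1_eq.choose_spec.1

theorem e0_turn (ζ : ℂ) : e0 (ζ + 2 * Real.pi * Complex.I) = e0 ζ := by
  simp only [e0_eq, solI_add, solI'_add]

/-- Only `solL` is multivalued, with jump `2πi * solI`. Its coefficient `-1/2` in `K₀` and the
normalization `1/(πi)` of `e₁` turn this jump into exactly `e₀`. -/
theorem e1_turn (ζ : ℂ) : e1 (ζ + 2 * Real.pi * Complex.I) = e1 ζ + e0 ζ := by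
  obtain ⟨c, -, -, h⟩ := exists_e1_eq
  have hpi : (Real.pi : ℂ) ≠ 0 := by exact_mod_cast Real.pi_ne_zero
  have hI := Complex.I_ne_zero
  rw [h, e0_eq]
  simp only [solI_add, solI'_add, solL_add, solL'_add]
  ext i
  fin_cases i
  · simp
    field_simp
    ring
  · simp
    field_simp
    ring

/-- The multiple of `solI` in `e₁` drops out, and what remains is the Wronskian of `solI` and
`solL`, equal to one. -/
theorem det_e0_e1 (ζ : ℂ) :
    2 * Real.pi * Complex.I * (e0 ζ 0 * e1 ζ 1 - e0 ζ 1 * e1 ζ 0) = 1 := by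
  obtain ⟨c, -, -, h⟩ := exists_e1_eq
  have hpi : (Real.pi : ℂ) ≠ 0 := by exact_mod_cast Real.pi_ne_zero
  have hI := Complex.I_ne_zero
  have hw := wronskian_solI_solL ζ
  unfold wronskian at hw
  rw [h, e0_eq]
  simp
  field_simp
  linear_combination hw

theorem norm_tCoord (ζ : ℂ) : ‖tCoord ζ‖ = 2 * Real.exp (ζ.re / 2) := by
  rw [tCoord, norm_mul, Complex.norm_exp]
  simp

theorem norm_e0_le (ζ : ℂ) (i : Fin 2) :
    ‖e0 ζ i‖ ≤ (1 + Real.exp (ζ.re / 2)) * Real.exp |(tCoord ζ).re| := by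
  have h1 := norm_besselI0_le (tCoord ζ)
  have h2 := norm_deriv_besselI0_le (tCoord_ne_zero ζ)
  have h3 := Real.exp_pos (ζ.re / 2)
  have h4 := Real.exp_pos |(tCoord ζ).re|
  rw [e0_eq, ← funI_eq, ← funI'_eq]
  fin_cases i
  · have : ‖funI' ζ‖ ≤ Real.exp (ζ.re / 2) * Real.exp |(tCoord ζ).re| := by
      rw [funI', norm_mul, norm_div, norm_tCoord]
      norm_num
      gcongr
    simp
    nlinarith
  · simp [funI]
    nlinarith

theorem norm_e1_le {ζ : ℂ} (hζ : ζ ∈ principalStrip) (i : Fin 2) :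
    ‖e1 ζ i‖ ≤ (1 + Real.exp (ζ.re / 2)) * rayBound (tCoord ζ).re := by
  have h1 := norm_besselK0_le (tCoord_re_pos hζ)
  have h2 := norm_deriv_besselK0_le (tCoord_re_pos hζ)
  have h3 := Real.exp_pos (ζ.re / 2)
  have h4 := rayBound_nonneg (tCoord ζ).re
  have hpi : (1 : ℝ) ≤ Real.pi := by linarith [Real.pi_gt_three]
  have hpi0 : ‖(Real.pi : ℂ)‖ = Real.pi := by simp [abs_of_pos Real.pi_pos]
  rw [exists_e1_eq.choose_spec.2.1 ζ hζ]
  have key : ∀ w : ℂ, ‖w‖ ≤ (1 + Real.exp (ζ.re / 2)) * rayBound (tCoord ζ).re →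
      ‖w / (Real.pi * Complex.I)‖ ≤ (1 + Real.exp (ζ.re / 2)) * rayBound (tCoord ζ).re := by
    intro w hw
    rw [norm_div, norm_mul, hpi0, Complex.norm_I, mul_one]
    exact (div_le_self (norm_nonneg w) hpi).trans hw
  revert i
  rw [Fin.forall_fin_two]
  refine ⟨key _ ?_, key _ ?_⟩
  · rw [norm_neg, norm_mul, norm_div, norm_tCoord]
    norm_num
    gcongr
    linarith
  · exact h1.trans (by nlinarith)

/-! ### Growth of the monomials in `e₀` and `e₁` -/

theorem isBigO_coeff_mul {α : Type*} {l : Filter α} {P Q : α → Polynomial ℂ} {g h : α → ℝ}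
    (hP : ∀ n, (fun q => (P q).coeff n) =O[l] g) (hQ : ∀ n, (fun q => (Q q).coeff n) =O[l] h)
    (n : ℕ) : (fun q => (P q * Q q).coeff n) =O[l] fun q => g q * h q := by
  simp only [Polynomial.coeff_mul]
  exact Asymptotics.IsBigO.fun_sum fun x _ => (hP x.1).mul (hQ x.2)

theorem isBigO_coeff_pow {α : Type*} {l : Filter α} {P : α → Polynomial ℂ} {g : α → ℝ}
    (hP : ∀ n, (fun q => (P q).coeff n) =O[l] g) (m n : ℕ) :
    (fun q => (P q ^ m).coeff n) =O[l] fun q => g q ^ m := by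
  induction m generalizing n with
  | zero =>
    simp only [pow_zero]
    exact Asymptotics.isBigO_const_const _ one_ne_zero _
  | succ m ih =>
    simp only [pow_succ]
    exact isBigO_coeff_mul ih hP n

theorem isBigO_coeff_linear {α : Type*} {l : Filter α} {a b : α → ℂ} {g : α → ℝ}
    (ha : a =O[l] g) (hb : b =O[l] g) (n : ℕ) :
    (fun q => (Polynomial.C (a q) + Polynomial.C (b q) * Polynomial.X).coeff n) =O[l] g := by
  rcases n with _ | _ | n
  · simpa using ha
  · simpa [Polynomial.coeff_C] using hb
  · simp only [Polynomial.coeff_add, Polynomial.coeff_C_mul, Polynomial.coeff_X, Polynomial.coeff_C]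
    simpa using Asymptotics.isBigO_zero g l

theorem isBigO_eMonomial {α : Type*} {l : Filter α} {z : α → ℂ} {g h : α → ℝ}
    (h0 : ∀ i, (fun q => e0 (z q) i) =O[l] g) (h1 : ∀ i, (fun q => e1 (z q) i) =O[l] h)
    (k j : ℕ) : (fun q => eMonomial k j (z q)) =O[l] fun q => g q ^ j * h q ^ (k - j) := by
  rw [Asymptotics.isBigO_pi]
  intro a
  exact isBigO_coeff_mul (isBigO_coeff_pow (isBigO_coeff_linear (h0 0) (h0 1)) j)
    (isBigO_coeff_pow (isBigO_coeff_linear (h1 0) (h1 1)) (k - j)) a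

/-! ### Estimates near the boundary circles -/

/-- The square root of the absolute value of the coordinate `z`. -/
def sqrtAbs (q : ℝ × ℝ) : ℝ := Real.exp ((logCoord q).re / 2)

theorem logCoord_re (q : ℝ × ℝ) : (logCoord q).re = Real.log (q.1 / (1 - q.1)) := by
  simp only [logCoord, Complex.add_re, Complex.ofReal_re, Complex.mul_re, Complex.ofReal_im,
    Complex.I_re, Complex.I_im]
  ring

theorem logCoord_im (q : ℝ × ℝ) : (logCoord q).im = q.2 := by
  simp only [logCoord, Complex.add_im, Complex.ofReal_re, Complex.mul_im, Complex.ofReal_im,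
    Complex.I_re, Complex.I_im]
  ring

theorem sqrtAbs_sq {q : ℝ × ℝ} (hq : q ∈ openStrip) : sqrtAbs q ^ 2 = q.1 / (1 - q.1) := by
  have h : 0 < q.1 / (1 - q.1) := div_pos hq.1 (sub_pos.2 hq.2)
  rw [sqrtAbs, logCoord_re, ← Real.exp_nat_mul]
  push_cast
  rw [mul_div_cancel₀ _ two_ne_zero, Real.exp_log h]

theorem sqrtAbs_pos (q : ℝ × ℝ) : 0 < sqrtAbs q := Real.exp_pos _

theorem tCoord_logCoord_re (q : ℝ × ℝ) :
    (tCoord (logCoord q)).re = 2 * (sqrtAbs q * Real.cos (q.2 / 2)) := by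
  rw [tCoord_re, logCoord_im, sqrtAbs]

/-- Near a boundary point with `|θ| < π`, `Re t` is comparable to `|t|`. -/
theorem eventually_angle {p : ℝ × ℝ} (hp : |p.2| < Real.pi) :
    ∃ c : ℝ, 0 < c ∧ ∀ᶠ q in 𝓝[openStrip] p, q ∈ openStrip ∧ logCoord q ∈ principalStrip ∧
      c * sqrtAbs q ≤ (tCoord (logCoord q)).re ∧ (tCoord (logCoord q)).re ≤ 2 * sqrtAbs q := by
  have h := abs_lt.1 hp
  have hc : 0 < Real.cos (p.2 / 2) :=
    Real.cos_pos_of_mem_Ioo ⟨by linarith, by linarith⟩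
  have h1 : ∀ᶠ q : ℝ × ℝ in 𝓝 p, Real.cos (p.2 / 2) / 2 < Real.cos (q.2 / 2) :=
    (Continuous.tendsto (by fun_prop : Continuous fun q : ℝ × ℝ => Real.cos (q.2 / 2)) p
      ).eventually_const_lt (by linarith)
  have h2 : ∀ᶠ q : ℝ × ℝ in 𝓝 p, |q.2| < Real.pi :=
    (Continuous.tendsto (by fun_prop : Continuous fun q : ℝ × ℝ => |q.2|) p
      ).eventually_lt_const hp
  refine ⟨Real.cos (p.2 / 2), hc, ?_⟩
  filter_upwards [self_mem_nhdsWithin, nhdsWithin_le_nhds h1, nhdsWithin_le_nhds h2] with q hq h3 h4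
  have hs := sqrtAbs_pos q
  refine ⟨hq, by rw [principalStrip, mem_ofPred_eq, logCoord_im]; exact h4, ?_, ?_⟩
  · rw [tCoord_logCoord_re]; nlinarith
  · rw [tCoord_logCoord_re]; nlinarith [Real.cos_le_one (q.2 / 2)]

theorem tendsto_sqrtAbs {p : ℝ × ℝ} (hp : p.1 = 1) :
    Tendsto sqrtAbs (𝓝[openStrip] p) atTop := by
  have h1 : Tendsto (fun q : ℝ × ℝ => q.1) (𝓝[openStrip] p) (𝓝 1) :=
    hp ▸ (continuous_fst.tendsto p).mono_left nhdsWithin_le_nhds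
  have h2 : Tendsto (fun q : ℝ × ℝ => 1 - q.1) (𝓝[openStrip] p) (𝓝[>] 0) := by
    refine tendsto_nhdsWithin_iff.2 ⟨by simpa using h1.const_sub 1, ?_⟩
    filter_upwards [self_mem_nhdsWithin] with q hq
    exact sub_pos.2 hq.2
  have h3 : Tendsto (fun q : ℝ × ℝ => q.1 / (1 - q.1)) (𝓝[openStrip] p) atTop :=
    h1.pos_mul_atTop one_pos h2.inv_tendsto_nhdsGT_zero
  have h4 := Real.tendsto_exp_atTop.comp
    ((Real.tendsto_log_atTop.comp h3).atTop_div_const two_pos)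
  exact h4.congr fun q => by simp [sqrtAbs, logCoord_re]

/-- Each factor `e₀` costs `e^{Re t}` and each `e₁` gains `e^{-Re t}`, so the net exponent is `-(k -
2j) Re t`. This gives rapid decay for `2j < k` and moderate growth for `2j ≤ k`, whence the ranges
of `i` and `j` in the theorem. -/
theorem isBigO_eMonomial_infty {p : ℝ × ℝ} (hp : p.1 = 1) (hp' : |p.2| < Real.pi) {k j : ℕ}
    (hj : 2 * j ≤ k) :
    (fun q => eMonomial k j (logCoord q)) =O[𝓝[openStrip] p] fun q =>
      sqrtAbs q ^ k * Real.exp (-((k - 2 * j : ℕ) * (tCoord (logCoord q)).re)) := by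
  obtain ⟨c, hc, hev⟩ := eventually_angle hp'
  have hT := tendsto_sqrtAbs hp
  have hbig : ∀ᶠ q in 𝓝[openStrip] p, 1 ≤ sqrtAbs q ∧ 1 ≤ (tCoord (logCoord q)).re := by
    filter_upwards [hev, hT.eventually_ge_atTop 1, hT.eventually_ge_atTop (1 / c)] with q h1 h2 h3
    refine ⟨h2, le_trans ?_ h1.2.2.1⟩
    rw [div_le_iff₀ hc] at h3
    linarith
  have h0 : ∀ i, (fun q => e0 (logCoord q) i) =O[𝓝[openStrip] p] fun q =>
      sqrtAbs q * Real.exp (tCoord (logCoord q)).re := fun i => by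
    refine Asymptotics.IsBigO.of_bound 2 ?_
    filter_upwards [hbig] with q h1
    have hs := sqrtAbs_pos q
    rw [Real.norm_of_nonneg (by positivity)]
    refine (norm_e0_le _ i).trans ?_
    rw [abs_of_pos (by linarith [h1.2])]
    have : (1 + sqrtAbs q) ≤ 2 * sqrtAbs q := by linarith [h1.1]
    have he := Real.exp_pos (tCoord (logCoord q)).re
    have := mul_le_mul_of_nonneg_right this he.le
    rw [sqrtAbs] at *
    linarith
  have h1 : ∀ i, (fun q => e1 (logCoord q) i) =O[𝓝[openStrip] p] fun q =>
      sqrtAbs q * Real.exp (-(tCoord (logCoord q)).re) := fun i => by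
    refine Asymptotics.IsBigO.of_bound (2 * (Real.exp 1 * rayBound 1)) ?_
    filter_upwards [hbig, hev] with q h1 h2
    have hs := sqrtAbs_pos q
    rw [Real.norm_of_nonneg (by positivity)]
    refine (norm_e1_le h2.2.1 i).trans ?_
    have h3 : (1 + sqrtAbs q) ≤ 2 * sqrtAbs q := by linarith [h1.1]
    have h4 := mul_le_mul h3 (rayBound_le_exp h1.2) (rayBound_nonneg _) (by positivity)
    rw [sqrtAbs] at *
    linarith
  refine (isBigO_eMonomial h0 h1 k j).trans (Eventually.isBigO (Eventually.of_forall fun q => ?_))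
  have hs := sqrtAbs_pos q
  rw [Real.norm_of_nonneg (by positivity)]
  refine le_of_eq ?_
  obtain ⟨m, rfl⟩ := Nat.exists_eq_add_of_le hj
  rw [mul_pow, mul_pow, mul_mul_mul_comm, ← pow_add, ← Real.exp_nat_mul, ← Real.exp_nat_mul,
    ← Real.exp_add, show 2 * j + m - 2 * j = m by omega, show 2 * j + m - j = j + m by omega,
    show j + (j + m) = 2 * j + m by ring]
  congr 2
  push_cast
  ring

theorem eventually_half {p : ℝ × ℝ} (hp : p.1 = 1) :
    ∀ᶠ q in 𝓝[openStrip] p, q ∈ openStrip ∧ 1 / 2 ≤ q.1 := by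
  have h1 : Tendsto (fun q : ℝ × ℝ => q.1) (𝓝[openStrip] p) (𝓝 1) :=
    hp ▸ (continuous_fst.tendsto p).mono_left nhdsWithin_le_nhds
  filter_upwards [self_mem_nhdsWithin, h1.eventually_const_le (by norm_num : (1 / 2 : ℝ) < 1)]
    with q hq h
  exact ⟨hq, h⟩

theorem boundary_coord {q : ℝ × ℝ} (hq : q ∈ openStrip) :
    q.1 * (1 - q.1) * sqrtAbs q ^ 2 = q.1 ^ 2 := by
  have := (sub_pos.2 hq.2).ne'
  rw [sqrtAbs_sq hq]
  field_simp

theorem rapidDecayAt_eMonomial {p : ℝ × ℝ} (hp : p.1 = 1) (hp' : |p.2| < Real.pi) {k j : ℕ}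
    (hj : 2 * j < k) : RapidDecayAt k (eMonomial k j) p := by
  intro N
  obtain ⟨c, hc, hev⟩ := eventually_angle hp'
  have hT := tendsto_sqrtAbs hp
  have hexp : ∀ᶠ q in 𝓝[openStrip] p,
      ‖sqrtAbs q ^ (k + 2 * N)‖ ≤ 1 * ‖Real.exp (c * sqrtAbs q)‖ :=
    hT.eventually ((isLittleO_pow_exp_pos_mul_atTop (k + 2 * N) hc).def one_pos)
  refine (isBigO_eMonomial_infty hp hp' hj.le).trans ?_
  refine Asymptotics.IsBigO.of_bound (4 ^ N) ?_
  filter_upwards [hev, hexp, eventually_half hp] with q h1 h2 h3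
  have hs := sqrtAbs_pos q
  have hb : 0 < q.1 * (1 - q.1) := mul_pos h3.1.1 (sub_pos.2 h3.1.2)
  rw [Real.norm_of_nonneg (by positivity), Real.norm_of_nonneg (by positivity), one_mul] at h2
  rw [Real.norm_of_nonneg (by positivity), Real.norm_of_nonneg (by positivity)]
  have h4 : Real.exp (-((k - 2 * j : ℕ) * (tCoord (logCoord q)).re)) ≤
      Real.exp (-(c * sqrtAbs q)) := by
    refine Real.exp_le_exp.2 (neg_le_neg ?_)
    have h5 : (1 : ℝ) ≤ (k - 2 * j : ℕ) := by exact_mod_cast (by omega : 1 ≤ k - 2 * j)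
    have h6 : 0 ≤ (tCoord (logCoord q)).re := le_trans (by positivity) h1.2.2.1
    exact h1.2.2.1.trans (le_mul_of_one_le_left h6 h5)
  -- `ρ (1 - ρ) |z| = ρ²` is at least `1/4` for `ρ ≥ 1/2`: each factor `ρ (1 - ρ)` is paid for by
  -- two factors `sqrtAbs`, hence the exponent `k + 2 * N` and the constant `4 ^ N`.
  have h5 : 1 ≤ 4 * (q.1 * (1 - q.1)) * sqrtAbs q ^ 2 := by
    rw [mul_assoc, boundary_coord h3.1]
    nlinarith [h3.2]
  have h6 : 1 ≤ (4 ^ N * (q.1 * (1 - q.1)) ^ N) * sqrtAbs q ^ (2 * N) := by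
    rw [pow_mul, ← mul_pow, ← mul_pow]
    exact one_le_pow₀ h5
  calc sqrtAbs q ^ k * Real.exp (-((k - 2 * j : ℕ) * (tCoord (logCoord q)).re))
      ≤ sqrtAbs q ^ k * Real.exp (-(c * sqrtAbs q)) := by gcongr
    _ ≤ (sqrtAbs q ^ k * Real.exp (-(c * sqrtAbs q))) *
        ((4 ^ N * (q.1 * (1 - q.1)) ^ N) * sqrtAbs q ^ (2 * N)) :=
        le_mul_of_one_le_right (by positivity) h6
    _ = (4 ^ N * (q.1 * (1 - q.1)) ^ N) * (sqrtAbs q ^ (k + 2 * N) *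
        Real.exp (-(c * sqrtAbs q))) := by rw [pow_add]; ring
    _ ≤ (4 ^ N * (q.1 * (1 - q.1)) ^ N) * 1 := by
        gcongr
        rw [Real.exp_neg, ← div_eq_mul_inv]
        exact (div_le_one (Real.exp_pos _)).2 h2
    _ = _ := mul_one _

theorem moderateGrowthAt_eMonomial_infty {p : ℝ × ℝ} (hp : p.1 = 1) (hp' : |p.2| < Real.pi)
    {k j : ℕ} (hj : 2 * j ≤ k) : ModerateGrowthAt k (eMonomial k j) p := by
  refine ⟨k, (isBigO_eMonomial_infty hp hp' hj).trans (Asymptotics.IsBigO.of_bound 1 ?_)⟩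
  obtain ⟨c, hc, hev⟩ := eventually_angle hp'
  filter_upwards [hev, (tendsto_sqrtAbs hp).eventually_ge_atTop 1] with q h1 h2
  have hs := sqrtAbs_pos q
  have hb : 0 < q.1 * (1 - q.1) := mul_pos h1.1.1 (sub_pos.2 h1.1.2)
  rw [Real.norm_of_nonneg (by positivity), Real.norm_of_nonneg (by positivity), one_mul]
  have h6 : 0 ≤ (tCoord (logCoord q)).re := le_trans (by positivity) h1.2.2.1
  have h7 : Real.exp (-((k - 2 * j : ℕ) * (tCoord (logCoord q)).re)) ≤ 1 :=
    Real.exp_le_one_iff.2 (neg_nonpos.2 (by positivity))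
  have h8 : q.1 * (1 - q.1) * sqrtAbs q ≤ 1 := by
    have := boundary_coord h1.1
    have h9 : q.1 ^ 2 ≤ 1 := pow_le_one₀ h1.1.1.le h1.1.2.le
    nlinarith
  rw [← one_div, le_div_iff₀ (by positivity)]
  calc sqrtAbs q ^ k * Real.exp (-((k - 2 * j : ℕ) * (tCoord (logCoord q)).re)) *
        (q.1 * (1 - q.1)) ^ k
      ≤ sqrtAbs q ^ k * 1 * (q.1 * (1 - q.1)) ^ k := by gcongr
    _ = (q.1 * (1 - q.1) * sqrtAbs q) ^ k := by rw [mul_one, ← mul_pow, mul_comm (sqrtAbs q)]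
    _ ≤ 1 := pow_le_one₀ (by positivity) h8

/-- Near `0` the section `e₀` is bounded. For `e₁` the crude bound `O(|z|^{-1/2})` from
`rayBound_le` suffices, although its growth is only logarithmic. -/
theorem moderateGrowthAt_eMonomial_zero {p : ℝ × ℝ} (hp : p.1 = 0) (hp' : |p.2| < Real.pi)
    (k j : ℕ) : ModerateGrowthAt k (eMonomial k j) p := by
  obtain ⟨c, hc, hev⟩ := eventually_angle hp'
  have hsmall : ∀ᶠ q in 𝓝[openStrip] p, sqrtAbs q ≤ 1 := by
    have h1 : Tendsto (fun q : ℝ × ℝ => q.1) (𝓝[openStrip] p) (𝓝 0) :=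
      hp ▸ (continuous_fst.tendsto p).mono_left nhdsWithin_le_nhds
    filter_upwards [self_mem_nhdsWithin, h1.eventually_le_const (by norm_num : (0 : ℝ) < 1 / 2)]
      with q hq h
    have : sqrtAbs q ^ 2 ≤ 1 := by
      rw [sqrtAbs_sq hq, div_le_one (sub_pos.2 hq.2)]
      linarith
    exact (pow_le_one_iff_of_nonneg (sqrtAbs_pos q).le two_ne_zero).1 this
  have h0 : ∀ i, (fun q => e0 (logCoord q) i) =O[𝓝[openStrip] p] fun q => (1 : ℝ) := fun i => by
    refine Asymptotics.IsBigO.of_bound (2 * Real.exp 2) ?_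
    filter_upwards [hev, hsmall] with q h1 h2
    have hs := sqrtAbs_pos q
    have h3 : 0 ≤ (tCoord (logCoord q)).re := le_trans (by positivity) h1.2.2.1
    rw [norm_one, mul_one]
    refine (norm_e0_le _ i).trans ?_
    rw [abs_of_nonneg h3]
    have h4 : Real.exp (tCoord (logCoord q)).re ≤ Real.exp 2 :=
      Real.exp_le_exp.2 (by linarith [h1.2.2.2])
    refine mul_le_mul ?_ h4 (Real.exp_pos _).le (by norm_num)
    rw [sqrtAbs] at h2
    linarith
  have h1 : ∀ i, (fun q => e1 (logCoord q) i) =O[𝓝[openStrip] p] fun q => (sqrtAbs q)⁻¹ :=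
    fun i => by
    refine Asymptotics.IsBigO.of_bound (4 / c) ?_
    filter_upwards [hev, hsmall] with q h1 h2
    have hs := sqrtAbs_pos q
    have h3 : 0 < (tCoord (logCoord q)).re := lt_of_lt_of_le (by positivity) h1.2.2.1
    rw [Real.norm_of_nonneg (by positivity)]
    refine (norm_e1_le h1.2.1 i).trans ?_
    have h4 : rayBound (tCoord (logCoord q)).re ≤ 2 / (c * sqrtAbs q) :=
      (rayBound_le h3).trans (by gcongr; exact h1.2.2.1)
    have h5 : 1 + sqrtAbs q ≤ 2 := by linarith
    refine (mul_le_mul h5 h4 (rayBound_nonneg _) (by norm_num)).trans (le_of_eq ?_)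
    field_simp
    norm_num
  refine ⟨k, (isBigO_eMonomial h0 h1 k j).trans (Asymptotics.IsBigO.of_bound 1 ?_)⟩
  filter_upwards [hev, hsmall] with q h1 h2
  have hs := sqrtAbs_pos q
  have hb : 0 < q.1 * (1 - q.1) := mul_pos h1.1.1 (sub_pos.2 h1.1.2)
  rw [Real.norm_of_nonneg (by positivity), Real.norm_of_nonneg (by positivity), one_mul, one_pow,
    one_mul, inv_pow]
  have h3 : q.1 * (1 - q.1) ≤ sqrtAbs q ^ 2 := by
    rw [sqrtAbs_sq h1.1, le_div_iff₀ (sub_pos.2 h1.1.2)]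
    have h4 : 0 < 1 - q.1 := sub_pos.2 h1.1.2
    have h5 : 0 < q.1 := h1.1.1
    nlinarith [mul_pos h4 h5]
  gcongr
  calc (q.1 * (1 - q.1)) ^ k ≤ (sqrtAbs q ^ 2) ^ k := by gcongr
    _ = sqrtAbs q ^ (2 * k) := (pow_mul _ _ _).symm
    _ ≤ sqrtAbs q ^ (k - j) := pow_le_pow_of_le_one hs.le h2 (by omega)

/-! ### Flatness of the monomials in `e₀` and `e₁` -/

/-- The polynomial `v 0 + v 1 X` that represents a vector of `Kl₂`. -/
def linearPoly (v : Fin 2 → ℂ) : Polynomial ℂ :=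
  Polynomial.C (v 0) + Polynomial.C (v 1) * Polynomial.X

/-- The operator `z∇` on polynomials that represent vectors of `Sym^d Kl₂`. -/
def connectionPoly (d : ℕ) (z : ℂ) (P : Polynomial ℂ) : Polynomial ℂ :=
  Polynomial.C (d : ℂ) * Polynomial.X * P +
    (Polynomial.C z - Polynomial.X ^ 2) * Polynomial.derivative P

/-- With `X = v₁ / v₀`, a vector of degree `d` is `v₀^d P(X)`. The factor `v₀^d` contributes `d X
P`, and `z∇ X = z - X²`, so the operator is a derivation in which degrees add. -/
theorem connectionPoly_mul (d d' : ℕ) (z : ℂ) (P Q : Polynomial ℂ) :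
    connectionPoly (d + d') z (P * Q) = connectionPoly d z P * Q + P * connectionPoly d' z Q := by
  unfold connectionPoly
  rw [Polynomial.derivative_mul, Nat.cast_add, Polynomial.C_add]
  ring

theorem coeff_connectionPoly_zero (d : ℕ) (z : ℂ) (P : Polynomial ℂ) :
    (connectionPoly d z P).coeff 0 = z * P.coeff 1 := by
  simp [connectionPoly, mul_assoc, sub_mul, pow_two, Polynomial.coeff_derivative]

theorem coeff_connectionPoly_succ (d : ℕ) (z : ℂ) (P : Polynomial ℂ) (n : ℕ) :
    (connectionPoly d z P).coeff (n + 1) =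
      (d - n) * P.coeff n + z * (n + 2) * P.coeff (n + 2) := by
  have h : (Polynomial.X * (Polynomial.X * Polynomial.derivative P)).coeff (n + 1) =
      n * P.coeff n := by
    rw [Polynomial.coeff_X_mul]
    cases n with
    | zero => simp
    | succ n => rw [Polynomial.coeff_X_mul, Polynomial.coeff_derivative]; push_cast; ring
  simp only [connectionPoly, mul_assoc, sub_mul, pow_two, Polynomial.coeff_add,
    Polynomial.coeff_sub, Polynomial.coeff_C_mul, h, Polynomial.coeff_X_mul,
    Polynomial.coeff_derivative]
  push_cast
  ring

/-- Flatness of a multivalued section of `Sym^d Kl₂` that is given by polynomials. -/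
def IsFlatPoly (d : ℕ) (P : ℂ → Polynomial ℂ) : Prop :=
  ∀ ζ n, HasDerivAt (fun ζ => (P ζ).coeff n) (-(connectionPoly d (Complex.exp ζ) (P ζ)).coeff n) ζ

theorem IsFlatPoly.mul {d d' : ℕ} {P Q : ℂ → Polynomial ℂ} (hP : IsFlatPoly d P)
    (hQ : IsFlatPoly d' Q) : IsFlatPoly (d + d') fun ζ => P ζ * Q ζ := by
  intro ζ n
  simp only [Polynomial.coeff_mul]
  refine (HasDerivAt.fun_sum fun x _ => (hP ζ x.1).fun_mul (hQ ζ x.2)).congr_deriv ?_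
  rw [connectionPoly_mul, Polynomial.coeff_add, Polynomial.coeff_mul, Polynomial.coeff_mul,
    ← Finset.sum_add_distrib, ← Finset.sum_neg_distrib]
  exact Finset.sum_congr rfl fun x _ => by ring

theorem IsFlatPoly.pow {P : ℂ → Polynomial ℂ} (hP : IsFlatPoly 1 P) (d : ℕ) :
    IsFlatPoly d fun ζ => P ζ ^ d := by
  induction d with
  | zero =>
    intro ζ n
    simp only [pow_zero]
    exact (hasDerivAt_const ζ _).congr_deriv (by simp [connectionPoly])
  | succ d ih => simpa only [pow_succ] using ih.mul hP

theorem isFlatPoly_linearPoly {e : MultiSection 1} (he : IsFlat 1 e) :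
    IsFlatPoly 1 fun ζ => linearPoly (e ζ) := by
  intro ζ n
  have h := hasDerivAt_pi.1 (he ζ)
  have hsum : ∀ g : Fin (1 + 1) → ℂ, ∑ i, g i = g 0 + g 1 := Fin.sum_univ_two
  simp only [Pi.neg_apply, Matrix.mulVec, dotProduct, hsum, connectionMatrix] at h
  rcases n with _ | _ | n
  · refine ((h 0).congr_of_eventuallyEq (.of_forall fun x => ?_)).congr_deriv ?_
    · simp [linearPoly]
    · simp [coeff_connectionPoly_zero, linearPoly, Polynomial.coeff_C]
  · refine ((h 1).congr_of_eventuallyEq (.of_forall fun x => ?_)).congr_deriv ?_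
    · simp [linearPoly, Polynomial.coeff_C]
    · simp [coeff_connectionPoly_succ, linearPoly, Polynomial.coeff_C, Polynomial.coeff_X]
  · refine ((hasDerivAt_const ζ (0 : ℂ)).congr_of_eventuallyEq
      (.of_forall fun x => ?_)).congr_deriv ?_
    · simp [linearPoly]
    · cases n <;> simp [coeff_connectionPoly_succ, linearPoly, Polynomial.coeff_C]

theorem natDegree_linearPoly_le (v : Fin 2 → ℂ) : (linearPoly v).natDegree ≤ 1 := by
  unfold linearPoly
  compute_degree

/-- The family of the coefficients of a polynomial that represents a vector of `Sym^k Kl₂`. -/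
def coeffVector (k : ℕ) : Polynomial ℂ →ₗ[ℂ] Fin (k + 1) → ℂ :=
  LinearMap.pi fun a => Polynomial.lcoeff ℂ a

@[simp] theorem coeffVector_apply (k : ℕ) (P : Polynomial ℂ) (a : Fin (k + 1)) :
    coeffVector k P a = P.coeff a := rfl

theorem mulVec_coeffVector {k : ℕ} (z : ℂ) {P : Polynomial ℂ} (hP : P.natDegree ≤ k)
    (a : Fin (k + 1)) : (connectionMatrix k z).mulVec (coeffVector k P) a =
      (connectionPoly k z P).coeff a := by
  have hkey : ∀ b : Fin (k + 1), connectionMatrix k z a b * P.coeff b =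
      (if (a : ℕ) = b + 1 then ((k : ℂ) - (b : ℕ)) * P.coeff b else 0) +
      (if (a : ℕ) + 1 = b then ((b : ℕ) : ℂ) * z * P.coeff b else 0) := by
    intro b
    simp only [connectionMatrix, Matrix.of_apply]
    split_ifs <;> first | omega | simp
  simp only [Matrix.mulVec, dotProduct, coeffVector_apply, hkey, Finset.sum_add_distrib]
  rw [Fin.sum_univ_eq_sum_range (fun b => if (a : ℕ) = b + 1 then ((k : ℂ) - b) * P.coeff b else 0),
    Fin.sum_univ_eq_sum_range (fun b => if (a : ℕ) + 1 = b then (b : ℂ) * z * P.coeff b else 0)]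
  have h2 : (∑ b ∈ Finset.range (k + 1), if (a : ℕ) + 1 = b then (b : ℂ) * z * P.coeff b else 0) =
      z * (a + 1) * P.coeff (a + 1) := by
    rw [Finset.sum_ite_eq]
    split_ifs with h
    · push_cast; ring
    -- In the last row the matrix has no column `k + 1`; the degree bound makes that coefficient
    -- vanish.
    · rw [Polynomial.coeff_eq_zero_of_natDegree_lt, mul_zero]
      rw [Finset.mem_range] at h
      omega
  rw [h2]
  obtain ⟨a, ha⟩ := a
  cases a with
  | zero => simp [coeff_connectionPoly_zero]
  | succ a =>
    simp only [coeff_connectionPoly_succ, Nat.add_right_cancel_iff, Finset.sum_ite_eq]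
    rw [if_pos (Finset.mem_range.2 (by omega))]
    push_cast
    ring

/-- The polynomial that represents `e₀^i e₁^j`. -/
def monomialPoly (i j : ℕ) (ζ : ℂ) : Polynomial ℂ :=
  linearPoly (e0 ζ) ^ i * linearPoly (e1 ζ) ^ j

theorem eMonomial_eq (k j : ℕ) (ζ : ℂ) :
    eMonomial k j ζ = coeffVector k (monomialPoly j (k - j) ζ) := rfl

theorem natDegree_monomialPoly_le (i j : ℕ) (ζ : ℂ) : (monomialPoly i j ζ).natDegree ≤ i + j := by
  refine Polynomial.natDegree_mul_le.trans (add_le_add ?_ ?_)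
  · simpa using Polynomial.natDegree_pow_le_of_le i (natDegree_linearPoly_le (e0 ζ))
  · simpa using Polynomial.natDegree_pow_le_of_le j (natDegree_linearPoly_le (e1 ζ))

theorem isFlat_eMonomial {k j : ℕ} (hj : j ≤ k) : IsFlat k (eMonomial k j) := by
  intro ζ
  rw [hasDerivAt_pi]
  intro a
  have h := ((isFlatPoly_linearPoly isFlat_e0).pow j).mul
    ((isFlatPoly_linearPoly isFlat_e1).pow (k - j)) ζ a
  rw [Nat.add_sub_cancel' hj] at h
  refine h.congr_deriv ?_
  rw [Pi.neg_apply, eMonomial_eq, mulVec_coeffVector]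
  · rfl
  · exact (natDegree_monomialPoly_le _ _ _).trans (by omega)

/-! ### Monodromy of the monomials -/

theorem linearPoly_add_smul (v w : Fin 2 → ℂ) (c : ℂ) :
    linearPoly (v + c • w) = linearPoly v + Polynomial.C c * linearPoly w := by
  simp only [linearPoly, Pi.add_apply, Pi.smul_apply, smul_eq_mul, Polynomial.C_add,
    Polynomial.C_mul]
  ring

theorem e0_turns (m : ℕ) (ζ : ℂ) : e0 (ζ + 2 * Real.pi * Complex.I * m) = e0 ζ := by
  induction m with
  | zero => simp
  | succ m ih =>
    rw [← ih, ← e0_turn (ζ + 2 * Real.pi * Complex.I * m)]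
    congr 1
    push_cast
    ring

theorem e1_turns (m : ℕ) (ζ : ℂ) :
    e1 (ζ + 2 * Real.pi * Complex.I * m) = e1 ζ + (m : ℂ) • e0 ζ := by
  induction m with
  | zero => simp
  | succ m ih =>
    rw [show ζ + 2 * Real.pi * Complex.I * (m + 1 : ℕ) =
      ζ + 2 * Real.pi * Complex.I * m + 2 * Real.pi * Complex.I by push_cast; ring, e1_turn, ih,
      e0_turns, Nat.cast_succ, add_smul, one_smul, add_assoc]

/-- After `m` turns `e₁` becomes `e₁ + m e₀`; expand its power by the binomial theorem. -/
theorem eMonomial_turns (k j m : ℕ) (ζ : ℂ) :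
    eMonomial k j (ζ + 2 * Real.pi * Complex.I * m) =
      ∑ l ∈ Finset.range (k - j + 1), (((k - j).choose l : ℂ) * (m : ℂ) ^ l) •
        eMonomial k (j + l) ζ := by
  simp only [eMonomial_eq, ← map_smul, ← map_sum]
  congr 1
  rw [monomialPoly, e0_turns, e1_turns, linearPoly_add_smul, add_comm (linearPoly (e1 ζ)), add_pow,
    Finset.mul_sum]
  refine Finset.sum_congr rfl fun l _ => ?_
  simp only [monomialPoly, ← Nat.sub_sub, Polynomial.smul_eq_C_mul, mul_pow, pow_add,
    Polynomial.C_mul, Polynomial.C_pow, map_natCast]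
  ring

/-! ### The pairings of the monomials -/

theorem coeff_linearPoly_pow (v : Fin 2 → ℂ) {k a : ℕ} (ha : a ≤ k) :
    (linearPoly v ^ k).coeff a = (k.choose a : ℂ) * v 1 ^ a * v 0 ^ (k - a) := by
  have h : linearPoly v ^ k = ∑ l ∈ Finset.range (k + 1),
      Polynomial.C ((k.choose l : ℂ) * v 1 ^ l * v 0 ^ (k - l)) * Polynomial.X ^ l := by
    rw [linearPoly, add_comm, add_pow]
    refine Finset.sum_congr rfl fun l _ => ?_
    simp only [Polynomial.C_mul, Polynomial.C_pow, map_natCast]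
    ring
  rw [h]
  simp only [Polynomial.finsetSum_coeff, Polynomial.coeff_C_mul_X_pow, Finset.sum_ite_eq]
  rw [if_pos (Finset.mem_range.2 (Nat.lt_succ_of_le ha))]

theorem topPairing_linearPoly_pow (k : ℕ) (v w : Fin 2 → ℂ) :
    topPairing k (coeffVector k (linearPoly v ^ k)) (coeffVector k (linearPoly w ^ k)) =
      (2 * Real.pi * Complex.I * (v 0 * w 1 - v 1 * w 0)) ^ k := by
  rw [topPairing_eq, mul_pow (2 * Real.pi * Complex.I) (v 0 * w 1 - v 1 * w 0), sub_eq_neg_add,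
    add_pow]
  congr 1
  rw [← Fin.sum_univ_eq_sum_range fun a =>
    (-(v 1 * w 0)) ^ a * (v 0 * w 1) ^ (k - a) * (k.choose a : ℂ)]
  refine Finset.sum_congr rfl fun a _ => ?_
  have ha : (a : ℕ) ≤ k := by omega
  rw [coeffVector_apply, coeffVector_apply, coeff_linearPoly_pow v ha,
    coeff_linearPoly_pow w (by omega), Fin.val_rev, show k + 1 - (a + 1 : ℕ) = k - a by omega,
    Nat.sub_sub_self ha, Nat.choose_symm ha, pairingWeight, Nat.cast_choose ℂ ha]
  have h1 : ((a : ℕ)! : ℂ) ≠ 0 := Nat.cast_ne_zero.2 (Nat.factorial_ne_zero _)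
  have h2 : ((k - a : ℕ)! : ℂ) ≠ 0 := Nat.cast_ne_zero.2 (Nat.factorial_ne_zero _)
  have h3 : (k ! : ℂ) ≠ 0 := Nat.cast_ne_zero.2 (Nat.factorial_ne_zero _)
  rw [neg_pow (v 1 * w 0), mul_pow, mul_pow]
  field_simp

theorem coeffVector_linearPoly_pow (k : ℕ) (ζ x : ℂ) :
    coeffVector k (linearPoly (e1 ζ + x • e0 ζ) ^ k) =
      ∑ i ∈ Finset.range (k + 1), ((k.choose i : ℂ) * x ^ i) • eMonomial k i ζ := by
  simp only [eMonomial_eq, ← map_smul, ← map_sum]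
  congr 1
  rw [linearPoly_add_smul, add_comm (linearPoly (e1 ζ)), add_pow]
  refine Finset.sum_congr rfl fun l _ => ?_
  simp only [monomialPoly, Polynomial.smul_eq_C_mul, mul_pow, Polynomial.C_mul, Polynomial.C_pow,
    map_natCast]
  ring

theorem eq_of_sum_mul_pow_eq {n : ℕ} {a b : ℕ → ℂ}
    (h : ∀ x : ℂ, ∑ i ∈ Finset.range n, a i * x ^ i = ∑ i ∈ Finset.range n, b i * x ^ i)
    {i : ℕ} (hi : i < n) : a i = b i := by
  have hc : ∀ a : ℕ → ℂ, (∑ i ∈ Finset.range n, Polynomial.C (a i) * Polynomial.X ^ i).coeff i =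
      a i := fun a => by
    simp [Polynomial.coeff_X_pow, hi]
  have hp : (∑ i ∈ Finset.range n, Polynomial.C (a i) * Polynomial.X ^ i) =
      ∑ i ∈ Finset.range n, Polynomial.C (b i) * Polynomial.X ^ i :=
    Polynomial.funext fun x => by simpa [Polynomial.eval_finsetSum] using h x
  rw [← hc a, hp, hc b]

/-- By `topPairing_linearPoly_pow` and `det_e0_e1`, the powers `(e₁ + x e₀)^k` and `(e₁ + y e₀)^k`
pair to `(x - y)^k`. Compare the coefficients of `x^i y^j`. -/
theorem topPairing_eMonomial {k i j : ℕ} (hi : i ≤ k) (hj : j ≤ k) (ζ : ℂ) :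
    topPairing k (eMonomial k i ζ) (eMonomial k j ζ) =
      if i + j = k then (-1) ^ j / (k.choose j : ℂ) else 0 := by
  have hgen : ∀ x y : ℂ, ∑ i ∈ Finset.range (k + 1), (∑ j ∈ Finset.range (k + 1),
      ((k.choose i : ℂ) * (k.choose j : ℂ) *
        topPairing k (eMonomial k i ζ) (eMonomial k j ζ)) * y ^ j) * x ^ i =
      ∑ i ∈ Finset.range (k + 1), ((k.choose i : ℂ) * (-y) ^ (k - i)) * x ^ i := by
    intro x y
    have h := topPairing_linearPoly_pow k (e1 ζ + x • e0 ζ) (e1 ζ + y • e0 ζ)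
    have hdet : 2 * Real.pi * Complex.I * ((e1 ζ + x • e0 ζ) 0 * (e1 ζ + y • e0 ζ) 1 -
        (e1 ζ + x • e0 ζ) 1 * (e1 ζ + y • e0 ζ) 0) = x + -y := by
      simp only [Pi.add_apply, Pi.smul_apply, smul_eq_mul]
      linear_combination (x - y) * det_e0_e1 ζ
    rw [hdet, coeffVector_linearPoly_pow, coeffVector_linearPoly_pow, ← topForm_apply, add_pow]
      at h
    simp only [map_sum, map_smul, LinearMap.sum_apply, LinearMap.smul_apply, smul_eq_mul,
      topForm_apply] at h
    refine Eq.trans ?_ (h.trans (Finset.sum_congr rfl fun i _ => by ring))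
    simp only [Finset.sum_mul, Finset.mul_sum]
    rw [Finset.sum_comm]
    refine Finset.sum_congr rfl fun i _ => Finset.sum_congr rfl fun j _ => by ring
  have h1 := fun y => eq_of_sum_mul_pow_eq (fun x => hgen x y) (Nat.lt_succ_of_le hi)
  have h2 := eq_of_sum_mul_pow_eq (n := k + 1) (b := fun l => if l = k - i then
      (k.choose i : ℂ) * (-1) ^ (k - i) else 0) (fun y => (h1 y).trans (by
    simp only [ite_mul, zero_mul, Finset.sum_ite_eq']
    rw [if_pos (Finset.mem_range.2 (by omega)), neg_pow]
    ring)) (Nat.lt_succ_of_le hj)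
  have hci : (k.choose i : ℂ) ≠ 0 := Nat.cast_ne_zero.2 (Nat.choose_pos hi).ne'
  have hcj : (k.choose j : ℂ) ≠ 0 := Nat.cast_ne_zero.2 (Nat.choose_pos hj).ne'
  split_ifs with hij
  · rw [if_pos (by omega), show k - i = j by omega] at h2
    field_simp
    exact mul_left_cancel₀ hci (by linear_combination h2)
  · rw [if_neg (by omega)] at h2
    exact (mul_eq_zero.1 h2).resolve_left (mul_ne_zero hci hcj)

/-- Of the binomial expansion only `l = k - i - j` pairs nontrivially. If `j > k - i` no term does,
and the binomial coefficient on the right vanishes too. -/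
theorem topPairing_eMonomial_turns {k i j : ℕ} (hi : i ≤ k) (hj : j ≤ k) (m : ℕ) (ζ : ℂ) :
    topPairing k (eMonomial k i (ζ + 2 * Real.pi * Complex.I * m)) (eMonomial k j ζ) =
      (-1) ^ j * ((k - i).choose j : ℂ) / (k.choose j : ℂ) * (m : ℂ) ^ (k - i - j) := by
  rw [eMonomial_turns, ← topForm_apply, map_sum, LinearMap.sum_apply]
  simp only [map_smul, LinearMap.smul_apply, topForm_apply, smul_eq_mul]
  rcases le_or_gt j (k - i) with h | h
  · rw [Finset.sum_eq_single (k - i - j), topPairing_eMonomial (by omega) hj, if_pos (by omega),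
      Nat.choose_symm h]
    · ring
    · intro l hl hne
      rw [Finset.mem_range] at hl
      rw [topPairing_eMonomial (by omega) hj, if_neg (by omega), mul_zero]
    · intro h
      exact absurd (Finset.mem_range.2 (by omega)) h
  · rw [Nat.choose_eq_zero_of_lt h, Finset.sum_eq_zero]
    · simp
    · intro l hl
      rw [Finset.mem_range] at hl
      rw [topPairing_eMonomial (by omega) hj, if_neg (by omega), mul_zero]

/-! ### The coefficients `C_n(a)` -/

/-- Up to sign, the sum is the `n`-th finite difference of `x^s` at `0`. -/
theorem alternating_sum_pow {n s : ℕ} (hs : s ≤ n) :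
    ∑ a ∈ Finset.range (n + 1), (-1 : ℂ) ^ a * (n.choose a : ℂ) * (a : ℂ) ^ s =
      if s = n then (-1) ^ n * (n ! : ℂ) else 0 := by
  have h := fwdDiff_iter_eq_sum_shift (1 : ℂ) (fun x : ℂ => x ^ s) n 0
  have h1 : ∑ a ∈ Finset.range (n + 1), (-1 : ℂ) ^ a * (n.choose a : ℂ) * (a : ℂ) ^ s =
      (-1) ^ n * (fwdDiff (1 : ℂ))^[n] (fun x : ℂ => x ^ s) 0 := by
    rw [h, Finset.mul_sum]
    refine Finset.sum_congr rfl fun a ha => ?_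
    obtain ⟨b, rfl⟩ := Nat.exists_eq_add_of_le (Nat.lt_succ_iff.1 (Finset.mem_range.1 ha))
    have hb : (-1 : ℂ) ^ b * (-1) ^ b = 1 := by rw [← mul_pow]; simp
    simp only [Nat.add_sub_cancel_left, zsmul_eq_mul, nsmul_eq_mul, zero_add, mul_one]
    push_cast
    rw [pow_add]
    linear_combination (-((-1 : ℂ) ^ a * ((a + b).choose a : ℂ) * (a : ℂ) ^ s)) * hb
  rw [h1]
  split_ifs with hsn
  · subst hsn
    rw [fwdDiff_iter_eq_factorial, Pi.natCast_apply]
  · rw [fwdDiff_iter_pow_eq_zero_of_lt (lt_of_le_of_ne hs hsn)]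
    simp

/-- One factor `a` cancels the denominator of `C_n(a)`, leaving the alternating sum of
`alternating_sum_pow` without its term `a = 0`; that missing term produces `1 / n` when `s = 0`. -/
theorem sum_coeffC_mul_pow_succ {n s : ℕ} (hn : 1 ≤ n) (hs : s ≤ n) :
    ∑ a ∈ Finset.Icc 1 n, coeffC n a * (a : ℂ) ^ (s + 1) =
      (if s = 0 then 1 else 0) / (n : ℂ) +
        if s = n then (-1) ^ (n - 1) * ((n - 1)! : ℂ) else 0 := by
  have hn0 : (n : ℂ) ≠ 0 := Nat.cast_ne_zero.2 (by omega)
  have h := alternating_sum_pow hs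
  rw [Finset.range_eq_Ico, Finset.sum_eq_sum_Ico_succ_bot (Nat.succ_pos n)] at h
  have h1 : ∑ a ∈ Finset.Icc 1 n, coeffC n a * (a : ℂ) ^ (s + 1) =
      -(∑ a ∈ Finset.Ico (0 + 1) (n + 1), (-1 : ℂ) ^ a * (n.choose a : ℂ) * (a : ℂ) ^ s) / n := by
    rw [neg_div, Finset.sum_div, ← Finset.sum_neg_distrib]
    refine Finset.sum_congr rfl fun a ha => ?_
    rw [Finset.mem_Ico] at ha
    obtain ⟨b, rfl⟩ := Nat.exists_eq_add_of_le ha.1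
    have hb : ((1 + b : ℕ) : ℂ) ≠ 0 := Nat.cast_ne_zero.2 (by omega)
    rw [coeffC, show 0 + 1 + b - 1 = b by omega, pow_succ, pow_add]
    field_simp
    ring
  rw [h1]
  obtain ⟨n, rfl⟩ := Nat.exists_eq_add_of_le' hn
  rw [Nat.add_sub_cancel]
  rw [eq_sub_of_add_eq' h]
  rcases Nat.eq_zero_or_pos s with rfl | hs0
  · simp
  · rw [if_neg hs0.ne', Nat.cast_zero, zero_pow hs0.ne']
    split_ifs
    · rw [Nat.factorial_succ, pow_succ]
      push_cast at hn0 ⊢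
      field_simp
      ring
    · simp

theorem sum_range_pow_complex (a p : ℕ) :
    ∑ m ∈ Finset.range a, (m : ℂ) ^ p = ∑ l ∈ Finset.range (p + 1),
      ((bernoulli l : ℚ) : ℂ) * ((p + 1).choose l : ℂ) * (a : ℂ) ^ (p - l + 1) / (p + 1) := by
  have h := congr_arg (fun q : ℚ => (q : ℂ)) (sum_range_pow a p)
  push_cast at h
  rw [h]
  refine Finset.sum_congr rfl fun l hl => ?_
  rw [Finset.mem_range] at hl
  rw [show p + 1 - l = p - l + 1 by omega]

/-- In Faulhaber's formula the weights `C_n(a)` keep the linear term in `a`, which carries the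
Bernoulli number of index `p`, and the term in `a^(n+1)`, which is present only if `p = n`. -/
theorem sum_coeffC_mul_sum_pow {n p : ℕ} (hn : 1 ≤ n) (hp : 1 ≤ p) (hpn : p ≤ n) :
    ∑ a ∈ Finset.Icc 1 n, coeffC n a * ∑ m ∈ Finset.range a, (m : ℂ) ^ p =
      ((bernoulli p : ℚ) : ℂ) / n +
        if p = n then (-1) ^ (n - 1) * ((n - 1)! : ℂ) / ((n + 1 : ℕ) : ℂ) else 0 := by
  have hn0 : (n : ℂ) ≠ 0 := Nat.cast_ne_zero.2 (by omega)
  have hp0 : ((p : ℂ) + 1) ≠ 0 := by exact_mod_cast Nat.succ_ne_zero p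
  simp only [sum_range_pow_complex, Finset.mul_sum]
  rw [Finset.sum_comm]
  have h : ∀ l ∈ Finset.range (p + 1), ∑ a ∈ Finset.Icc 1 n, coeffC n a *
      (((bernoulli l : ℚ) : ℂ) * ((p + 1).choose l : ℂ) * (a : ℂ) ^ (p - l + 1) / (p + 1)) =
      (if l = p then ((bernoulli l : ℚ) : ℂ) * ((p + 1).choose l : ℂ) / (p + 1) / n else 0) +
      (if l = 0 then (if p = n then (-1) ^ (n - 1) * ((n - 1)! : ℂ) / (p + 1) else 0) else 0) := by
    intro l hl
    rw [Finset.mem_range] at hl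
    have h := sum_coeffC_mul_pow_succ hn (show p - l ≤ n by omega)
    calc _ = ((bernoulli l : ℚ) : ℂ) * ((p + 1).choose l : ℂ) / (p + 1) *
        ∑ a ∈ Finset.Icc 1 n, coeffC n a * (a : ℂ) ^ (p - l + 1) := by
          rw [Finset.mul_sum]; exact Finset.sum_congr rfl fun a _ => by ring
      _ = _ := by
          rw [h]
          rcases Nat.eq_zero_or_pos l with rfl | h0
          · rw [Nat.sub_zero, if_neg (show ¬ p = 0 by omega), if_neg (show ¬ 0 = p by omega),
              if_pos rfl]
            split_ifs <;> simp
            ring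
          · rw [if_neg (show ¬ p - l = n by omega), if_neg h0.ne']
            by_cases hlp : l = p
            · rw [if_pos (by omega), if_pos hlp]; ring
            · rw [if_neg (by omega), if_neg hlp]; ring
  rw [Finset.sum_congr rfl h, Finset.sum_add_distrib, Finset.sum_ite_eq', Finset.sum_ite_eq',
    if_pos (Finset.mem_range.2 (by omega)), if_pos (Finset.mem_range.2 (by omega))]
  congr 1
  · rw [Nat.choose_succ_self_right]
    push_cast
    field_simp
  · split_ifs with h
    · rw [h]; push_cast; rfl
    · rfl

/-! ### Affine simplices -/

namespace SmoothSimplex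

theorem segment_path {p q : ℝ × ℝ} (hp : p.1 ∈ Icc (0 : ℝ) 1) (hq : q.1 ∈ Icc (0 : ℝ) 1) {s : ℝ}
    (hs : s ∈ Icc (0 : ℝ) 1) : (segment p q hp hq).path s = (1 - s) • p + s • q := by
  rw [path, projIcc_of_mem _ hs]
  rfl

theorem deriv_segment_path {p q : ℝ × ℝ} (hp : p.1 ∈ Icc (0 : ℝ) 1) (hq : q.1 ∈ Icc (0 : ℝ) 1)
    {s : ℝ} (hs : s ∈ Ioo (0 : ℝ) 1) : deriv (segment p q hp hq).path s = q - p := by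
  have h : HasDerivAt (fun s : ℝ => (1 - s) • p + s • q) ((-1 : ℝ) • p + (1 : ℝ) • q) s :=
    (((hasDerivAt_id s).const_sub 1).smul_const p).add ((hasDerivAt_id s).smul_const q)
  have h' := h.congr_of_eventuallyEq (f₁ := (segment p q hp hq).path) (by
    filter_upwards [isOpen_Ioo.mem_nhds hs] with x hx
    exact segment_path hp hq (Ioo_subset_Icc_self hx))
  rw [h'.deriv]
  module

/-- The `0`-simplex at a point. -/
def vertex (p : ℝ × ℝ) (hp : p.1 ∈ Icc (0 : ℝ) 1) : SmoothSimplex 0 where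
  toFun _ := p
  smooth' := ⟨fun _ => p, contDiff_const, fun _ => rfl⟩
  mem_strip' _ := hp

theorem vertex_deck (p : ℝ × ℝ) (hp : p.1 ∈ Icc (0 : ℝ) 1) :
    (vertex p hp).deck = vertex (p + (0, 2 * Real.pi)) (by simpa using hp) := rfl

/-- The affine triangle with given vertices. -/
def triangle (p q r : ℝ × ℝ) (hp : p.1 ∈ Icc (0 : ℝ) 1) (hq : q.1 ∈ Icc (0 : ℝ) 1)
    (hr : r.1 ∈ Icc (0 : ℝ) 1) : SmoothSimplex 2 where
  toFun x := x.1 0 • p + x.1 1 • q + x.1 2 • r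
  smooth' := by
    refine ⟨fun x => x 0 • p + x 1 • q + x 2 • r, ?_, fun x => rfl⟩
    fun_prop
  mem_strip' x := by
    have h0 := x.2.1 0
    have h1 := x.2.1 1
    have h2 := x.2.1 2
    have hs : x.1 0 + x.1 1 + x.1 2 = 1 := by simpa [Fin.sum_univ_three] using x.2.2
    simp only [Prod.fst_add, Prod.smul_fst, smul_eq_mul]
    constructor
    · have := mul_nonneg h0 hp.1
      have := mul_nonneg h1 hq.1
      have := mul_nonneg h2 hr.1
      linarith
    · have := mul_le_mul_of_nonneg_left hp.2 h0
      have := mul_le_mul_of_nonneg_left hq.2 h1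
      have := mul_le_mul_of_nonneg_left hr.2 h2
      linarith

theorem stdSimplex_map_val {m n : ℕ} (f : Fin m → Fin n) (x : stdSimplex ℝ (Fin m)) (j : Fin n) :
    (stdSimplex.map f x).1 j = ∑ i, if f i = j then x.1 i else 0 := by
  rw [← Finset.sum_filter]
  exact FunOnFinite.linearMap_apply_apply ℝ ℝ f x.1 j

theorem segment_face_zero {p q : ℝ × ℝ} (hp : p.1 ∈ Icc (0 : ℝ) 1) (hq : q.1 ∈ Icc (0 : ℝ) 1) :
    (segment p q hp hq).face 0 = vertex q hq := by
  refine SmoothSimplex.ext (funext fun x => ?_)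
  have hx : x.1 0 = 1 := by simpa using x.2.2
  simp only [face, segment, vertex, stdSimplex_map_val]
  simp [hx]

theorem segment_face_one {p q : ℝ × ℝ} (hp : p.1 ∈ Icc (0 : ℝ) 1) (hq : q.1 ∈ Icc (0 : ℝ) 1) :
    (segment p q hp hq).face 1 = vertex p hp := by
  refine SmoothSimplex.ext (funext fun x => ?_)
  have hx : x.1 0 = 1 := by simpa using x.2.2
  simp only [face, segment, vertex, stdSimplex_map_val]
  simp [hx]

theorem triangle_face {p q r : ℝ × ℝ} (hp : p.1 ∈ Icc (0 : ℝ) 1) (hq : q.1 ∈ Icc (0 : ℝ) 1)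
    (hr : r.1 ∈ Icc (0 : ℝ) 1) (i : Fin 3) : (triangle p q r hp hq hr).face i =
      ![segment q r hq hr, segment p r hp hr, segment p q hp hq] i := by
  refine SmoothSimplex.ext (funext fun x => ?_)
  fin_cases i <;> simp [face, triangle, segment, stdSimplex_map_val, Fin.sum_univ_two,
    Fin.succAbove, Fin.lt_def]

end SmoothSimplex

/-! ### Cycles -/

section Cycles

variable {k : ℕ} {G : MultiSection k → ℝ × ℝ → Prop}

open SmoothSimplex

theorem boundary_single_segment {p q : ℝ × ℝ} (hp : p.1 ∈ Icc (0 : ℝ) 1)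
    (hq : q.1 ∈ Icc (0 : ℝ) 1) (e : MultiSection k) :
    boundary k 0 (Finsupp.single (segment p q hp hq) e) =
      Finsupp.single (vertex q hq) e - Finsupp.single (vertex p hp) e := by
  simp [boundary, Fin.sum_univ_two, segment_face_zero, segment_face_one, sub_eq_add_neg]

theorem boundary_single_triangle {p q r : ℝ × ℝ} (hp : p.1 ∈ Icc (0 : ℝ) 1)
    (hq : q.1 ∈ Icc (0 : ℝ) 1) (hr : r.1 ∈ Icc (0 : ℝ) 1) (e : MultiSection k) :
    boundary k 1 (Finsupp.single (triangle p q r hp hq hr) e) =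
      Finsupp.single (segment q r hq hr) e - Finsupp.single (segment p r hp hr) e +
        Finsupp.single (segment p q hp hq) e := by
  simp [boundary, Fin.sum_univ_three, triangle_face, sub_eq_add_neg]

theorem single_mem_twistedChains {n : ℕ} {σ : SmoothSimplex n} {e : MultiSection k}
    (h : Admissible G σ e) : Finsupp.single σ e ∈ twistedChains G n :=
  Submodule.subset_span ⟨σ, e, h, rfl⟩

theorem single_vertex_mem_nullChains {p : ℝ × ℝ} {hp : p.1 ∈ Icc (0 : ℝ) 1} {e : MultiSection k}
    (he : IsFlat k e) (hb : p ∈ boundaryStrip) (h : G e p) :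
    Finsupp.single (vertex p hp) e ∈ nullChains G 0 :=
  Submodule.subset_span (Or.inl ⟨vertex p hp, e, ⟨he, fun _ _ => h⟩, fun _ => hb, rfl⟩)

theorem single_segment_mem_twistedCycles {p q : ℝ × ℝ} {hp : p.1 ∈ Icc (0 : ℝ) 1}
    {hq : q.1 ∈ Icc (0 : ℝ) 1} {e : MultiSection k} (h : Admissible G (segment p q hp hq) e)
    (hbp : p ∈ boundaryStrip) (hbq : q ∈ boundaryStrip) (hep : G e p) (heq : G e q) :
    Finsupp.single (segment p q hp hq) e ∈ twistedCycles G := by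
  refine ⟨single_mem_twistedChains h, ?_⟩
  rw [SetLike.mem_coe, Submodule.mem_comap, boundary_single_segment]
  exact Submodule.sub_mem _ (single_vertex_mem_nullChains h.1 hbq heq)
    (single_vertex_mem_nullChains h.1 hbp hep)

/-! ### The cycles `β_j` -/

/-- A lift of a path from `0` to `∞` whose angle increases from `0` to `π / 2`. -/
def diagonal : SmoothSimplex 1 :=
  segment (0, 0) (1, Real.pi / 2) (by norm_num) (by norm_num)

theorem moderateGrowthAt_eMonomial {j : ℕ} (hj : 2 * j ≤ k) {p : ℝ × ℝ} (hp : p ∈ boundaryStrip)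
    (hp' : |p.2| < Real.pi) : ModerateGrowthAt k (eMonomial k j) p :=
  hp.elim (fun h => moderateGrowthAt_eMonomial_zero h hp' k j)
    fun h => moderateGrowthAt_eMonomial_infty h hp' hj

theorem admissible_moderateGrowthAt {n j : ℕ} (hj : 2 * j ≤ k) {σ : SmoothSimplex n}
    (hσ : ∀ x, |(σ.toFun x).2| < Real.pi) :
    Admissible (ModerateGrowthAt k) σ (eMonomial k j) :=
  ⟨isFlat_eMonomial (by omega), fun x hx => moderateGrowthAt_eMonomial hj hx (hσ x)⟩

theorem abs_mul_pi_div_two_lt {x : ℝ} (h0 : 0 ≤ x) (h1 : x ≤ 1) :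
    |x * (Real.pi / 2)| < Real.pi := by
  have := Real.pi_pos
  rw [abs_of_nonneg (by positivity)]
  nlinarith

theorem single_diagonal_mem_modCycles {j : ℕ} (hj : 2 * j ≤ k) :
    Finsupp.single diagonal (eMonomial k j) ∈ modCycles k := by
  have hpi := Real.pi_pos
  refine single_segment_mem_twistedCycles (admissible_moderateGrowthAt hj fun x => ?_)
    (Or.inl rfl) (Or.inr rfl) (moderateGrowthAt_eMonomial hj (Or.inl rfl) (by simpa))
    (moderateGrowthAt_eMonomial hj (Or.inr rfl) ?_)
  · simpa [SmoothSimplex.segment] using abs_mul_pi_div_two_lt (x.2.1 1) (stdSimplex.le_one x 1)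
  · simpa using abs_mul_pi_div_two_lt zero_le_one le_rfl

theorem betaChain_mem_modCycles {j : ℕ} (hj : 2 * j ≤ k) : betaChain k j ∈ modCycles k := by
  have hpi := Real.pi_pos
  exact single_segment_mem_twistedCycles
    (admissible_moderateGrowthAt hj fun x => by simpa [SmoothSimplex.segment])
    (Or.inl rfl) (Or.inr rfl) (moderateGrowthAt_eMonomial hj (Or.inl rfl) (by simpa))
    (moderateGrowthAt_eMonomial hj (Or.inr rfl) (by simpa))

/-- The ray runs along `c_+` and meets the circles at their end points, so it is moved. The triangle
between the ray and the diagonal has its third side over `∞`, which is null. All angles stay below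
`π`, where `e₀^j e₁^(k-j)` is known to have moderate growth. -/
theorem homologyClass_diagonal {j : ℕ} (hj : 2 * j ≤ k) :
    homologyClass _ (single_diagonal_mem_modCycles hj) =
      homologyClass _ (betaChain_mem_modCycles hj) := by
  refine Subtype.ext ((Submodule.Quotient.eq _).2 ?_)
  have h01 : ((0 : ℝ), (0 : ℝ)).1 ∈ Icc (0 : ℝ) 1 := by norm_num
  have h11 : ((1 : ℝ), (0 : ℝ)).1 ∈ Icc (0 : ℝ) 1 := by norm_num
  have h12 : ((1 : ℝ), Real.pi / 2).1 ∈ Icc (0 : ℝ) 1 := by norm_num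
  have ht := boundary_single_triangle h01 h11 h12 (eMonomial k j)
  have heq : Finsupp.single diagonal (eMonomial k j) - betaChain k j =
      Finsupp.single (segment (1, 0) (1, Real.pi / 2) h11 h12) (eMonomial k j) -
        boundary k 1 (Finsupp.single (triangle _ _ _ h01 h11 h12) (eMonomial k j)) := by
    rw [ht, diagonal, betaChain, ray]
    abel
  rw [heq]
  refine Submodule.sub_mem _ (Submodule.mem_sup_right (Submodule.subset_span
    (Or.inl ⟨_, _, ?_, fun x => Or.inr ?_, rfl⟩)))
    (Submodule.mem_sup_left (Submodule.mem_map_of_mem (single_mem_twistedChains ?_)))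
  · refine admissible_moderateGrowthAt hj fun x => ?_
    simpa [SmoothSimplex.segment] using abs_mul_pi_div_two_lt (x.2.1 1) (stdSimplex.le_one x 1)
  · have hs : x.1 0 + x.1 1 = 1 := by simpa [Fin.sum_univ_two] using x.2.2
    simpa [SmoothSimplex.segment] using hs
  · refine admissible_moderateGrowthAt hj fun x => ?_
    simpa [triangle] using abs_mul_pi_div_two_lt (x.2.1 2) (stdSimplex.le_one x 2)

/-! ### The cycles `α_i` -/

/-- Iterates the identification of two lifts. Over `ℂˣ` the growth condition is vacuous, so flatness
is all that is needed. -/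
theorem single_vertex_turn_mem_nullChains {p : ℝ × ℝ} (hp : p ∈ openStrip) {e : MultiSection k}
    (he : IsFlat k e) (n : ℕ) (hp' : (p + turn n).1 ∈ Icc (0 : ℝ) 1) (hp'' : p.1 ∈ Icc (0 : ℝ) 1) :
    Finsupp.single (vertex (p + turn n) hp') e -
      Finsupp.single (vertex p hp'') (fun ζ => e (ζ + 2 * Real.pi * Complex.I * n)) ∈
        nullChains G 0 := by
  induction n generalizing e with
  | zero =>
    have h : vertex (p + turn (0 : ℕ)) hp' = vertex p hp'' := by
      congr 1
      simp [turn]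
    rw [h]
    simp
  | succ n ih =>
    have hdeck : vertex (p + turn (n + 1 : ℕ)) hp' =
        (vertex (p + turn n) (by simpa [turn] using hp'')).deck := by
      rw [vertex_deck]
      congr 1
      rw [Nat.cast_succ, turn_add, turn_one, add_assoc]
    have hshift : IsFlat k fun ζ => e (ζ + 2 * Real.pi * Complex.I) := by
      simpa using he.shift 1
    have h1 : Finsupp.single (vertex (p + turn n) (by simpa [turn] using hp'')).deck e -
        Finsupp.single (vertex (p + turn n) (by simpa [turn] using hp''))
          (fun ζ => e (ζ + 2 * Real.pi * Complex.I)) ∈ nullChains G 0 :=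
      Submodule.subset_span (Or.inr ⟨_, e, ⟨he, fun x hx => ?_⟩, rfl⟩)
    · convert Submodule.add_mem _ h1 (ih hshift (by simpa [turn] using hp'')) using 1
      rw [hdeck, sub_add_sub_cancel]
      congr 2
      funext ζ
      congr 1
      push_cast
      ring
    · rw [← hdeck] at hx
      have : (p + turn (n + 1 : ℕ)) ∈ boundaryStrip := hx
      rw [turn_mem_boundaryStrip] at this
      rcases this with h | h
      · exact absurd h hp.1.ne'
      · exact absurd h hp.2.ne

/-- With `n = k - i + 1`, `T` the monodromy and `N = log T`, expand `T^a - 1` in powers of `a N`.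
The weights keep only `N / n`, since `N^(n+1)` kills `e₀^(i-1) e₁^n`, and `N` maps this monomial to
`n e₀^i e₁^(n-1)`. -/
theorem sum_coeffC_smul_eMonomial {i : ℕ} (hi : 1 ≤ i) (hik : i ≤ k) (ζ : ℂ) :
    ∑ a ∈ Finset.Icc 1 (k - i + 1), coeffC (k - i + 1) a •
      (eMonomial k (i - 1) (ζ + 2 * Real.pi * Complex.I * a) - eMonomial k (i - 1) ζ) =
        eMonomial k i ζ := by
  have hn : k - (i - 1) = k - i + 1 := by omega
  have hC : ∀ s ∈ Finset.range (k - i + 1),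
      ∑ a ∈ Finset.Icc 1 (k - i + 1), coeffC (k - i + 1) a * (a : ℂ) ^ (s + 1) =
        (if s = 0 then 1 else 0) / ((k - i + 1 : ℕ) : ℂ) := fun s hs => by
    rw [Finset.mem_range] at hs
    rw [sum_coeffC_mul_pow_succ (by omega) (by omega), if_neg (show ¬ s = k - i + 1 by omega),
      add_zero]
  simp only [eMonomial_turns, hn]
  simp only [Finset.sum_range_succ' _ (k - i + 1), Nat.choose_zero_right, pow_zero, Nat.cast_one,
    mul_one, one_smul, add_zero, add_sub_cancel_right, Finset.smul_sum, smul_smul]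
  rw [Finset.sum_comm]
  have h : ∀ s ∈ Finset.range (k - i + 1), ∑ a ∈ Finset.Icc 1 (k - i + 1),
      (coeffC (k - i + 1) a * (((k - i + 1).choose (s + 1) : ℂ) * (a : ℂ) ^ (s + 1))) •
        eMonomial k (i - 1 + (s + 1)) ζ = if s = 0 then eMonomial k i ζ else 0 := by
    intro s hs
    rw [← Finset.sum_smul]
    simp only [mul_left_comm (coeffC _ _)]
    rw [← Finset.mul_sum, hC s hs]
    split_ifs with h
    · subst h
      have h0 : ((k - i + 1 : ℕ) : ℂ) ≠ 0 := Nat.cast_ne_zero.2 (Nat.succ_ne_zero _)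
      rw [zero_add, Nat.choose_one_right, mul_one_div_cancel h0, one_smul, Nat.sub_add_cancel hi]
    · simp
  rw [Finset.sum_congr rfl h, Finset.sum_ite_eq', if_pos (Finset.mem_range.2 (Nat.succ_pos _))]

theorem circle_admissible (n : ℕ) {e : MultiSection k} (he : IsFlat k e) :
    Admissible G (circle n) e := by
  refine ⟨he, fun x hx => ?_⟩
  have hs : x.1 0 + x.1 1 = 1 := by simpa [Fin.sum_univ_two] using x.2.2
  have h1 : ((circle n).toFun x).1 = 1 / 2 := by
    simp only [circle, SmoothSimplex.segment, Prod.fst_add, Prod.smul_fst, smul_eq_mul]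
    linear_combination hs / 2
  rcases hx with h | h <;> rw [h1] at h <;> norm_num at h

theorem cPlus_admissible {i : ℕ} (hi : 2 * i < k) :
    Admissible (RapidDecayAt k) cPlus (eMonomial k i) := by
  refine ⟨isFlat_eMonomial (by omega), fun x hx => ?_⟩
  have h0 := x.2.1 0
  have h1 := x.2.1 1
  have hs : x.1 0 + x.1 1 = 1 := by simpa [Fin.sum_univ_two] using x.2.2
  have he : cPlus.toFun x = (x.1 0 * (1 / 2) + x.1 1, 0) := by simp [cPlus, SmoothSimplex.segment]
  rw [he] at hx ⊢
  refine rapidDecayAt_eMonomial (hx.resolve_left fun h => ?_) (by simpa using Real.pi_pos) hi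
  simp only at h
  linarith

theorem boundary_circle_mem_nullChains (n : ℕ) {e : MultiSection k} (he : IsFlat k e) :
    boundary k 0 (Finsupp.single (circle n) e) -
      Finsupp.single (vertex (1 / 2, 0) (by norm_num))
        (fun ζ => e (ζ + 2 * Real.pi * Complex.I * n) - e ζ) ∈ nullChains G 0 := by
  have h := single_vertex_turn_mem_nullChains (G := G) (p := (1 / 2, 0))
    ⟨by norm_num, by norm_num⟩ he n (by norm_num [turn]) (by norm_num)
  rw [circle, boundary_single_segment]
  convert h using 1
  rw [show (fun ζ => e (ζ + 2 * Real.pi * Complex.I * n) - e ζ) =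
    (fun ζ => e (ζ + 2 * Real.pi * Complex.I * n)) - e from rfl, Finsupp.single_sub]
  simp [turn]

theorem alphaZero_mem_rdCycles (k : ℕ) : alphaZero k ∈ rdCycles k := by
  have hf := isFlat_eMonomial (le_refl k)
  refine ⟨single_mem_twistedChains (circle_admissible 1 hf), ?_⟩
  have h := boundary_circle_mem_nullChains (G := RapidDecayAt k) 1 hf
  rw [show (fun ζ => eMonomial k k (ζ + 2 * Real.pi * Complex.I * (1 : ℕ)) - eMonomial k k ζ) = 0
    from funext fun ζ => by rw [eMonomial_turns]; simp, Finsupp.single_zero, sub_zero] at h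
  exact h

/-- Modulo null chains the circles have total boundary `e₀^i e₁^(k-i)` at the point `z = 1`, where
`ρ = 1/2`; this cancels the initial point of `c_+`. The end point of `c_+` is null because `2i < k`
gives rapid decay. -/
theorem alphaChain_mem_rdCycles {i : ℕ} (hi : 2 * i < k) : alphaChain k i ∈ rdCycles k := by
  rw [alphaChain]
  split_ifs with h0
  · exact alphaZero_mem_rdCycles k
  have hf : IsFlat k (eMonomial k (i - 1)) := isFlat_eMonomial (by omega)
  rw [add_assoc]
  refine Submodule.add_mem _ (Submodule.smul_mem _ _ (alphaZero_mem_rdCycles k)) ⟨?_, ?_⟩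
  · exact Submodule.add_mem _ (single_mem_twistedChains (cPlus_admissible hi))
      (Submodule.sum_mem _ fun a _ => Submodule.smul_mem _ _
        (single_mem_twistedChains (circle_admissible a hf)))
  · rw [SetLike.mem_coe, Submodule.mem_comap, map_add, map_sum, cPlus, boundary_single_segment]
    simp only [map_smul]
    have h1 := Submodule.sum_mem (nullChains (RapidDecayAt k) 0)
      (t := Finset.Icc 1 (k - i + 1)) fun a _ => Submodule.smul_mem _ (coeffC (k - i + 1) a)
        (boundary_circle_mem_nullChains (G := RapidDecayAt k) a hf)
    have h2 := single_vertex_mem_nullChains (G := RapidDecayAt k) (p := (1, 0)) (hp := by norm_num)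
      (isFlat_eMonomial (show i ≤ k by omega)) (Or.inr rfl)
      (rapidDecayAt_eMonomial rfl (by simpa using Real.pi_pos) hi)
    have h3 : ∑ a ∈ Finset.Icc 1 (k - i + 1), coeffC (k - i + 1) a •
        Finsupp.single (vertex (1 / 2, 0) (by norm_num)) (fun ζ => eMonomial k (i - 1)
          (ζ + 2 * Real.pi * Complex.I * a) - eMonomial k (i - 1) ζ) =
        Finsupp.single (vertex (1 / 2, 0) (by norm_num)) (eMonomial k i) := by
      simp only [Finsupp.smul_single, ← Finsupp.single_finsetSum]
      congr 1
      funext ζ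
      rw [← sum_coeffC_smul_eMonomial (by omega) (by omega), Finset.sum_apply]
      rfl
    simp only [smul_sub, Finset.sum_sub_distrib, h3] at h1
    convert Submodule.add_mem _ h1 h2 using 1
    abel

end Cycles

/-! ### The intersection numbers of `α_i` and `β_j` -/

section Values

variable {k : ℕ}

open SmoothSimplex

/-- The contribution of a simplex to the intersection number with `τ ⊗ f`. -/
def crossingForm (σ τ : SmoothSimplex 1) (f : MultiSection k) : MultiSection k →ₗ[ℂ] ℂ :=
  ∑ᶠ p ∈ crossings σ τ, ((SignType.sign (crossingDet σ τ p) : ℤ) : ℂ) •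
    (topForm k).flip (f (logCoord (τ.path p.2))) ∘ₗ LinearMap.proj (logCoord (σ.path p.1))

theorem crossingForm_apply {σ τ : SmoothSimplex 1} (h : (crossings σ τ).Finite)
    (e f : MultiSection k) : crossingForm σ τ f e = ∑ᶠ p ∈ crossings σ τ,
      ((SignType.sign (crossingDet σ τ p) : ℤ) : ℂ) *
        topPairing k (e (logCoord (σ.path p.1))) (f (logCoord (τ.path p.2))) := by
  rw [crossingForm, finsum_mem_eq_finite_toFinset_sum _ h, finsum_mem_eq_finite_toFinset_sum _ h,
    LinearMap.sum_apply]
  rfl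

/-- As a sum over the support the intersection number is not visibly additive, and in `α_i` the
simple circle occurs both in `α₀` and in the term `a = 1`. Finiteness of the crossings makes it a
linear functional. -/
theorem intersectionNumber_single_right {a : Chain k 1} {τ : SmoothSimplex 1}
    (h : ∀ σ ∈ a.support, (crossings σ τ).Finite) (f : MultiSection k) :
    intersectionNumber a (Finsupp.single τ f) =
      Finsupp.lsum ℂ (fun σ => crossingForm σ τ f) a := by
  rw [intersectionNumber, Finsupp.lsum_apply]
  refine Finsupp.sum_congr fun σ hσ => ?_
  rw [Finsupp.sum_single_index, crossingForm_apply (h σ hσ)]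
  have h0 : ∀ v : Fin (k + 1) → ℂ, topPairing k v 0 = 0 := fun v => by simp [topPairing]
  simp [h0]

theorem circle_path (n : ℕ) {s : ℝ} (hs : s ∈ Icc (0 : ℝ) 1) :
    (circle n).path s = (1 / 2, 2 * Real.pi * n * s) := by
  rw [circle, segment_path _ _ hs]
  ext
  · simp only [Prod.fst_add, Prod.smul_fst, smul_eq_mul]; ring
  · simp only [Prod.snd_add, Prod.smul_snd, smul_eq_mul]; ring

theorem diagonal_path {t : ℝ} (ht : t ∈ Icc (0 : ℝ) 1) :
    diagonal.path t = (t, t * (Real.pi / 2)) := by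
  rw [diagonal, segment_path _ _ ht]
  ext <;> simp

theorem cPlus_path {s : ℝ} (hs : s ∈ Icc (0 : ℝ) 1) : cPlus.path s = (1 / 2 + s / 2, 0) := by
  rw [cPlus, segment_path _ _ hs]
  ext
  · simp only [Prod.fst_add, Prod.smul_fst, smul_eq_mul]; ring
  · simp

/-- Equal radii force `t ≥ 1/2`, while equal angles modulo `2π` force `t = -4m`, which is impossible
for `t` in `(0, 1]`. -/
theorem crossings_cPlus_diagonal : crossings cPlus diagonal = ∅ := by
  refine eq_empty_of_forall_notMem ?_
  rintro ⟨s, t⟩ ⟨hs, ht, m, h⟩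
  have hpi := Real.pi_pos
  rw [cPlus_path hs, diagonal_path ht, Prod.ext_iff] at h
  simp only [Prod.fst_add, Prod.snd_add, add_zero] at h ht hs
  have h2 : t = -4 * m := by
    have : Real.pi * (t + 4 * m) = 0 := by linear_combination -2 * h.2
    linarith [(mul_eq_zero.1 this).resolve_left hpi.ne']
  have h3 : t ≠ 0 := by linarith [h.1, hs.1]
  have h4 : m < 0 := by
    have : (m : ℝ) < 0 := by linarith [lt_of_le_of_ne ht.1 h3.symm]
    exact_mod_cast this
  have h5 : (m : ℝ) ≤ -1 := by exact_mod_cast Int.le_sub_one_of_lt h4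
  linarith [ht.2]

/-- The parameters of the intersections of `c₀^n` with the diagonal path. -/
def circleCrossing (n m : ℕ) : ℝ × ℝ := ((1 / 8 + m) / n, 1 / 2)

theorem circleCrossing_mem {n m : ℕ} (h : m < n) : (circleCrossing n m).1 ∈ Ioo (0 : ℝ) 1 := by
  have hn : (m : ℝ) + 1 ≤ n := by exact_mod_cast h
  have hm : (0 : ℝ) ≤ m := Nat.cast_nonneg m
  have h0 : (0 : ℝ) < n := by linarith
  exact ⟨by unfold circleCrossing; positivity,
    by unfold circleCrossing; rw [div_lt_one h0]; linarith⟩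

theorem circle_path_circleCrossing {n m : ℕ} (h : m < n) :
    (circle n).path (circleCrossing n m).1 = diagonal.path (1 / 2) + turn m := by
  have h0 : (n : ℝ) ≠ 0 := Nat.cast_ne_zero.2 (by omega)
  rw [circle_path n (Ioo_subset_Icc_self (circleCrossing_mem h)), diagonal_path (by norm_num)]
  ext
  · simp [turn]
  · simp only [circleCrossing, turn, Prod.snd_add]
    push_cast
    field_simp
    ring

/-- The diagonal reaches `ρ = 1/2` at `t = 1/2` with angle `π/4`, an eighth of a turn; `c₀^n` passes
that angle once after each `m < n` full turns. -/
theorem crossings_circle_diagonal (n : ℕ) :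
    crossings (circle n) diagonal = circleCrossing n '' (Finset.range n : Set ℕ) := by
  have hpi := Real.pi_pos
  ext ⟨s, t⟩
  constructor
  · rintro ⟨hs, ht, m, h⟩
    rw [circle_path n hs, diagonal_path ht, Prod.ext_iff] at h
    simp only [Prod.fst_add, Prod.snd_add, add_zero] at h ht hs
    obtain ⟨h1, h2⟩ := h
    subst h1
    have h3 : (n : ℝ) * s = 1 / 8 + m := by
      have : Real.pi * ((n : ℝ) * s - (1 / 8 + m)) = 0 := by linear_combination h2 / 2
      linarith [(mul_eq_zero.1 this).resolve_left hpi.ne']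
    have hn : (0 : ℝ) ≤ n := Nat.cast_nonneg n
    have h4 : 0 ≤ m := by
      have : (-1 : ℝ) < m := by nlinarith [mul_nonneg hn hs.1]
      have : -1 < m := by exact_mod_cast this
      omega
    have h5 : m < n := by
      have : (m : ℝ) < n := by nlinarith [mul_le_mul_of_nonneg_left hs.2 hn]
      exact_mod_cast this
    obtain ⟨m, rfl⟩ := Int.eq_ofNat_of_zero_le h4
    have hmn : m < n := by exact_mod_cast h5
    refine ⟨m, by simpa using hmn, ?_⟩
    have h0 : (n : ℝ) ≠ 0 := Nat.cast_ne_zero.2 (by omega)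
    rw [circleCrossing]
    ext
    · simp only
      rw [div_eq_iff h0, mul_comm s]
      exact_mod_cast h3.symm
    · rfl
  · rintro ⟨m, hm, h⟩
    have hm' : m < n := by simpa using hm
    rw [← h]
    exact ⟨Ioo_subset_Icc_self (circleCrossing_mem hm'), by norm_num [circleCrossing], m,
      circle_path_circleCrossing hm'⟩

theorem crossingDet_circle_diagonal {n m : ℕ} (h : m < n) :
    crossingDet (circle n) diagonal (circleCrossing n m) < 0 := by
  have h0 : (0 : ℝ) < n := Nat.cast_pos.2 (by omega)
  have h1 : deriv (circle n).path (circleCrossing n m).1 = _ :=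
    deriv_segment_path _ _ (circleCrossing_mem h)
  have h2 : deriv diagonal.path (circleCrossing n m).2 = _ :=
    deriv_segment_path _ _ (by norm_num [circleCrossing])
  have hpi := Real.pi_pos
  rw [crossingDet, h1, h2]
  simp
  positivity

/-- At each crossing the circle moves in the angular direction and the diagonal outwards, so the
index is `-1`; the branch on the circle has made `m` turns there. -/
theorem crossingForm_circle (n : ℕ) {i j : ℕ} (hi : i ≤ k) (hj : j ≤ k) :
    crossingForm (circle n) diagonal (eMonomial k j) (eMonomial k i) =
      -((-1) ^ j * ((k - i).choose j : ℂ) / (k.choose j : ℂ) *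
        ∑ m ∈ Finset.range n, (m : ℂ) ^ (k - i - j)) := by
  have hinj : Set.InjOn (circleCrossing n) (Finset.range n : Set ℕ) := by
    intro m hm m' hm' h
    have h0 : (n : ℝ) ≠ 0 := by
      have : m < n := by simpa using hm
      exact Nat.cast_ne_zero.2 (by omega)
    have h1 := (div_left_inj' h0).1 (congrArg Prod.fst h)
    exact_mod_cast add_left_cancel h1
  rw [crossingForm_apply (by rw [crossings_circle_diagonal]; exact (Finset.finite_toSet _).image _),
    crossings_circle_diagonal, finsum_mem_image hinj, finsum_mem_coe_finset, Finset.mul_sum,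
    ← Finset.sum_neg_distrib]
  refine Finset.sum_congr rfl fun m hm => ?_
  rw [Finset.mem_range] at hm
  rw [sign_neg (crossingDet_circle_diagonal hm), circle_path_circleCrossing hm, logCoord_add_turn]
  have h := topPairing_eMonomial_turns hi hj m (logCoord (diagonal.path (1 / 2)))
  rw [← h]
  simp [circleCrossing]

/-- The simplices that occur in the cycles `α_i`. -/
def alphaSimplices : Set (SmoothSimplex 1) := insert cPlus (range circle)

theorem alphaChain_mem_supported (k i : ℕ) :
    alphaChain k i ∈ Finsupp.supported (MultiSection k) ℂ alphaSimplices := by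
  have hc : ∀ n e, Finsupp.single (circle n) e ∈
      Finsupp.supported (MultiSection k) ℂ alphaSimplices := fun n e =>
    Finsupp.single_mem_supported ℂ e (Or.inr ⟨n, rfl⟩)
  rw [alphaChain]
  split_ifs
  · exact hc _ _
  · exact Submodule.add_mem _ (Submodule.add_mem _ (Submodule.smul_mem _ _ (hc _ _))
      (Finsupp.single_mem_supported ℂ _ (Or.inl rfl)))
      (Submodule.sum_mem _ fun a _ => Submodule.smul_mem _ _ (hc _ _))

theorem finite_crossings_diagonal {σ : SmoothSimplex 1} (hσ : σ ∈ alphaSimplices) :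
    (crossings σ diagonal).Finite := by
  rcases hσ with rfl | ⟨n, rfl⟩
  · rw [crossings_cPlus_diagonal]; exact finite_empty
  · rw [crossings_circle_diagonal]; exact (Finset.finite_toSet _).image _

theorem inGeneralPosition_alphaChain (k i : ℕ) (f : MultiSection k) :
    InGeneralPosition (alphaChain k i) (Finsupp.single diagonal f) := by
  intro σ hσ τ hτ p hp
  rw [Finset.mem_singleton.1 (Finsupp.support_single_subset hτ)] at hp ⊢
  rcases alphaChain_mem_supported k i hσ with rfl | ⟨n, rfl⟩
  · rw [crossings_cPlus_diagonal] at hp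
    exact absurd hp (notMem_empty _)
  · rw [crossings_circle_diagonal] at hp
    obtain ⟨m, hm, rfl⟩ := hp
    have hm' : m < n := by simpa using hm
    have hmem := circleCrossing_mem hm'
    refine ⟨hmem, by norm_num [circleCrossing], ?_, (crossingDet_circle_diagonal hm').ne⟩
    rw [circle_path n (Ioo_subset_Icc_self hmem)]
    norm_num [openStrip]

theorem intersectionNumber_alphaChain (k i : ℕ) (f : MultiSection k) :
    intersectionNumber (alphaChain k i) (Finsupp.single diagonal f) =
      Finsupp.lsum ℂ (fun σ => crossingForm σ diagonal f) (alphaChain k i) :=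
  intersectionNumber_single_right
    (fun _ hσ => finite_crossings_diagonal (alphaChain_mem_supported k i hσ)) f

theorem crossingForm_circle_one {j : ℕ} (hj : j ≤ k) :
    crossingForm (circle 1) diagonal (eMonomial k j) (eMonomial k k) = if j = 0 then -1 else 0 := by
  rw [crossingForm_circle 1 le_rfl hj]
  split_ifs with h
  · simp [h]
  · rw [Nat.sub_self, Nat.choose_eq_zero_of_lt (Nat.pos_of_ne_zero h)]
    simp

theorem intersectionNumber_alphaChain_zero {j : ℕ} (hj : j ≤ k) :
    intersectionNumber (alphaChain k 0) (Finsupp.single diagonal (eMonomial k j)) =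
      if j = 0 then -1 else 0 := by
  rw [intersectionNumber_alphaChain, alphaChain, if_pos rfl, alphaZero, Finsupp.lsum_single,
    crossingForm_circle_one hj]

theorem intersectionNumber_alphaChain_pos {i j : ℕ} (hi : 1 ≤ i) (hij : i + j + 1 ≤ k) :
    intersectionNumber (alphaChain k i) (Finsupp.single diagonal (eMonomial k j)) =
      (-1 : ℂ) ^ (k - i) * (((k - i)! : ℂ) * ((k - j)! : ℂ) / (k ! : ℂ)) *
        ((bernoulli (k - i - j + 1) : ℚ) : ℂ) / ((k - i - j + 1)! : ℂ) := by
  -- `n` is the exponent of `e₁` in the sections on the circles, and `p = n - j` the power of `m` in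
  -- their pairing with `β_j`.
  obtain ⟨n, hn⟩ : ∃ n, n = k - i + 1 := ⟨_, rfl⟩
  obtain ⟨p, hp⟩ : ∃ p, p = k - i - j + 1 := ⟨_, rfl⟩
  have hnp : n = p + j := by omega
  have h0 : crossingForm cPlus diagonal (eMonomial k j) (eMonomial k i) = 0 := by
    rw [crossingForm_apply (by rw [crossings_cPlus_diagonal]; exact finite_empty),
      crossings_cPlus_diagonal, finsum_mem_empty]
  rw [intersectionNumber_alphaChain, alphaChain, if_neg (by omega), map_add, map_add, map_smul,
    map_sum, alphaZero, Finsupp.lsum_single, Finsupp.lsum_single, h0,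
    crossingForm_circle_one (by omega), ← hn, ← hp]
  have h1 : ∀ a ∈ Finset.Icc 1 n, Finsupp.lsum ℂ
      (fun σ => crossingForm σ diagonal (eMonomial k j))
      (coeffC n a • Finsupp.single (circle a) (eMonomial k (i - 1))) =
      -((-1) ^ j * (n.choose j : ℂ) / (k.choose j : ℂ)) *
        (coeffC n a * ∑ m ∈ Finset.range a, (m : ℂ) ^ p) := by
    intro a _
    rw [map_smul, Finsupp.lsum_single, crossingForm_circle a (by omega) (by omega),
      show k - (i - 1) = n by omega, show n - j = p by omega, smul_eq_mul]
    ring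
  rw [Finset.sum_congr rfl h1, ← Finset.mul_sum,
    sum_coeffC_mul_sum_pow (by omega) (by omega) (by omega),
    show k - i = n - 1 by omega, show n - 1 + 2 = n + 1 by omega]
  have hn0 : (n : ℂ) ≠ 0 := Nat.cast_ne_zero.2 (by omega)
  have hd : (if j = 0 then (-1 : ℂ) else 0) = -(if p = n then 1 else 0) := by
    by_cases h : j = 0
    · rw [if_pos h, if_pos (by omega)]
    · rw [if_neg h, if_neg (by omega), neg_zero]
  -- The top degree term of `sum_coeffC_mul_sum_pow` occurs only for `p = n`, that is `j = 0`, just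
  -- where `α₀` pairs nontrivially; the coefficient of `α₀` in `α_i` is the one that cancels it.
  have hcancel : (n.choose j : ℂ) / (k.choose j : ℂ) * (-1) ^ j *
      (if p = n then (-1) ^ (n - 1) * ((n - 1)! : ℂ) / ((n + 1 : ℕ) : ℂ) else 0) =
      ((-1 : ℂ) ^ (n - 1) * ((n - 1)! : ℂ)) / ((n + 1 : ℕ) : ℂ) * (if p = n then 1 else 0) := by
    split_ifs with h
    · rw [show j = 0 by omega]; simp
    · simp
  -- Since `p ≥ 2`, the Bernoulli number vanishes unless `p` is even, and then `n = p + j` has the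
  -- parity of `j`.
  have hsign : (-1 : ℂ) ^ (n - 1) * ((bernoulli p : ℚ) : ℂ) =
      -((-1) ^ j * ((bernoulli p : ℚ) : ℂ)) := by
    rcases p.even_or_odd with he | ho
    · obtain ⟨q, rfl⟩ : ∃ q, n = q + 1 := ⟨n - 1, by omega⟩
      have : (-1 : ℂ) ^ (q + 1) = (-1) ^ j := by rw [hnp, pow_add, he.neg_one_pow, one_mul]
      rw [← this, pow_succ, Nat.add_sub_cancel]
      ring
    · rw [bernoulli_eq_zero_of_odd ho (by omega)]
      simp
  have hbinom : (n.choose j : ℂ) / (k.choose j : ℂ) / n =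
      ((n - 1)! : ℂ) * ((k - j)! : ℂ) / (k ! : ℂ) / (p ! : ℂ) := by
    rw [Nat.cast_choose ℂ (show j ≤ n by omega), Nat.cast_choose ℂ (show j ≤ k by omega),
      show n - j = p by omega, ← Nat.mul_factorial_pred (show n ≠ 0 by omega)]
    have hf : ∀ m : ℕ, (m ! : ℂ) ≠ 0 := fun m => Nat.cast_ne_zero.2 (Nat.factorial_ne_zero _)
    have := hf j; have := hf p; have := hf k; have := hf (k - j); have := hf (n - 1)
    push_cast
    field_simp
  rw [hd, smul_eq_mul]
  linear_combination (-hcancel) - (-1) ^ j * ((bernoulli p : ℚ) : ℂ) * hbinom -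
    ((n - 1)! : ℂ) * ((k - j)! : ℂ) / (k ! : ℂ) / (p ! : ℂ) * hsign

end Values

end

end KloostermanBetti

/-- For `k ≥ 1`, with `k' = ⌊(k - 1) / 2⌋`, the chains `α_i` (`0 ≤ i ≤ k'`) are rapid decay cycles,
the chains `β_j` (`0 ≤ j ≤ ⌊k / 2⌋`) are moderate growth cycles, and the Betti intersection pairing
takes the stated values on their classes. -/
theorem mainTheorem3 (k : ℕ) (hk : 1 ≤ k) :
    ∃ (hα : ∀ i : ℕ, i ≤ (k - 1) / 2 →
        KloostermanBetti.alphaChain k i ∈ KloostermanBetti.rdCycles k)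
      (hβ : ∀ j : ℕ, j ≤ k / 2 →
        KloostermanBetti.betaChain k j ∈ KloostermanBetti.modCycles k),
      (∀ (j : ℕ) (hj : j ≤ k / 2),
        KloostermanBetti.HasBettiPairing
          (KloostermanBetti.homologyClass (KloostermanBetti.alphaChain k 0) (hα 0 (Nat.zero_le _)))
          (KloostermanBetti.homologyClass (KloostermanBetti.betaChain k j) (hβ j hj))
          (if j = 0 then -1 else 0)) ∧
      ∀ (i j : ℕ) (_ : 1 ≤ i) (hi : i ≤ (k - 1) / 2) (hj : j ≤ k / 2),
        KloostermanBetti.HasBettiPairing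
          (KloostermanBetti.homologyClass (KloostermanBetti.alphaChain k i) (hα i hi))
          (KloostermanBetti.homologyClass (KloostermanBetti.betaChain k j) (hβ j hj))
          ((-1 : ℂ) ^ (k - i) * (((k - i)! : ℂ) * ((k - j)! : ℂ) / (k ! : ℂ)) *
            ((bernoulli (k - i - j + 1) : ℚ) : ℂ) / ((k - i - j + 1)! : ℂ)) := by
  have hα : ∀ i : ℕ, i ≤ (k - 1) / 2 → 2 * i < k := fun i hi => by omega
  have hβ : ∀ j : ℕ, j ≤ k / 2 → 2 * j ≤ k := fun j hj => by omega
  refine ⟨fun i hi => KloostermanBetti.alphaChain_mem_rdCycles (hα i hi),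
    fun j hj => KloostermanBetti.betaChain_mem_modCycles (hβ j hj), fun j hj => ?_,
    fun i j hi1 hi hj => ?_⟩
  -- General position is reached by moving `β_j` only; `α_i` represents its own class.
  · rw [← KloostermanBetti.intersectionNumber_alphaChain_zero (show j ≤ k by omega)]
    exact KloostermanBetti.hasBettiPairing_of_generalPosition rfl
      (KloostermanBetti.homologyClass_diagonal (hβ j hj))
      (KloostermanBetti.inGeneralPosition_alphaChain k 0 _)
  -- For either parity of `k` the bounds on `i` and `j` give `i + j ≤ k - 1`, so the Bernoulli index
  -- is at least two.
  · rw [← KloostermanBetti.intersectionNumber_alphaChain_pos hi1 (by omega)]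
    exact KloostermanBetti.hasBettiPairing_of_generalPosition rfl
      (KloostermanBetti.homologyClass_diagonal (hβ j hj))
      (KloostermanBetti.inGeneralPosition_alphaChain k i _)
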